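/- **Setting.** Let $A_{11}\in\mathbb R^{d_\theta\times d_\theta}$, $A_{12}\in\mathbb R^{d_\theta\times d_w}$, $A_{21}\in\mathbb R^{d_w\times d_\theta}$, $A_{22}\in\mathbb R^{d_w\times d_w}$, $b_1\in\mathbb R^{d_\theta}$, $b_2\in\mathbb R^{d_w}$ be such that $-A_{22}$ and $-\Delta$ are Hurwitz, where $\Delta=A_{11}-A_{12}A_{22}^{-1}A_{21}$. Put $\theta^\star=\Delta^{-1}(b_1-A_{12}A_{22}^{-1}b_2)$ and $w^\star=A_{22}^{-1}(b_2-A_{21}\theta^\star)$. Let $Q_{22},Q_\Delta$ be the symmetric positive definite solutions of $A_{22}^\top Q_{22}+Q_{22}A_{22}=\mathrm I$ and $\Delta^\top Q_\Delta+Q_\Delta\Delta=\mathrm I$, and put $a_{22}=1/(4\|Q_{22}\|)$, $a_\Delta=1/(4\|Q_\Delta\|)$ (operator norms). Let $X_1,X_2,\dots$ be random elements of a measurable space $\mathsf X$, let $\mathbf A_{ij}(\cdot),\mathbf b_i(\cdot)$ be measurable matrix- and vector-valued functions on $\mathsf X$, and write $\mathbf A_{ij}^k=\mathbf A_{ij}(X_k)$,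 $\mathbf b_i^k=\mathbf b_i(X_k)$. For deterministic $\theta_0,w_0$ and step sizes $$\beta_k=c_{0,\beta}(k+k_0)^{-b},\qquad \gamma_k=c_{0,\gamma}(k+k_0)^{-a},\qquad \tfrac12<a<b<1,\quad c_{0,\beta},c_{0,\gamma}>0,$$ let, for $k\ge0$, $$\theta_{k+1}=\theta_k+\beta_k\{\mathbf b_1^{k+1}-\mathbf A_{11}^{k+1}\theta_k-\mathbf A_{12}^{k+1}w_k\},\qquad w_{k+1}=w_k+\gamma_k\{\mathbf b_2^{k+1}-\mathbf A_{21}^{k+1}\theta_k-\mathbf A_{22}^{k+1}w_k\}.$$ Put $\mathcal F_k=\sigma(X_1,\dots,X_k)$ ($\mathcal F_0$ trivial), $\varepsilon_V^{k}=\mathbf b_1^{k}-\mathbf A_{11}^{k}\theta^\star-\mathbf A_{12}^{k}w^\star$, $\varepsilon_W^{k}=\mathbf b_2^{k}-\mathbf A_{21}^{k}\theta^\star-\mathbf A_{22}^{k}w^\star$, and $$V_{k+1}=\varepsilon_V^{k+1}-(\mathbf A_{11}^{k+1}-A_{11})(\theta_k-\theta^\star)-(\mathbf A_{12}^{k+1}-A_{12})(w_k-w^\star),$$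 $$W_{k+1}=\varepsilon_W^{k+1}-(\mathbf A_{21}^{k+1}-A_{21})(\theta_k-\theta^\star)-(\mathbf A_{22}^{k+1}-A_{22})(w_k-w^\star).$$ Define $L_0=0$, $U_k=\Delta-A_{12}L_k$, $$L_{k+1}=\big(L_k-\gamma_kA_{22}L_k+\beta_kA_{22}^{-1}A_{21}U_k\big)(\mathrm I-\beta_kU_k)^{-1},$$ and the decoupled errors $\tilde\theta_k=\theta_k-\theta^\star$, $\tilde w_k=w_k-w^\star+(L_k+A_{22}^{-1}A_{21})\tilde\theta_k$. **Assumptions** (for a real $p\ge2$). 1. $\mathbb E[V_{k+1}\mid\mathcal F_k]=0$ and $\mathbb E[W_{k+1}\mid\mathcal F_k]=0$ for all $k\ge0$. 2. For all $k\ge0$, with constants $m_V,m_W>0$ not depending on $p$ and $k$: $\mathbb E^{1/p}\|V_{k+1}\|^p\le m_V(1+\mathbb E^{1/p}\|\theta_k-\theta^\star\|^p+\mathbb E^{1/p}\|w_k-w^\star\|^p)$, and the same for $W_{k+1}$ with $m_W$. 3. $\mathbb E[\varepsilon_V^{k+1}\mid\mathcal F_k]=0$ and $\mathbb E[\varepsilon_W^{k+1}\mid\mathcal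 F_k]=0$ for all $k\ge 0$, and there are constant matrices $\Sigma_V,\Sigma_W,\Sigma_{VW}$ which for every $k>0$ are the conditional expectations given $\mathcal F_k$ of $\varepsilon_V^{k+1}(\varepsilon_V^{k+1})^\top$, $\varepsilon_W^{k+1}(\varepsilon_W^{k+1})^\top$, $\varepsilon_V^{k+1}(\varepsilon_W^{k+1})^\top$. 4. $\|\mathbf A_{ij}(x)\|$, $\|\mathbf A_{ij}(x)-A_{ij}\|$, $\|\mathbf b_i(x)\|$, $\|\mathbf b_i(x)-b_i\|$ are bounded uniformly in $x\in\mathsf X$, for all $i,j\in\{1,2\}$. **Statement.** There is $r>0$, depending only on the matrices and vectors of the system and on $a,b$, such that whenever $c_{0,\beta}/c_{0,\gamma}\le r$ the following holds. There is $K>0$, depending only on these data, $c_{0,\beta},c_{0,\gamma},m_V,m_W$, and there is $C>0$, depending in addition only on $\theta_0,w_0$, such that for every real $p\ge2$ and every real $k_0\ge K\,p^{4/b}$ all the matrices $\mathrm I-\beta_kU_k$ are invertible (so that $L_k$ is well defined), and, whenever assumptions 1–4 hold, for all $k\ge0$ $$\mathbb E^{1/p}\|\tilde\theta_{k+1}\|^p\le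 C\Big(\prod_{j=0}^{k}\big(1-\tfrac{a_\Delta}{8}\beta_j\big)+p^2\beta_k^{1/2}\Big),\qquad \mathbb E^{1/p}\|\tilde w_{k+1}\|^p\le C\Big(\prod_{j=0}^{k}\big(1-\tfrac{a_{22}}{8}\gamma_j\big)+p^3\gamma_k^{1/2}\Big).$$ In particular $K$ and $C$ depend neither on $p$ nor on $k$, and $C$ does not depend on $k_0$. -/

import Mathlib

open MeasureTheory
open scoped Matrix Matrix.Norms.L2Operator

universe u v

/-- A square real matrix is Hurwitz if all its complex eigenvalues have negative real part. -/
def IsHurwitz {d : ℕ} (M : Matrix (Fin d) (Fin d) ℝ) : Prop :=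
  ∀ z ∈ spectrum ℂ (M.map (algebraMap ℝ ℂ)), z.re < 0

open Classical in
/-- The symmetric positive definite solution `Q` of the Lyapunov equation `Aᵀ Q + Q A = I`
(it exists and is unique when `-A` is Hurwitz; the value is `0` if there is no solution). -/
noncomputable def lyapunovQ {d : ℕ} (A : Matrix (Fin d) (Fin d) ℝ) :
    Matrix (Fin d) (Fin d) ℝ :=
  if h : ∃ Q : Matrix (Fin d) (Fin d) ℝ, Q.PosDef ∧ Aᵀ * Q + Q * A = 1 then h.choose else 0

/-- The contraction rate `1 / (4 ‖Q‖)`, with `Q` the Lyapunov matrix of `A` and `‖·‖` the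
operator norm. -/
noncomputable def contractionRate {d : ℕ} (A : Matrix (Fin d) (Fin d) ℝ) : ℝ :=
  1 / (4 * ‖lyapunovQ A‖)

/-- Polynomial step sizes `c (k + k₀)^{-e}`. -/
noncomputable def stepSize (c e k₀ : ℝ) (k : ℕ) : ℝ := c * ((k : ℝ) + k₀) ^ (-e)

/-- The deterministic linear system
`A₁₁ θ + A₁₂ w = b₁`, `A₂₁ θ + A₂₂ w = b₂`. -/
structure LinSystem (dθ dw : ℕ) where
  A11 : Matrix (Fin dθ) (Fin dθ) ℝ
  A12 : Matrix (Fin dθ) (Fin dw) ℝ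
  A21 : Matrix (Fin dw) (Fin dθ) ℝ
  A22 : Matrix (Fin dw) (Fin dw) ℝ
  b1 : EuclideanSpace ℝ (Fin dθ)
  b2 : EuclideanSpace ℝ (Fin dw)

namespace LinSystem

variable {dθ dw : ℕ} (S : LinSystem dθ dw)

/-- The Schur complement `Δ = A₁₁ - A₁₂ A₂₂⁻¹ A₂₁`. -/
noncomputable def Δ : Matrix (Fin dθ) (Fin dθ) ℝ := S.A11 - S.A12 * S.A22⁻¹ * S.A21

/-- `θ⋆ = Δ⁻¹ (b₁ - A₁₂ A₂₂⁻¹ b₂)`. -/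
noncomputable def θstar : EuclideanSpace ℝ (Fin dθ) :=
  (S.Δ⁻¹).toEuclideanLin (S.b1 - (S.A12 * S.A22⁻¹).toEuclideanLin S.b2)

/-- `w⋆ = A₂₂⁻¹ (b₂ - A₂₁ θ⋆)`. -/
noncomputable def wstar : EuclideanSpace ℝ (Fin dw) :=
  (S.A22⁻¹).toEuclideanLin (S.b2 - S.A21.toEuclideanLin S.θstar)

/-- `a_Δ = 1 / (4 ‖Q_Δ‖)`. -/
noncomputable def aΔ : ℝ := contractionRate S.Δ

/-- `a₂₂ = 1 / (4 ‖Q₂₂‖)`. -/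
noncomputable def a22 : ℝ := contractionRate S.A22

/-- The decoupling matrices: `L₀ = 0` and
`L_{k+1} = (L_k - γ_k A₂₂ L_k + β_k A₂₂⁻¹ A₂₁ U_k) (I - β_k U_k)⁻¹`, `U_k = Δ - A₁₂ L_k`. -/
noncomputable def L (β γ : ℕ → ℝ) : ℕ → Matrix (Fin dw) (Fin dθ) ℝ
  | 0 => 0
  | k + 1 =>
    (L β γ k - γ k • (S.A22 * L β γ k)
        + β k • (S.A22⁻¹ * S.A21 * (S.Δ - S.A12 * L β γ k)))
      * (1 - β k • (S.Δ - S.A12 * L β γ k))⁻¹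

/-- `U_k = Δ - A₁₂ L_k`. -/
noncomputable def U (β γ : ℕ → ℝ) (k : ℕ) : Matrix (Fin dθ) (Fin dθ) ℝ :=
  S.Δ - S.A12 * S.L β γ k

end LinSystem

/-- The stochastic estimates `𝐀ᵢⱼ(x)`, `𝐛ᵢ(x)` of the matrices and vectors of the system. -/
structure Oracle (𝒳 : Type v) (dθ dw : ℕ) where
  A11 : 𝒳 → Matrix (Fin dθ) (Fin dθ) ℝ
  A12 : 𝒳 → Matrix (Fin dθ) (Fin dw) ℝ
  A21 : 𝒳 → Matrix (Fin dw) (Fin dθ) ℝ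
  A22 : 𝒳 → Matrix (Fin dw) (Fin dw) ℝ
  b1 : 𝒳 → EuclideanSpace ℝ (Fin dθ)
  b2 : 𝒳 → EuclideanSpace ℝ (Fin dw)

/-- All the estimates are measurable functions (matrices: entry by entry). -/
def Oracle.IsMeasurable {𝒳 : Type v} [MeasurableSpace 𝒳] {dθ dw : ℕ} (O : Oracle 𝒳 dθ dw) :
    Prop :=
  (∀ i j, Measurable fun x => O.A11 x i j) ∧ (∀ i j, Measurable fun x => O.A12 x i j) ∧
  (∀ i j, Measurable fun x => O.A21 x i j) ∧ (∀ i j, Measurable fun x => O.A22 x i j) ∧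
  Measurable O.b1 ∧ Measurable O.b2

/-- Uniform boundedness of the estimates and of their deviations from the true values. -/
def Oracle.IsBounded {𝒳 : Type v} {dθ dw : ℕ} (O : Oracle 𝒳 dθ dw) (S : LinSystem dθ dw) :
    Prop :=
  ∃ C_A > 0, ∃ C_b > 0, ∀ x,
    max ‖O.A11 x‖ ‖O.A11 x - S.A11‖ ≤ C_A ∧ max ‖O.A12 x‖ ‖O.A12 x - S.A12‖ ≤ C_A ∧
    max ‖O.A21 x‖ ‖O.A21 x - S.A21‖ ≤ C_A ∧ max ‖O.A22 x‖ ‖O.A22 x - S.A22‖ ≤ C_A ∧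
    max ‖O.b1 x‖ ‖O.b1 x - S.b1‖ ≤ C_b ∧ max ‖O.b2 x‖ ‖O.b2 x - S.b2‖ ≤ C_b

/-- The data of a linear two-timescale stochastic approximation scheme: the system, the
estimates, the driving random elements `X_1, X_2, …` (`X 0` is not used), the step sizes and the
deterministic starting point. -/
structure TTSA (Ω : Type u) (𝒳 : Type v) (dθ dw : ℕ) where
  sys : LinSystem dθ dw
  oracle : Oracle 𝒳 dθ dw
  X : ℕ → Ω → 𝒳
  β : ℕ → ℝ
  γ : ℕ → ℝ
  θ₀ : EuclideanSpace ℝ (Fin dθ)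
  w₀ : EuclideanSpace ℝ (Fin dw)

namespace TTSA

variable {Ω : Type u} {𝒳 : Type v} {dθ dw : ℕ} (T : TTSA Ω 𝒳 dθ dw)

/-- The pair of iterates `(θ_k, w_k)`:
`θ_{k+1} = θ_k + β_k (𝐛₁(X_{k+1}) - 𝐀₁₁(X_{k+1}) θ_k - 𝐀₁₂(X_{k+1}) w_k)`,
`w_{k+1} = w_k + γ_k (𝐛₂(X_{k+1}) - 𝐀₂₁(X_{k+1}) θ_k - 𝐀₂₂(X_{k+1}) w_k)`. -/
noncomputable def iter : ℕ → Ω → EuclideanSpace ℝ (Fin dθ) × EuclideanSpace ℝ (Fin dw)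
  | 0, _ => (T.θ₀, T.w₀)
  | k + 1, ω =>
    ((iter k ω).1 + T.β k • (T.oracle.b1 (T.X (k + 1) ω)
        - (T.oracle.A11 (T.X (k + 1) ω)).toEuclideanLin (iter k ω).1
        - (T.oracle.A12 (T.X (k + 1) ω)).toEuclideanLin (iter k ω).2),
     (iter k ω).2 + T.γ k • (T.oracle.b2 (T.X (k + 1) ω)
        - (T.oracle.A21 (T.X (k + 1) ω)).toEuclideanLin (iter k ω).1
        - (T.oracle.A22 (T.X (k + 1) ω)).toEuclideanLin (iter k ω).2))

/-- The slow error `θ̃_k = θ_k - θ⋆`. -/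
noncomputable def θtilde (k : ℕ) (ω : Ω) : EuclideanSpace ℝ (Fin dθ) :=
  (T.iter k ω).1 - T.sys.θstar

/-- The fast error `w_k - w⋆`, before decoupling. -/
noncomputable def werr (k : ℕ) (ω : Ω) : EuclideanSpace ℝ (Fin dw) :=
  (T.iter k ω).2 - T.sys.wstar

/-- The decoupled fast error `w̃_k = w_k - w⋆ + D_{k-1} θ̃_k`, where
`D_{k-1} = L_k + A₂₂⁻¹ A₂₁`. -/
noncomputable def wtilde (k : ℕ) (ω : Ω) : EuclideanSpace ℝ (Fin dw) :=
  T.werr k ω +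
    (T.sys.L T.β T.γ k + T.sys.A22⁻¹ * T.sys.A21).toEuclideanLin (T.θtilde k ω)

/-- `ε_V^k = 𝐛₁(X_k) - 𝐀₁₁(X_k) θ⋆ - 𝐀₁₂(X_k) w⋆`. -/
noncomputable def εV (k : ℕ) (ω : Ω) : EuclideanSpace ℝ (Fin dθ) :=
  T.oracle.b1 (T.X k ω) - (T.oracle.A11 (T.X k ω)).toEuclideanLin T.sys.θstar
    - (T.oracle.A12 (T.X k ω)).toEuclideanLin T.sys.wstar

/-- `ε_W^k = 𝐛₂(X_k) - 𝐀₂₁(X_k) θ⋆ - 𝐀₂₂(X_k) w⋆`. -/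
noncomputable def εW (k : ℕ) (ω : Ω) : EuclideanSpace ℝ (Fin dw) :=
  T.oracle.b2 (T.X k ω) - (T.oracle.A21 (T.X k ω)).toEuclideanLin T.sys.θstar
    - (T.oracle.A22 (T.X k ω)).toEuclideanLin T.sys.wstar

/-- The noise `V_{k+1}`, as a function of `k`:
`V_{k+1} = ε_V^{k+1} - (𝐀₁₁(X_{k+1}) - A₁₁)(θ_k - θ⋆) - (𝐀₁₂(X_{k+1}) - A₁₂)(w_k - w⋆)`. -/
noncomputable def Vsucc (k : ℕ) (ω : Ω) : EuclideanSpace ℝ (Fin dθ) :=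
  T.εV (k + 1) ω
    - (T.oracle.A11 (T.X (k + 1) ω) - T.sys.A11).toEuclideanLin (T.θtilde k ω)
    - (T.oracle.A12 (T.X (k + 1) ω) - T.sys.A12).toEuclideanLin (T.werr k ω)

/-- The noise `W_{k+1}`, as a function of `k`:
`W_{k+1} = ε_W^{k+1} - (𝐀₂₁(X_{k+1}) - A₂₁)(θ_k - θ⋆) - (𝐀₂₂(X_{k+1}) - A₂₂)(w_k - w⋆)`. -/
noncomputable def Wsucc (k : ℕ) (ω : Ω) : EuclideanSpace ℝ (Fin dw) :=
  T.εW (k + 1) ω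
    - (T.oracle.A21 (T.X (k + 1) ω) - T.sys.A21).toEuclideanLin (T.θtilde k ω)
    - (T.oracle.A22 (T.X (k + 1) ω) - T.sys.A22).toEuclideanLin (T.werr k ω)

/-- `ℱ_k = σ(X_1, …, X_k)`; `ℱ_0` is trivial. -/
@[reducible] def ℱ [MeasurableSpace 𝒳] (k : ℕ) : MeasurableSpace Ω :=
  ⨆ i ∈ Finset.Icc 1 k, MeasurableSpace.comap (T.X i) inferInstance

variable [MeasurableSpace Ω] [MeasurableSpace 𝒳] (μ : Measure Ω)

/-- The noise terms have zero conditional mean: `E[V_{k+1} | ℱ_k] = 0`, `E[W_{k+1} | ℱ_k] = 0`. -/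
def ZeroMean : Prop :=
  ∀ k, μ[T.Vsucc k | T.ℱ k] =ᵐ[μ] 0 ∧ μ[T.Wsucc k | T.ℱ k] =ᵐ[μ] 0

/-- The moment bounds, for a given `p`, with constants `m_V`, `m_W`:
`E^{1/p}‖V_{k+1}‖^p ≤ m_V (1 + E^{1/p}‖θ_k - θ⋆‖^p + E^{1/p}‖w_k - w⋆‖^p)` and the same for `W`.
The quantity `E^{1/p}‖f‖^p` is `eLpNorm f p μ`. -/
def MomentBound (p m_V m_W : ℝ) : Prop :=
  ∀ k,
    eLpNorm (T.Vsucc k) (ENNReal.ofReal p) μ ≤ ENNReal.ofReal m_V *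
      (1 + eLpNorm (T.θtilde k) (ENNReal.ofReal p) μ
        + eLpNorm (T.werr k) (ENNReal.ofReal p) μ) ∧
    eLpNorm (T.Wsucc k) (ENNReal.ofReal p) μ ≤ ENNReal.ofReal m_W *
      (1 + eLpNorm (T.θtilde k) (ENNReal.ofReal p) μ
        + eLpNorm (T.werr k) (ENNReal.ofReal p) μ)

/-- `ε_V^{k+1}`, `ε_W^{k+1}` have zero conditional mean given `ℱ_k`, and, for `k > 0`, constant
conditional (cross-)covariance matrices `Σ_V`, `Σ_W`, `Σ_VW` (written entry by entry). -/
def ConstantCovariance : Prop :=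
  (∀ k, μ[T.εV (k + 1) | T.ℱ k] =ᵐ[μ] 0 ∧ μ[T.εW (k + 1) | T.ℱ k] =ᵐ[μ] 0) ∧
  ∃ (SV : Matrix (Fin dθ) (Fin dθ) ℝ) (SW : Matrix (Fin dw) (Fin dw) ℝ)
    (SVW : Matrix (Fin dθ) (Fin dw) ℝ), ∀ k > 0,
    (∀ i j, μ[fun ω => T.εV (k + 1) ω i * T.εV (k + 1) ω j | T.ℱ k] =ᵐ[μ] fun _ => SV i j) ∧
    (∀ i j, μ[fun ω => T.εW (k + 1) ω i * T.εW (k + 1) ω j | T.ℱ k] =ᵐ[μ] fun _ => SW i j) ∧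
    (∀ i j, μ[fun ω => T.εV (k + 1) ω i * T.εW (k + 1) ω j | T.ℱ k] =ᵐ[μ] fun _ => SVW i j)

end TTSA

/-! Write ρ_k = β_k / γ_k. The matrices L_k are built so that w̃ obeys a recursion in which θ̃ does
not occur (`TTSA.wtilde_succ`), and w̃ contracts at a rate of order γ_k. The slow error contracts at
a rate of order β_k, but it is driven by -β_k A₁₂ w̃_k; as w̃ has size γ^{1/2}, a direct estimate of
θ̃ gives only γ^{1/2}. The remedy is the corrected error z_k = θ̃_k - ρ_k A₁₂ A₂₂⁻¹ w̃_k: since ρ_k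
γ_k = β_k, the drive cancels against the drift of w̃, and a remainder of order β_k ρ_k w̃_k is left
(`TTSA.zerr_succ`).

Contraction is measured in norms ‖B ·‖ with Q = BᵀB the Lyapunov matrix
(`IsHurwitz.exists_lyapunov_factor`). For conditionally centred noise D, two-smoothness of L^p gives
‖X + D‖_p² ≤ ‖X‖_p² + 6p ‖D‖_p² (`sq_lpNorm_add_le`). Hence the squared moments Y of w̃ and Z of z
satisfy scalar recursions with noise p γ² (1 + Z + Y) and p β² (1 + Z + Y).

The combination Z + ρ² Y closes up: ρ² γ² = β², and the coupling is absorbed by the fast contraction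
because β is much smaller than γ. This bounds Z + ρ² Y by a squared product plus a multiple of p β;
so Z stays bounded, and then Y is bounded by a squared product plus a multiple of p γ
(`exists_bound_of_two_timescale`). Square roots give a factor p^{1/2}, which is better than p² and
p³. That pβ, pγ and ρ are small and that the steps vary slowly follows from k₀ ≥ K p^{4/b}
(`exists_smallSteps`). -/

/-! ### Operator norms of real matrices -/

section MatrixNorm

variable {l m n : ℕ}

theorem Matrix.norm_toEuclideanLin_le (M : Matrix (Fin m) (Fin n) ℝ)
    (x : EuclideanSpace ℝ (Fin n)) : ‖M.toEuclideanLin x‖ ≤ ‖M‖ * ‖x‖ := by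
  have := Matrix.l2_opNorm_mulVec M x
  simpa [Matrix.toLpLin_apply] using this

theorem Matrix.toEuclideanLin_mul_apply (M : Matrix (Fin l) (Fin m) ℝ)
    (N : Matrix (Fin m) (Fin n) ℝ) (x : EuclideanSpace ℝ (Fin n)) :
    (M * N).toEuclideanLin x = M.toEuclideanLin (N.toEuclideanLin x) := by
  simp [Matrix.toLpLin_apply, Matrix.mulVec_mulVec]

theorem Matrix.toEuclideanLin_one_apply (x : EuclideanSpace ℝ (Fin n)) :
    (1 : Matrix (Fin n) (Fin n) ℝ).toEuclideanLin x = x := by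
  simp

theorem Matrix.l2_opNorm_le_bound (M : Matrix (Fin m) (Fin n) ℝ) {c : ℝ} (hc : 0 ≤ c)
    (h : ∀ x, ‖M.toEuclideanLin x‖ ≤ c * ‖x‖) : ‖M‖ ≤ c := by
  rw [Matrix.l2_opNorm_def]
  exact ContinuousLinearMap.opNorm_le_bound _ hc h

/-- Real vectors embed isometrically into complex ones. This lets the spectral radius formula, which
needs complex scalars, control powers of a real matrix. -/
theorem Matrix.l2_opNorm_le_map_complex (M : Matrix (Fin m) (Fin n) ℝ) :
    ‖M‖ ≤ ‖M.map (algebraMap ℝ ℂ)‖ := by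
  refine Matrix.l2_opNorm_le_bound M (norm_nonneg _) fun x => ?_
  have h := Matrix.l2_opNorm_mulVec (M.map (algebraMap ℝ ℂ))
    (WithLp.toLp 2 fun i => ((x i : ℝ) : ℂ))
  have h1 : ‖(WithLp.toLp 2 fun i => ((x i : ℝ) : ℂ) : EuclideanSpace ℂ (Fin n))‖ = ‖x‖ := by
    simp [EuclideanSpace.norm_eq]
  have h2 : M.map (algebraMap ℝ ℂ) *ᵥ (fun i => ((x i : ℝ) : ℂ))
      = fun i => ((M *ᵥ x.ofLp) i : ℂ) := by
    ext i
    simp [Matrix.mulVec, dotProduct]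
  rw [h1] at h
  refine le_trans (le_of_eq ?_) h
  simp only [h2]
  simp [EuclideanSpace.norm_eq, Matrix.toLpLin_apply]

theorem Matrix.inner_transpose_left (M : Matrix (Fin m) (Fin n) ℝ)
    (x : EuclideanSpace ℝ (Fin m)) (y : EuclideanSpace ℝ (Fin n)) :
    inner ℝ (Mᵀ.toEuclideanLin x) y = inner ℝ x (M.toEuclideanLin y) := by
  simp only [Matrix.toLpLin_apply, EuclideanSpace.inner_eq_star_dotProduct, star_trivial]
  rw [Matrix.mulVec_transpose, dotProduct_comm, ← Matrix.dotProduct_mulVec, dotProduct_comm]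

end MatrixNorm

/-! ### Lyapunov equation and contraction of Euler steps -/

section Lyapunov

variable {d : ℕ}

open Filter Topology in
/-- Powers of a real matrix with spectral radius less than one decay geometrically. -/
theorem Matrix.exists_pow_norm_le {C : Matrix (Fin d) (Fin d) ℝ}
    (h : ∀ z ∈ spectrum ℂ (C.map (algebraMap ℝ ℂ)), ‖z‖ < 1) :
    ∃ s : ℝ, 0 ≤ s ∧ s < 1 ∧ ∀ᶠ n : ℕ in atTop, ‖C ^ n‖ ≤ s ^ n := by
  rcases isEmpty_or_nonempty (Fin d) with he | he
  · refine ⟨0, le_rfl, one_pos, Eventually.of_forall fun n => ?_⟩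
    rw [Subsingleton.elim (C ^ n) 0]
    simp only [norm_zero]
    positivity
  set A := C.map (algebraMap ℝ ℂ) with hA
  have hr : spectralRadius ℂ A < 1 := by
    have := spectrum.spectralRadius_lt_of_forall_lt A (r := 1) (fun z hz => by
      have := h z hz
      exact_mod_cast this)
    simpa using this
  -- By Gelfand's formula the roots ‖Aⁿ‖^{1/n} converge to the spectral radius, so any s strictly
  -- between it and 1 eventually bounds them.
  obtain ⟨s, hs1, hs2⟩ := ENNReal.lt_iff_exists_nnreal_btwn.1 hr
  have hG := (spectrum.pow_nnnorm_pow_one_div_tendsto_nhds_spectralRadius A).eventually_lt_const hs1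
  refine ⟨s, s.2, by exact_mod_cast hs2, ?_⟩
  filter_upwards [hG, eventually_gt_atTop 0] with n hn hn0
  have h1 : ((‖A ^ n‖₊ : ENNReal) ^ (1 / (n : ℝ))) ^ (n : ℝ) ≤ (s : ENNReal) ^ (n : ℝ) :=
    ENNReal.rpow_le_rpow hn.le (by positivity)
  rw [← ENNReal.rpow_mul, one_div, inv_mul_cancel₀ (by positivity), ENNReal.rpow_one,
    ENNReal.rpow_natCast] at h1
  have h2 : ‖A ^ n‖ ≤ (s : ℝ) ^ n := by exact_mod_cast h1
  refine le_trans (Matrix.l2_opNorm_le_map_complex _) (le_trans (le_of_eq ?_) h2)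
  rw [hA]
  congr 1
  exact map_pow (RingHom.mapMatrix (algebraMap ℝ ℂ)) C n

theorem Matrix.l2_opNorm_transpose (C : Matrix (Fin d) (Fin d) ℝ) : ‖Cᵀ‖ = ‖C‖ := by
  rw [← Matrix.conjTranspose_eq_transpose_of_trivial, Matrix.l2_opNorm_conjTranspose]

open Filter Topology in
/-- The discrete Lyapunov (Stein) equation `Q = P + Cᵀ Q C` has a positive definite solution
if the spectral radius of `C` is less than one. -/
theorem Matrix.exists_posDef_stein {C P : Matrix (Fin d) (Fin d) ℝ}
    (h : ∀ z ∈ spectrum ℂ (C.map (algebraMap ℝ ℂ)), ‖z‖ < 1) (hP : P.PosDef) :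
    ∃ Q : Matrix (Fin d) (Fin d) ℝ, Q.PosDef ∧ Q = P + Cᵀ * Q * C := by
  obtain ⟨s, hs0, hs1, hs⟩ := Matrix.exists_pow_norm_le h
  set f : ℕ → Matrix (Fin d) (Fin d) ℝ := fun n => (C ^ n)ᵀ * P * C ^ n with hf
  have hsum : Summable f := by
    have hg : Summable fun n : ℕ => ‖P‖ * (s * s) ^ n :=
      (summable_geometric_of_lt_one (by positivity) (by nlinarith)).mul_left _
    refine Summable.of_norm_bounded_eventually_nat hg ?_
    filter_upwards [hs] with n hn
    calc ‖f n‖ ≤ ‖(C ^ n)ᵀ‖ * ‖P‖ * ‖C ^ n‖ :=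
          (norm_mul_le _ _).trans (mul_le_mul_of_nonneg_right (norm_mul_le _ _) (norm_nonneg _))
      _ ≤ s ^ n * ‖P‖ * s ^ n := by
          rw [Matrix.l2_opNorm_transpose]
          gcongr
      _ = ‖P‖ * (s * s) ^ n := by rw [mul_pow]; ring
  have hPt : Pᵀ = P := by simpa using hP.isHermitian.eq
  have hft : ∀ n, (f n)ᵀ = f n := fun n => by
    simp [hf, Matrix.transpose_mul, hPt, Matrix.mul_assoc]
  have hQt : (∑' n, f n)ᵀ = ∑' n, f n := by
    rw [Matrix.transpose_tsum]
    exact tsum_congr hft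
  -- Conjugation by C shifts the series by one index; splitting off the term n = 0 leaves P.
  have hrec : ∑' n, f n = P + Cᵀ * (∑' n, f n) * C := by
    rw [← hsum.tsum_mul_left, ← (hsum.mul_left _).tsum_mul_right, hsum.tsum_eq_zero_add]
    congr 1
    · simp [hf]
    · refine tsum_congr fun n => ?_
      simp only [hf, pow_succ, Matrix.transpose_mul, Matrix.mul_assoc]
  refine ⟨∑' n, f n, Matrix.PosDef.of_dotProduct_mulVec_pos ?_ ?_, hrec⟩
  · simpa [Matrix.IsHermitian] using hQt
  intro x hx
  let φ : Matrix (Fin d) (Fin d) ℝ →+ ℝ :=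
    { toFun := fun M => x ⬝ᵥ M *ᵥ x
      map_zero' := by simp
      map_add' := fun M N => by simp [Matrix.add_mulVec, dotProduct_add] }
  have hφ : Continuous φ := by
    change Continuous fun M : Matrix (Fin d) (Fin d) ℝ => x ⬝ᵥ M *ᵥ x
    fun_prop
  have hφs : HasSum (fun n => φ (f n)) (φ (∑' n, f n)) := hsum.hasSum.map φ hφ
  have hval : ∀ n, φ (f n) = (C ^ n *ᵥ x) ⬝ᵥ P *ᵥ (C ^ n *ᵥ x) := fun n => by
    change x ⬝ᵥ ((C ^ n)ᵀ * P * C ^ n) *ᵥ x = _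
    rw [Matrix.mul_assoc, ← Matrix.mulVec_mulVec, Matrix.dotProduct_mulVec, Matrix.vecMul_transpose,
      ← Matrix.mulVec_mulVec]
  have hnn : ∀ n, 0 ≤ φ (f n) := fun n => by
    rw [hval]
    simpa using hP.posSemidef.dotProduct_mulVec_nonneg (C ^ n *ᵥ x)
  -- All terms of the quadratic form are nonnegative, and the zeroth one, xᵀPx, is already positive.
  have h0 : 0 < φ (f 0) := by
    rw [hval]
    simpa using hP.dotProduct_mulVec_pos hx
  have := le_hasSum hφs 0 fun n _ => hnn n
  have h1 : 0 < φ (∑' n, f n) := h0.trans_le this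
  rw [star_trivial]
  exact h1

/-- The number 1 has positive real part, so it is not an eigenvalue of -A. This makes the Cayley
transform of A available. -/
theorem IsHurwitz.isUnit_add_one {A : Matrix (Fin d) (Fin d) ℝ} (hA : IsHurwitz (-A)) :
    IsUnit (1 + A) := by
  have h1 : (1 : ℂ) ∉ spectrum ℂ ((-A).map (algebraMap ℝ ℂ)) := fun h => by
    have := hA 1 h
    norm_num at this
  rw [spectrum.notMem_iff, Matrix.isUnit_iff_isUnit_det] at h1
  rw [Matrix.isUnit_iff_isUnit_det]
  have h2 : algebraMap ℂ (Matrix (Fin d) (Fin d) ℂ) 1 - (-A).map (algebraMap ℝ ℂ)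
      = (algebraMap ℝ ℂ).mapMatrix (1 + A) := by
    ext i j
    simp [Matrix.one_apply, apply_ite]
  rw [h2, ← RingHom.map_det] at h1
  have h3 := h1.ne_zero
  exact isUnit_iff_ne_zero.2 fun h => h3 (by rw [h, map_zero])

/-- The Cayley transform of a matrix whose eigenvalues have positive real part has spectral
radius less than one. -/
theorem IsHurwitz.spectrum_cayley {A : Matrix (Fin d) (Fin d) ℝ} (hA : IsHurwitz (-A)) :
    ∀ z ∈ spectrum ℂ (((1 - A) * (1 + A)⁻¹).map (algebraMap ℝ ℂ)), ‖z‖ < 1 := by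
  intro z hz
  have hu := hA.isUnit_add_one
  set F := (algebraMap ℝ ℂ).mapMatrix (m := Fin d) with hF
  have hu' : IsUnit (F (1 + A)) := hu.map F
  have hC : ((1 - A) * (1 + A)⁻¹) * (1 + A) = 1 - A := by
    rw [Matrix.mul_assoc, Matrix.nonsing_inv_mul _ ((Matrix.isUnit_iff_isUnit_det _).1 hu),
      Matrix.mul_one]
  change z ∈ spectrum ℂ (F ((1 - A) * (1 + A)⁻¹)) at hz
  have h1 : ¬ IsUnit ((algebraMap ℂ _ z - F ((1 - A) * (1 + A)⁻¹)) * F (1 + A)) := by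
    rw [IsUnit.mul_right_iff hu']
    exact hz
  have h2 : (algebraMap ℂ _ z - F ((1 - A) * (1 + A)⁻¹)) * F (1 + A)
      = (z - 1) • (1 : Matrix (Fin d) (Fin d) ℂ) + (z + 1) • F A := by
    rw [sub_mul, ← map_mul, hC, map_sub, map_add, map_one, Algebra.algebraMap_eq_smul_one]
    simp only [smul_mul_assoc, one_mul, smul_add, sub_smul, add_smul, one_smul]
    abel
  rw [h2] at h1
  -- At z = -1 the pencil (z - 1) I + (z + 1) A reduces to -2 I, which is invertible.
  have hz1 : z + 1 ≠ 0 := fun h0 => h1 (by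
    rw [h0, zero_smul, add_zero, eq_neg_of_add_eq_zero_left h0]
    have : IsUnit ((-1 - 1 : ℂ)) := isUnit_iff_ne_zero.2 (by norm_num)
    have := this.map (algebraMap ℂ (Matrix (Fin d) (Fin d) ℂ))
    rwa [Algebra.algebraMap_eq_smul_one] at this)
  have hmem : (z - 1) / (z + 1) ∈ spectrum ℂ ((-A).map (algebraMap ℝ ℂ)) := by
    rw [spectrum.mem_iff]
    intro hI
    apply h1
    have h3 := hI.smul (Units.mk0 _ hz1)
    convert h3 using 1
    have h4 : (-A).map (algebraMap ℝ ℂ) = - F A := (map_neg F A :)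
    rw [h4, Units.smul_def, Units.val_mk0, Algebra.algebraMap_eq_smul_one, smul_sub, smul_smul,
      mul_div_cancel₀ _ hz1, smul_neg, sub_neg_eq_add]
  have hre := hA _ hmem
  have hn : 0 < Complex.normSq (z + 1) := Complex.normSq_pos.2 hz1
  rw [Complex.div_re, ← add_div, div_lt_iff₀ hn, zero_mul] at hre
  -- The numerator of Re ((z - 1) / (z + 1)) is |z|² - 1.
  have h5 : ‖z‖ ^ 2 < 1 := by
    rw [Complex.sq_norm, Complex.normSq_apply]
    simp at hre
    nlinarith
  have h6 := norm_nonneg z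
  nlinarith

/-- The Lyapunov equation of a matrix whose eigenvalues have positive real part is solvable. -/
theorem IsHurwitz.exists_lyapunov {A : Matrix (Fin d) (Fin d) ℝ} (hA : IsHurwitz (-A)) :
    ∃ Q : Matrix (Fin d) (Fin d) ℝ, Q.PosDef ∧ Aᵀ * Q + Q * A = 1 := by
  have hu := hA.isUnit_add_one
  have hud := (Matrix.isUnit_iff_isUnit_det _).1 hu
  set R := (1 + A)⁻¹ with hR
  have hR1 : R * (1 + A) = 1 := Matrix.nonsing_inv_mul _ hud
  have hR2 : (1 + A)ᵀ * Rᵀ = 1 := by rw [← Matrix.transpose_mul, hR1, Matrix.transpose_one]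
  have hRu : IsUnit R := (Matrix.isUnit_iff_isUnit_det _).2 (Matrix.isUnit_nonsing_inv_det _ hud)
  have hP : (Rᵀ * R).PosDef := by
    have := Matrix.PosDef.conjTranspose_mul_self (R := ℝ) R (Matrix.mulVec_injective_of_isUnit hRu)
    rwa [Matrix.conjTranspose_eq_transpose_of_trivial] at this
  -- The Stein equation for the Cayley transform, with right-hand side 2 RᵀR, becomes the Lyapunov
  -- equation after congruence by 1 + A: the difference of (1 + A)ᵀQ(1 + A) and (1 - A)ᵀQ(1 - A) is
  -- 2 (AᵀQ + QA).
  obtain ⟨Q, hQ, hQe⟩ := Matrix.exists_posDef_stein hA.spectrum_cayley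
    ((hP.smul (two_pos : (0 : ℝ) < 2)))
  rw [← hR] at hQe
  refine ⟨Q, hQ, ?_⟩
  have hC : ((1 - A) * R) * (1 + A) = 1 - A := by rw [Matrix.mul_assoc, hR1, Matrix.mul_one]
  have hC' : (1 + A)ᵀ * ((1 - A) * R)ᵀ = (1 - A)ᵀ := by rw [← Matrix.transpose_mul, hC]
  have h1 : (1 + A)ᵀ * Q * (1 + A)
      = (2 : ℝ) • (1 : Matrix (Fin d) (Fin d) ℝ) + (1 - A)ᵀ * Q * (1 - A) := by
    conv_lhs => rw [hQe]
    have e1 : (1 + A)ᵀ * (Rᵀ * R) * (1 + A) = 1 := by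
      rw [← Matrix.mul_assoc, hR2, Matrix.one_mul, hR1]
    have e2 : (1 + A)ᵀ * (((1 - A) * R)ᵀ * Q * ((1 - A) * R)) * (1 + A)
        = (1 - A)ᵀ * Q * (1 - A) := by
      calc _ = ((1 + A)ᵀ * ((1 - A) * R)ᵀ) * Q * (((1 - A) * R) * (1 + A)) := by
            simp only [Matrix.mul_assoc]
        _ = _ := by rw [hC, hC']
    rw [mul_add (1 + A)ᵀ, add_mul _ _ (1 + A), mul_smul_comm, smul_mul_assoc, e1, e2]
  have h2 : (2 : ℝ) • (Aᵀ * Q + Q * A) = (2 : ℝ) • (1 : Matrix (Fin d) (Fin d) ℝ) := by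
    simp only [Matrix.transpose_add, Matrix.transpose_sub, Matrix.transpose_one] at h1
    have h3 : (1 + Aᵀ) * Q * (1 + A) - (1 - Aᵀ) * Q * (1 - A) = (2 : ℝ) • (Aᵀ * Q + Q * A) := by
      rw [two_smul]
      noncomm_ring
    rw [← h3, h1]
    abel
  exact smul_right_injective _ (two_ne_zero : (2 : ℝ) ≠ 0) h2

/-- `‖B x‖` decreases at the rate `c` along the explicit Euler steps of size at most `τ` of
`x' = - A x`, and `M` is a condition number of `B`. -/
structure IsLyapunovFactor (A B : Matrix (Fin d) (Fin d) ℝ) (c M τ : ℝ) : Prop where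
  rate_pos : 0 < c
  cond_pos : 0 < M
  step_pos : 0 < τ
  norm_le : ∀ x, ‖x‖ ≤ M * ‖B.toEuclideanLin x‖
  norm_step_le : ∀ t, 0 ≤ t → t ≤ τ → ∀ x,
    ‖B.toEuclideanLin (x - t • A.toEuclideanLin x)‖ ≤ (1 - c * t) * ‖B.toEuclideanLin x‖

open scoped MatrixOrder in
/-- A quadratic Lyapunov function `‖B x‖²` for a matrix whose eigenvalues have positive real
part. -/
theorem IsHurwitz.exists_lyapunov_factor {A : Matrix (Fin d) (Fin d) ℝ} (hA : IsHurwitz (-A)) :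
    ∃ (B : Matrix (Fin d) (Fin d) ℝ) (c M τ : ℝ), contractionRate A ≤ c ∧ IsUnit A ∧
      IsLyapunovFactor A B c M τ := by
  have hex := hA.exists_lyapunov
  obtain ⟨hQ, hQe⟩ : (lyapunovQ A).PosDef ∧ Aᵀ * lyapunovQ A + lyapunovQ A * A = 1 := by
    rw [lyapunovQ, dif_pos hex]
    exact hex.choose_spec
  set Q := lyapunovQ A with hQdef
  obtain ⟨B, hB⟩ := CStarAlgebra.nonneg_iff_eq_star_mul_self.mp hQ.posSemidef.nonneg
  have hB' : Q = Bᵀ * B := by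
    rw [hB, Matrix.star_eq_conjTranspose, Matrix.conjTranspose_eq_transpose_of_trivial]
  have hQx : ∀ x y, inner ℝ x (Q.toEuclideanLin y)
      = inner ℝ (B.toEuclideanLin x) (B.toEuclideanLin y) := fun x y => by
    rw [hB', Matrix.toEuclideanLin_mul_apply, real_inner_comm, Matrix.inner_transpose_left,
      real_inner_comm]
  have hlyap : ∀ x, 2 * inner ℝ (B.toEuclideanLin x) (B.toEuclideanLin (A.toEuclideanLin x))
      = ‖x‖ ^ 2 := fun x => by
    have h1 : inner ℝ x ((Aᵀ * Q + Q * A).toEuclideanLin x) = ‖x‖ ^ 2 := by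
      rw [hQe, Matrix.toEuclideanLin_one_apply, real_inner_self_eq_norm_sq]
    rw [map_add, LinearMap.add_apply, inner_add_right, Matrix.toEuclideanLin_mul_apply,
      Matrix.toEuclideanLin_mul_apply, hQx, ← real_inner_comm, Matrix.inner_transpose_left,
      ← real_inner_comm, hQx, real_inner_comm] at h1
    rw [← h1]
    ring
  -- The Lyapunov identity itself bounds ‖x‖² by 2 ‖Bx‖ ‖BA‖ ‖x‖, so no inverse of B is needed; the
  -- summand 1 only makes the constant positive.
  have hlow : ∀ x, ‖x‖ ≤ (2 * ‖B * A‖ + 1) * ‖B.toEuclideanLin x‖ := fun x => by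
    have h1 := hlyap x
    have h2 := real_inner_le_norm (B.toEuclideanLin x) (B.toEuclideanLin (A.toEuclideanLin x))
    rw [← Matrix.toEuclideanLin_mul_apply] at h1 h2
    have h3 := Matrix.norm_toEuclideanLin_le (B * A) x
    have h4 : ‖x‖ * ‖x‖ ≤ (2 * ‖B * A‖ * ‖B.toEuclideanLin x‖) * ‖x‖ := by
      have := mul_le_mul_of_nonneg_left h3 (norm_nonneg (B.toEuclideanLin x))
      nlinarith
    have h5 := norm_nonneg (B.toEuclideanLin x)
    rcases (norm_nonneg x).eq_or_lt with h0 | h0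
    · rw [← h0]; positivity
    · have := le_of_mul_le_mul_right h4 h0
      linarith
  have hup : ∀ x, ‖B.toEuclideanLin x‖ ^ 2 ≤ ‖Q‖ * ‖x‖ ^ 2 := fun x => by
    rw [← real_inner_self_eq_norm_sq, ← hQx]
    have h1 := real_inner_le_norm x (Q.toEuclideanLin x)
    have h2 := mul_le_mul_of_nonneg_left (Matrix.norm_toEuclideanLin_le Q x) (norm_nonneg x)
    nlinarith
  obtain ⟨c, hc, hac, hcx⟩ : ∃ c : ℝ, 0 < c ∧ contractionRate A ≤ c ∧
      ∀ x, 4 * c * ‖B.toEuclideanLin x‖ ^ 2 ≤ ‖x‖ ^ 2 := by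
    -- A positive definite Q vanishes only in dimension zero. There `contractionRate` is 1 / 0 = 0,
    -- and c = 1 serves as a positive rate.
    rcases (norm_nonneg Q).eq_or_lt with h0 | h0
    · refine ⟨1, one_pos, by simp [contractionRate, ← hQdef, ← h0], fun x => ?_⟩
      have h1 := hup x
      rw [← h0] at h1
      have := sq_nonneg ‖x‖
      nlinarith
    · refine ⟨contractionRate A, ?_, le_rfl, fun x => ?_⟩
      · rw [contractionRate, ← hQdef]; positivity
      · have h1 := hup x
        rw [contractionRate, ← hQdef]
        have e : 4 * (1 / (4 * ‖Q‖)) * ‖B.toEuclideanLin x‖ ^ 2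
            = ‖B.toEuclideanLin x‖ ^ 2 / ‖Q‖ := by field_simp
        rw [e, div_le_iff₀ h0]
        linarith
  set M := 2 * ‖B * A‖ + 1 with hM
  have hMpos : 0 < M := by positivity
  set κ := (‖B * A‖ * M) ^ 2 + 1 with hκ
  have hκpos : 0 < κ := by positivity
  have hBA : ∀ x, ‖B.toEuclideanLin (A.toEuclideanLin x)‖ ^ 2 ≤ κ * ‖B.toEuclideanLin x‖ ^ 2 := by
    intro x
    have h1 : ‖B.toEuclideanLin (A.toEuclideanLin x)‖ ≤ ‖B * A‖ * M * ‖B.toEuclideanLin x‖ := by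
      rw [← Matrix.toEuclideanLin_mul_apply]
      refine (Matrix.norm_toEuclideanLin_le _ _).trans ?_
      rw [mul_assoc]
      exact mul_le_mul_of_nonneg_left (hlow x) (norm_nonneg _)
    have h2 := pow_le_pow_left₀ (norm_nonneg _) h1 2
    rw [mul_pow] at h2
    nlinarith [sq_nonneg ‖B.toEuclideanLin x‖]
  -- In ‖B(x - tAx)‖² the drift contributes -t ‖x‖² ≤ -4ct ‖Bx‖². The bound t ≤ 2c / κ lets half of
  -- it absorb the term t² ‖BAx‖², leaving 1 - 2ct ≤ (1 - ct)²; the bound t ≤ 1 / c keeps 1 - ct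
  -- nonnegative.
  refine ⟨B, c, M, min (2 * c / κ) (1 / c), hac, ?_, hc, hMpos, by positivity, hlow, ?_⟩
  · rw [Matrix.isUnit_iff_isUnit_det, isUnit_iff_ne_zero]
    intro hdet
    obtain ⟨v, hv, hv0⟩ := Matrix.exists_mulVec_eq_zero_iff.2 hdet
    have h1 := hlyap (WithLp.toLp 2 v)
    have h2 : A.toEuclideanLin (WithLp.toLp 2 v) = 0 := by simp [Matrix.toLpLin_apply, hv0]
    rw [h2, map_zero, inner_zero_right, mul_zero] at h1
    have h3 : (WithLp.toLp 2 v : EuclideanSpace ℝ (Fin d)) = 0 := by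
      rw [← norm_eq_zero]
      exact pow_eq_zero_iff two_ne_zero |>.1 h1.symm
    exact hv (by simpa using h3)
  · intro t ht0 ht x
    have ht1 : t * κ ≤ 2 * c := by
      rw [← le_div_iff₀ hκpos]
      exact ht.trans (min_le_left _ _)
    have ht2 : c * t ≤ 1 := by
      rw [mul_comm, ← le_div_iff₀ hc]
      exact ht.trans (min_le_right _ _)
    refine abs_le_of_sq_le_sq' ?_ (by have := norm_nonneg (B.toEuclideanLin x); nlinarith) |>.2
    have h1 := hlyap x
    rw [map_sub, map_smul, norm_sub_sq_real, inner_smul_right, norm_smul, mul_pow, Real.norm_eq_abs,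
      sq_abs]
    have h2 := hcx x
    have h3 := hBA x
    have h4 : t ^ 2 * ‖B.toEuclideanLin (A.toEuclideanLin x)‖ ^ 2
        ≤ t * (2 * c) * ‖B.toEuclideanLin x‖ ^ 2 := by
      calc _ ≤ t ^ 2 * (κ * ‖B.toEuclideanLin x‖ ^ 2) := by gcongr
        _ = t * (t * κ) * ‖B.toEuclideanLin x‖ ^ 2 := by ring
        _ ≤ _ := by gcongr
    have h5 := mul_le_mul_of_nonneg_left h2 ht0
    have h6 : 0 ≤ (c * t) ^ 2 * ‖B.toEuclideanLin x‖ ^ 2 := by positivity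
    nlinarith

end Lyapunov

/-! ### Polynomial step sizes -/

section StepSizes

/-- Two sequences of step sizes that are small, slowly varying and well separated at the
level `ε`, with `p` the moment under consideration. -/
structure SmallSteps (p ε : ℝ) (β γ : ℕ → ℝ) : Prop where
  two_le : 2 ≤ p
  slow_pos : ∀ k, 0 < β k
  fast_pos : ∀ k, 0 < γ k
  mul_slow_le : ∀ k, p * β k ≤ ε
  mul_fast_le : ∀ k, p * γ k ≤ ε
  ratio_le : ∀ k, β k / γ k ≤ ε
  slow_anti : ∀ k, β (k + 1) ≤ β k
  fast_anti : ∀ k, γ (k + 1) ≤ γ k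
  ratio_anti : ∀ k, β (k + 1) / γ (k + 1) ≤ β k / γ k
  slow_sub_le : ∀ k, β k - β (k + 1) ≤ ε * β k ^ 2
  fast_sub_le : ∀ k, γ k - γ (k + 1) ≤ ε * γ k ^ 2
  ratio_sub_le : ∀ k, β k / γ k - β (k + 1) / γ (k + 1) ≤ ε * β k * (β k / γ k)

theorem SmallSteps.mono {p ε ε' : ℝ} {β γ : ℕ → ℝ} (h : SmallSteps p ε β γ) (hε : ε ≤ ε') :
    SmallSteps p ε' β γ where
  two_le := h.two_le
  slow_pos := h.slow_pos
  fast_pos := h.fast_pos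
  mul_slow_le k := (h.mul_slow_le k).trans hε
  mul_fast_le k := (h.mul_fast_le k).trans hε
  ratio_le k := (h.ratio_le k).trans hε
  slow_anti := h.slow_anti
  fast_anti := h.fast_anti
  ratio_anti := h.ratio_anti
  slow_sub_le k := (h.slow_sub_le k).trans (mul_le_mul_of_nonneg_right hε (sq_nonneg _))
  fast_sub_le k := (h.fast_sub_le k).trans (mul_le_mul_of_nonneg_right hε (sq_nonneg _))
  ratio_sub_le k := (h.ratio_sub_le k).trans (by
    have h1 := h.slow_pos k
    have h2 := h.fast_pos k
    gcongr)

/-- For e ≤ 1 and a base in [0, 1] one has t ≤ t^e; apply this to t = x / (x + 1). -/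
theorem Real.rpow_neg_sub_rpow_neg_add_one_le {x e : ℝ} (hx : 0 < x) (he1 : e ≤ 1) :
    x ^ (-e) - (x + 1) ^ (-e) ≤ x ^ (-e) / x := by
  have h1 : x / (x + 1) ≤ (x / (x + 1)) ^ e := by
    have hlt : x / (x + 1) ≤ 1 := (div_le_one (by positivity)).2 (by linarith)
    exact Real.self_le_rpow_of_le_one (by positivity) hlt he1
  rw [Real.div_rpow hx.le (by positivity)] at h1
  have hxe : 0 < x ^ e := by positivity
  have hxe' : 0 < (x + 1) ^ e := by positivity
  rw [Real.rpow_neg hx.le, Real.rpow_neg (by positivity)]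
  have h2 : (x ^ e)⁻¹ * (x / (x + 1)) ≤ ((x + 1) ^ e)⁻¹ := by
    calc _ ≤ (x ^ e)⁻¹ * (x ^ e / (x + 1) ^ e) := by gcongr
      _ = _ := by field_simp
  have h3 : (x ^ e)⁻¹ - (x ^ e)⁻¹ * (x / (x + 1)) = (x ^ e)⁻¹ / (x + 1) := by field_simp; ring
  have h4 : (x ^ e)⁻¹ / (x + 1) ≤ (x ^ e)⁻¹ / x := by gcongr; linarith
  linarith

theorem stepSize_pos {c e k₀ : ℝ} (hc : 0 < c) (hk₀ : 0 < k₀) (k : ℕ) : 0 < stepSize c e k₀ k := by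
  unfold stepSize; positivity

theorem stepSize_succ_le {c e k₀ : ℝ} (hc : 0 < c) (he : 0 ≤ e) (hk₀ : 0 < k₀) (k : ℕ) :
    stepSize c e k₀ (k + 1) ≤ stepSize c e k₀ k := by
  unfold stepSize
  refine mul_le_mul_of_nonneg_left (Real.rpow_le_rpow_of_nonpos (by positivity) ?_ (by linarith))
    hc.le
  push_cast
  linarith

theorem stepSize_le {c e k₀ K q : ℝ} (hc : 0 < c) (he : 0 ≤ e) (hK : 0 < K) (hq : 0 < q)
    (hk₀ : K * q ≤ k₀) (k : ℕ) : stepSize c e k₀ k ≤ c * K ^ (-e) * q ^ (-e) := by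
  unfold stepSize
  rw [mul_assoc, ← Real.mul_rpow hK.le hq.le]
  refine mul_le_mul_of_nonneg_left (Real.rpow_le_rpow_of_nonpos (by positivity) ?_ (by linarith))
    hc.le
  have : (0 : ℝ) ≤ k := Nat.cast_nonneg k
  linarith

theorem stepSize_sub_le {c e k₀ : ℝ} (hc : 0 < c) (he1 : e ≤ 1) (hk₀ : 0 < k₀) (k : ℕ) :
    stepSize c e k₀ k - stepSize c e k₀ (k + 1) ≤ stepSize c e k₀ k * (k + k₀ : ℝ)⁻¹ := by
  unfold stepSize
  have h := Real.rpow_neg_sub_rpow_neg_add_one_le (x := (k : ℝ) + k₀) (by positivity) he1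
  have h2 := mul_le_mul_of_nonneg_left h hc.le
  have e1 : ((k + 1 : ℕ) : ℝ) + k₀ = k + k₀ + 1 := by push_cast; ring
  rw [e1]
  calc _ = c * ((k + k₀ : ℝ) ^ (-e) - (k + k₀ + 1 : ℝ) ^ (-e)) := by ring
    _ ≤ _ := h2
    _ = _ := by ring

theorem stepSize_div {c c' e e' k₀ : ℝ} (hk₀ : 0 < k₀) (k : ℕ) :
    stepSize c e k₀ k / stepSize c' e' k₀ k = stepSize (c / c') (e - e') k₀ k := by
  unfold stepSize
  have h : 0 < (k : ℝ) + k₀ := by positivity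
  rw [mul_div_mul_comm, ← Real.rpow_sub h]
  congr 2
  ring

/-- The relative decrease of a polynomial step is at most 1 / (k + k₀), and this quantity is
negligible against the step itself when the exponent is below 1. Hence the steps vary slowly on
their own scale. -/
theorem inv_le_stepSize {c e k₀ K ε : ℝ} (he : e ≤ 1) (hK : 0 < K) (hk₀ : K ≤ k₀)
    (h : K ^ (e - 1) ≤ ε * c) (k : ℕ) : (k + k₀ : ℝ)⁻¹ ≤ ε * stepSize c e k₀ k := by
  unfold stepSize
  have hk : (0 : ℝ) ≤ k := Nat.cast_nonneg k
  have hx : 0 < (k : ℝ) + k₀ := by linarith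
  have h1 : ((k : ℝ) + k₀) ^ (e - 1) ≤ ε * c :=
    (Real.rpow_le_rpow_of_nonpos hK (by linarith) (by linarith)).trans h
  calc ((k : ℝ) + k₀)⁻¹ = ((k : ℝ) + k₀) ^ (e - 1) * ((k : ℝ) + k₀) ^ (-e) := by
        rw [← Real.rpow_add hx, ← Real.rpow_neg_one]; congr 1; ring
    _ ≤ ε * c * ((k : ℝ) + k₀) ^ (-e) := by gcongr
    _ = _ := by ring

open Filter Topology in
/-- Polynomial step sizes are small, slowly varying and well separated if the offset is large
compared with a power of the moment. -/
theorem exists_smallSteps {a b cβ cγ ε : ℝ} (ha : 1 / 2 < a) (hab : a < b) (hb : b < 1)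
    (hcβ : 0 < cβ) (hcγ : 0 < cγ) (hε : 0 < ε) :
    ∃ K > 0, ∀ p k₀ : ℝ, 2 ≤ p → K * p ^ (4 / b) ≤ k₀ →
      SmallSteps p ε (stepSize cβ b k₀) (stepSize cγ a k₀) := by
  have hlim : ∀ (e c δ : ℝ), 0 < e → 0 < δ → ∀ᶠ K : ℝ in atTop, c * K ^ (-e) ≤ δ := by
    intro e c δ he hδ
    have h := (tendsto_rpow_neg_atTop he).const_mul c
    rw [mul_zero] at h
    exact h.eventually_le_const hδ
  have hev := ((hlim b cβ ε (by linarith) hε).and <| (hlim a cγ ε (by linarith) hε).and <|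
    (hlim (b - a) (cβ / cγ) ε (by linarith) hε).and <|
    (hlim (1 - b) 1 (ε * cβ) (by linarith) (by positivity)).and <|
    (hlim (1 - a) 1 (ε * cγ) (by linarith) (by positivity)).and <| eventually_ge_atTop 1)
  obtain ⟨K, h1, h2, h3, h4, h5, hK1⟩ := hev.exists
  have hK : 0 < K := by linarith
  refine ⟨K, hK, fun p k₀ hp hk₀ => ?_⟩
  have hp0 : 0 < p := by linarith
  have hp1 : 1 ≤ p := by linarith
  have hb0 : 0 < b := by linarith
  set q := p ^ (4 / b) with hq
  have hq1 : 1 ≤ q := Real.one_le_rpow hp1 (by positivity)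
  have hKk : K ≤ k₀ := le_trans (le_mul_of_one_le_right hK.le hq1) hk₀
  have hk₀' : 0 < k₀ := by linarith
  -- Here q^{-e} = p^{-4e/b} with 4e / b ≥ 2 / b > 1, so one factor p is absorbed for both exponents
  -- e = b and e = a.
  have hqp : ∀ e : ℝ, 1 / 2 ≤ e → p * q ^ (-e) ≤ 1 := by
    intro e he
    rw [hq, ← Real.rpow_mul hp0.le]
    nth_rewrite 1 [← Real.rpow_one p]
    rw [← Real.rpow_add hp0]
    refine Real.rpow_le_one_of_one_le_of_nonpos hp1 ?_
    have : 1 ≤ 4 / b * e := by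
      rw [div_mul_eq_mul_div, le_div_iff₀ hb0]
      linarith
    linarith
  have hmul : ∀ c e : ℝ, 0 < c → 1 / 2 ≤ e → c * K ^ (-e) ≤ ε → ∀ k, p * stepSize c e k₀ k ≤ ε := by
    intro c e hc he hcK k
    have h6 := stepSize_le (e := e) hc (by linarith) hK (by positivity) hk₀ k
    have hcK0 : 0 ≤ c * K ^ (-e) := by positivity
    calc p * stepSize c e k₀ k ≤ p * (c * K ^ (-e) * q ^ (-e)) := by gcongr
      _ = (c * K ^ (-e)) * (p * q ^ (-e)) := by ring
      _ ≤ (c * K ^ (-e)) * 1 := by gcongr; exact hqp e he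
      _ ≤ ε := by rwa [mul_one]
  have h4' : K ^ (b - 1) ≤ ε * cβ := by simpa using h4
  have h5' : K ^ (a - 1) ≤ ε * cγ := by simpa using h5
  have hsub : ∀ c e : ℝ, 0 < c → e ≤ 1 → K ^ (e - 1) ≤ ε * c → ∀ k,
      stepSize c e k₀ k - stepSize c e k₀ (k + 1) ≤ ε * stepSize c e k₀ k ^ 2 := by
    intro c e hc he hcK k
    refine (stepSize_sub_le hc he hk₀' k).trans ?_
    have h6 := inv_le_stepSize he hK hKk hcK k
    have h7 := stepSize_pos (e := e) hc hk₀' k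
    calc _ ≤ stepSize c e k₀ k * (ε * stepSize c e k₀ k) := by gcongr
      _ = _ := by ring
  have hcc : 0 < cβ / cγ := by positivity
  exact {
    two_le := hp
    slow_pos := stepSize_pos hcβ hk₀'
    fast_pos := stepSize_pos hcγ hk₀'
    mul_slow_le := hmul cβ b hcβ (by linarith) h1
    mul_fast_le := hmul cγ a hcγ (by linarith) h2
    ratio_le := fun k => by
      rw [stepSize_div hk₀']
      have h6 := stepSize_le (e := b - a) hcc (by linarith) hK (q := 1) one_pos
        ((mul_one K).trans_le hKk) k
      rw [Real.one_rpow, mul_one] at h6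
      exact h6.trans h3
    slow_anti := stepSize_succ_le hcβ (by linarith) hk₀'
    fast_anti := stepSize_succ_le hcγ (by linarith) hk₀'
    ratio_anti := fun k => by
      rw [stepSize_div hk₀', stepSize_div hk₀']
      exact stepSize_succ_le hcc (by linarith) hk₀' k
    slow_sub_le := hsub cβ b hcβ hb.le h4'
    fast_sub_le := hsub cγ a hcγ (by linarith) h5'
    ratio_sub_le := fun k => by
      rw [stepSize_div hk₀', stepSize_div hk₀']
      refine (stepSize_sub_le hcc (by linarith) hk₀' k).trans ?_
      have h6 := inv_le_stepSize hb.le hK hKk h4' k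
      have h7 := stepSize_pos (e := b - a) hcc hk₀' k
      rw [mul_comm]
      gcongr }

end StepSizes

/-! ### Scalar recursions on one and two time scales -/

section ScalarRecursion

/-- A contractive scalar recursion with a noise term of squared step size. -/
theorem le_prod_add_of_recursion {E η : ℕ → ℝ} {a c p A H : ℝ} (hc : 0 < c) (hac : a ≤ c)
    (hp : 0 ≤ p) (hE0 : 0 ≤ E 0) (hη : ∀ k, 0 < η k) (hη1 : ∀ k, c * η k ≤ 1)
    (hηsub : ∀ k, η k - η (k + 1) ≤ c / 16 * η k ^ 2) (hA : 16 * A ≤ c * H) (hH : 0 ≤ H)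
    (hE : ∀ k, E (k + 1) ≤ (1 - c / 4 * η k) * E k + A * p * η k ^ 2) (k : ℕ) :
    E k ≤ (∏ j ∈ Finset.range k, (1 - η j * a / 8)) ^ 2 * E 0 + H * p * η k := by
  induction k with
  | zero =>
    have := hη 0
    simp only [Finset.range_zero, Finset.prod_empty, one_pow, one_mul]
    have : 0 ≤ H * p * η 0 := by positivity
    linarith
  | succ k ih =>
    set P := ∏ j ∈ Finset.range k, (1 - η j * a / 8) with hP
    have hk := hη k
    have h1 := hη1 k
    have h0 : 0 ≤ 1 - c / 4 * η k := by nlinarith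
    have h2 := mul_le_mul_of_nonneg_left ih h0
    -- The recursion is for a squared moment, so the rate c / 4 is halved to a / 8 when the product
    -- is written as a square.
    have h3 : 1 - c / 4 * η k ≤ (1 - η k * a / 8) ^ 2 := by
      have := mul_le_mul_of_nonneg_right hac hk.le
      nlinarith [sq_nonneg (η k * a)]
    rw [Finset.prod_range_succ, mul_pow]
    have h4 := mul_le_mul_of_nonneg_right h3 (mul_nonneg (sq_nonneg P) hE0)
    -- The gain (c / 4) H p η² pays for the noise and for the decrease of η, each of which costs at
    -- most (c / 16) H p η².
    have h5 : (1 - c / 4 * η k) * (H * p * η k) + A * p * η k ^ 2 ≤ H * p * η (k + 1) := by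
      have hHp : 0 ≤ H * p := by positivity
      have h6 := mul_le_mul_of_nonneg_left (hηsub k) hHp
      have h7 : 0 ≤ p * η k ^ 2 := by positivity
      have h8 := mul_le_mul_of_nonneg_right hA h7
      have h9 : 0 ≤ c * (H * p) * η k ^ 2 := by positivity
      linarith
    have := hE k
    linarith

theorem prod_sq_le_one {η : ℕ → ℝ} {a c : ℝ} (ha : 0 ≤ a) (hac : a ≤ c) (hη : ∀ k, 0 < η k)
    (hη1 : ∀ k, c * η k ≤ 1) (k : ℕ) :
    0 ≤ ∏ j ∈ Finset.range k, (1 - η j * a / 8) ∧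
      ∏ j ∈ Finset.range k, (1 - η j * a / 8) ≤ 1 := by
  have h : ∀ j, 0 ≤ 1 - η j * a / 8 ∧ 1 - η j * a / 8 ≤ 1 := fun j => by
    have h1 := hη j
    have h2 := mul_le_mul_of_nonneg_right hac h1.le
    have h3 := hη1 j
    have h4 : 0 ≤ η j * a := by positivity
    constructor <;> nlinarith
  exact ⟨Finset.prod_nonneg fun j _ => (h j).1, Finset.prod_le_one (fun j _ => (h j).1)
    fun j _ => (h j).2⟩

/-- Each constraint holds near 0⁺, hence finitely many hold together. All later demands that ε be
small enough are passed to this lemma as vectors of constraints. -/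
theorem exists_pos_mul_le {ι : Type*} [Finite ι] (x y : ι → ℝ) (hy : ∀ i, 0 < y i) :
    ∃ ε > 0, ∀ i, x i * ε ≤ y i := by
  have h : ∀ᶠ ε : ℝ in nhdsWithin 0 (Set.Ioi 0), ∀ i, x i * ε ≤ y i := by
    rw [Filter.eventually_all]
    intro i
    have h1 : Filter.Tendsto (fun ε : ℝ => x i * ε) (nhdsWithin 0 (Set.Ioi 0)) (nhds 0) := by
      have : Filter.Tendsto (fun ε : ℝ => x i * ε) (nhds 0) (nhds (x i * 0)) :=
        Filter.tendsto_id.const_mul _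
      rw [mul_zero] at this
      exact this.mono_left nhdsWithin_le_nhds
    exact h1.eventually_le_const (hy i)
  obtain ⟨ε, h1, h2⟩ := (h.and self_mem_nhdsWithin).exists
  exact ⟨ε, h2, h1⟩

/-- A pair of scalar recursions on two time scales. -/
theorem exists_bound_of_two_timescale {a₁ c₁ a₂ c₂ C : ℝ} (ha₁ : 0 ≤ a₁) (hc₁ : 0 < c₁)
    (hac₁ : a₁ ≤ c₁) (hc₂ : 0 < c₂) (hac₂ : a₂ ≤ c₂) (hC : 0 ≤ C) :
    ∃ ε > 0, ∃ H > 0, ∀ (p : ℝ) (β γ : ℕ → ℝ), SmallSteps p ε β γ →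
      ∀ Y Z : ℕ → ℝ, (∀ k, 0 ≤ Y k) → (∀ k, 0 ≤ Z k) →
      (∀ k, Y (k + 1) ≤ (1 - c₂ / 2 * γ k) * Y k + C * p * γ k ^ 2 * (1 + Z k + Y k)) →
      (∀ k, Z (k + 1) ≤ (1 - c₁ / 2 * β k) * Z k + C * β k * (β k / γ k) ^ 2 * Y k
        + C * p * β k ^ 2 * (1 + Z k + Y k)) →
      ∀ M, Z 0 + Y 0 ≤ M → ∀ k,
        Z k + (β k / γ k) ^ 2 * Y k
          ≤ (∏ j ∈ Finset.range k, (1 - β j * a₁ / 8)) ^ 2 * M + H * p * β k ∧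
        Y k ≤ (∏ j ∈ Finset.range k, (1 - γ j * a₂ / 8)) ^ 2 * M + H * (1 + M) * p * γ k := by
  obtain ⟨ε, hε, hεi⟩ := exists_pos_mul_le
    ![1, c₁, c₂, 1, 1, 8 * C, 12 * C + c₁, 4 * C] ![1, 1, 1, c₁ / 16, c₂ / 16, c₁, 2 * c₂, c₂]
    (by intro i; fin_cases i <;> simp <;> positivity)
  have h₀ : 1 * ε ≤ 1 := hεi 0
  have h₁ : c₁ * ε ≤ 1 := hεi 1
  have h₂ : c₂ * ε ≤ 1 := hεi 2
  have h₃ : 1 * ε ≤ c₁ / 16 := hεi 3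
  have h₄ : 1 * ε ≤ c₂ / 16 := hεi 4
  have h₅ : 8 * C * ε ≤ c₁ := hεi 5
  have h₆ : (12 * C + c₁) * ε ≤ 2 * c₂ := hεi 6
  have h₇ : 4 * C * ε ≤ c₂ := hεi 7
  -- Both constants come from the requirement 16 A ≤ c H of `le_prod_add_of_recursion`, with A = 2C
  -- for the combined quantity and A = C (1 + M + H₁) for the fast one.
  set H₁ := 32 * C / c₁ + 1 with hH₁
  have hH₁pos : 0 < H₁ := by positivity
  set H₂ := 16 * C * (1 + H₁) / c₂ with hH₂
  have hH₂nn : 0 ≤ H₂ := by positivity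
  refine ⟨ε, hε, H₁ + H₂, by positivity, fun p β γ hs Y Z hY hZ hYrec hZrec M hM => ?_⟩
  have hp2 := hs.two_le
  have hp : 0 < p := by linarith
  have hβ := hs.slow_pos
  have hγ := hs.fast_pos
  have hM0 : 0 ≤ M := (add_nonneg (hZ 0) (hY 0)).trans hM
  have hle : ∀ {η : ℝ}, 0 < η → p * η ≤ ε → η ≤ ε := fun {η} h h' => by nlinarith
  have hβε := fun k => hle (hβ k) (hs.mul_slow_le k)
  have hγε := fun k => hle (hγ k) (hs.mul_fast_le k)
  have hβ1 : ∀ k, c₁ * β k ≤ 1 := fun k =>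
    (mul_le_mul_of_nonneg_left (hβε k) hc₁.le).trans h₁
  have hγ1 : ∀ k, c₂ * γ k ≤ 1 := fun k =>
    (mul_le_mul_of_nonneg_left (hγε k) hc₂.le).trans h₂
  have hρ : ∀ k, 0 < β k / γ k := fun k => div_pos (hβ k) (hγ k)
  have hρβ : ∀ k, β k / γ k * γ k = β k := fun k => div_mul_cancel₀ _ (hγ k).ne'
  set E : ℕ → ℝ := fun k => Z k + (β k / γ k) ^ 2 * Y k with hE
  have hρ1 : (β 0 / γ 0) ^ 2 ≤ 1 := by
    have := hρ 0
    have := hs.ratio_le 0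
    refine pow_le_one₀ (hρ 0).le (by linarith)
  have hE0 : E 0 ≤ M := by
    have := mul_le_mul_of_nonneg_right hρ1 (hY 0)
    simp only [hE]
    linarith
  have hE0' : 0 ≤ E 0 := add_nonneg (hZ 0) (mul_nonneg (sq_nonneg _) (hY 0))
  have hErec : ∀ k, E (k + 1) ≤ (1 - c₁ / 4 * β k) * E k + 2 * C * p * β k ^ 2 := by
    intro k
    set ρ := β k / γ k with hρk
    have e1 : ρ * γ k = β k := hρβ k
    have h1 : (β (k + 1) / γ (k + 1)) ^ 2 * Y (k + 1) ≤ ρ ^ 2 * Y (k + 1) :=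
      mul_le_mul_of_nonneg_right (pow_le_pow_left₀ (hρ (k + 1)).le (hs.ratio_anti k) 2) (hY _)
    have h2 := mul_le_mul_of_nonneg_left (hYrec k) (sq_nonneg ρ)
    have h3 := hZrec k
    -- The weight ρ² turns fast noise of order γ² into noise of order β².
    have e2 : ρ ^ 2 * (C * p * γ k ^ 2 * (1 + Z k + Y k))
        = C * p * β k ^ 2 * (1 + Z k + Y k) := by rw [← e1]; ring
    have h4 : 2 * C * p * β k ^ 2 * Z k ≤ c₁ / 4 * β k * Z k := by
      have h5 : 2 * C * (p * β k) ≤ c₁ / 4 := by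
        have := mul_le_mul_of_nonneg_left (hs.mul_slow_le k) hC
        linarith
      have := mul_le_mul_of_nonneg_right h5 (mul_nonneg (hβ k).le (hZ k))
      calc _ = 2 * C * (p * β k) * (β k * Z k) := by ring
        _ ≤ _ := this
        _ = _ := by ring
    -- The fast contraction pays, in the coefficient of ρ² Y, for the coupling, for the Y-part of
    -- both noise terms and for the rate (c₁ / 4) β required of the combination.
    have h5 : C * β k + 2 * C * p * γ k ^ 2 + c₁ / 4 * β k ≤ c₂ / 2 * γ k := by
      have h6 : β k ≤ ε * γ k := by
        rw [← e1]; exact mul_le_mul_of_nonneg_right (hs.ratio_le k) (hγ k).le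
      have h7 := mul_le_mul_of_nonneg_left h6 (by positivity : 0 ≤ C + c₁ / 4)
      have h8 := mul_le_mul_of_nonneg_right (mul_le_mul_of_nonneg_left (hs.mul_fast_le k) hC)
        (hγ k).le
      have h9 := mul_le_mul_of_nonneg_right h₆ (hγ k).le
      linarith
    have h6 := mul_le_mul_of_nonneg_right h5 (mul_nonneg (sq_nonneg ρ) (hY k))
    have e3 : 2 * C * p * γ k ^ 2 * (ρ ^ 2 * Y k) = 2 * C * p * β k ^ 2 * Y k := by
      rw [← e1]; ring
    simp only [hE, ← hρk]
    linarith
  have hbound := le_prod_add_of_recursion (H := H₁) hc₁ hac₁ hp.le hE0' hβ hβ1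
    (fun k => (hs.slow_sub_le k).trans (mul_le_mul_of_nonneg_right (by linarith) (sq_nonneg _)))
    (by rw [hH₁, mul_add, mul_div_cancel₀ _ hc₁.ne']; linarith) hH₁pos.le hErec
  have hbound' : ∀ k, E k ≤ (∏ j ∈ Finset.range k, (1 - β j * a₁ / 8)) ^ 2 * M + H₁ * p * β k :=
    fun k => (hbound k).trans
      (add_le_add_left (mul_le_mul_of_nonneg_left hE0 (sq_nonneg _)) _)
  have hZb : ∀ k, Z k ≤ M + H₁ := fun k => by
    have h1 := prod_sq_le_one ha₁ hac₁ hβ hβ1 k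
    have h2 := mul_le_mul_of_nonneg_right (pow_le_one₀ h1.1 h1.2 (n := 2)) hM0
    have h3 := mul_le_mul_of_nonneg_left (hs.mul_slow_le k) hH₁pos.le
    have h4 := mul_nonneg (sq_nonneg (β k / γ k)) (hY k)
    have h5 := hbound' k
    simp only [hE] at h5
    nlinarith
  -- Once Z is known to be bounded, the fast recursion no longer involves the slow moment.
  have hYrec' : ∀ k, Y (k + 1) ≤ (1 - c₂ / 4 * γ k) * Y k
      + C * (1 + M + H₁) * p * γ k ^ 2 := fun k => by
    have h1 := hYrec k
    have h2 : C * p * γ k ^ 2 * Z k ≤ C * p * γ k ^ 2 * (M + H₁) :=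
      mul_le_mul_of_nonneg_left (hZb k) (by positivity)
    have h3 : C * (p * γ k) ≤ c₂ / 4 := by
      have := mul_le_mul_of_nonneg_left (hs.mul_fast_le k) hC
      linarith
    have h4 := mul_le_mul_of_nonneg_right h3 (mul_nonneg (hγ k).le (hY k))
    linarith
  have hYbound := le_prod_add_of_recursion (H := H₂ * (1 + M)) hc₂ hac₂ hp.le (hY 0) hγ hγ1
    (fun k => (hs.fast_sub_le k).trans (mul_le_mul_of_nonneg_right (by linarith) (sq_nonneg _)))
    (by
      have e : c₂ * (H₂ * (1 + M)) = 16 * C * (1 + H₁) * (1 + M) := by rw [hH₂]; field_simp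
      rw [e]
      have : 0 ≤ C * (H₁ * M) := by positivity
      linarith) (by positivity) hYrec'
  intro k
  have hβk := (hβ k).le
  have hγk := (hγ k).le
  constructor
  · have h1 := hbound' k
    have h2 : 0 ≤ H₂ * p * β k := by positivity
    simp only [hE] at h1
    linarith
  · have h1 := hYbound k
    have h2 := mul_le_mul_of_nonneg_left (show Y 0 ≤ M by linarith [hZ 0])
      (sq_nonneg (∏ j ∈ Finset.range k, (1 - γ j * a₂ / 8)))
    have h3 : 0 ≤ H₁ * (1 + M) * p * γ k := by positivity
    linarith

end ScalarRecursion

/-! ### Two-smoothness of L^p with a constant linear in p -/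

section Smoothness

/-- Bernoulli's inequality is used with exponent e + 1, followed by t^{e+1} ≤ t^e for t = m / M. In
this form it covers 0 < e < 1 as well, where the derivative of t^e is unbounded near 0. -/
theorem Real.rpow_sub_rpow_mul_le {m M e : ℝ} (hm : 0 ≤ m) (hmM : m ≤ M) (he : 0 ≤ e) :
    (M ^ e - m ^ e) * M ≤ (e + 1) * M ^ e * (M - m) := by
  rcases (hm.trans hmM).eq_or_lt with h0 | h0
  · have : m = M := le_antisymm hmM (h0 ▸ hm)
    simp [this]
  have ht0 : 0 ≤ m / M := by positivity
  have ht1 : m / M ≤ 1 := (div_le_one h0).2 hmM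
  have h1 := one_add_mul_self_le_rpow_one_add (s := m / M - 1) (by linarith) (p := e + 1)
    (by linarith)
  have h2 : (m / M) ^ (e + 1) ≤ (m / M) ^ e := by
    rcases ht0.eq_or_lt with h | h
    · rw [← h, Real.zero_rpow (by positivity)]
      positivity
    · exact Real.rpow_le_rpow_of_exponent_ge h ht1 (by linarith)
  rw [add_sub_cancel] at h1
  have h3 : 1 - (m / M) ^ e ≤ (e + 1) * (1 - m / M) := by linarith
  rw [Real.div_rpow hm h0.le] at h3
  have hMe : 0 < M ^ e := by positivity
  have h4 := mul_le_mul_of_nonneg_left h3 (by positivity : 0 ≤ M ^ e * M)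
  calc (M ^ e - m ^ e) * M = M ^ e * M * (1 - m ^ e / M ^ e) := by field_simp
    _ ≤ _ := h4
    _ = _ := by field_simp

/-- A second-order Taylor bound for `‖x‖ ^ p`. -/
theorem norm_add_rpow_le {E : Type*} [NormedAddCommGroup E] [InnerProductSpace ℝ E] {p : ℝ}
    (hp : 2 ≤ p) (x d : E) :
    ‖x + d‖ ^ p ≤ ‖x‖ ^ p + p * (‖x‖ ^ (p - 2) * inner ℝ x d)
      + p ^ 2 * ((‖x‖ + ‖d‖) ^ (p - 2) * ‖d‖ ^ 2) := by
  set u := ‖x + d‖ with hu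
  set v := ‖x‖ with hv
  set δ := ‖d‖ with hδ
  have hu0 : 0 ≤ u := norm_nonneg _
  have hv0 : 0 ≤ v := norm_nonneg _
  have hδ0 : 0 ≤ δ := norm_nonneg _
  have hsq : u ^ 2 - v ^ 2 = 2 * inner ℝ x d + δ ^ 2 := by
    rw [hu, norm_add_sq_real]; ring
  have huv : u ≤ v + δ := norm_add_le _ _
  have hvu : v ≤ u + δ := by
    have := norm_sub_le (x + d) d
    rwa [add_sub_cancel_right] at this
  have hpow : ∀ t : ℝ, 0 ≤ t → t ^ p = t ^ (p - 2) * t ^ 2 := fun t ht => by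
    rw [← Real.rpow_natCast t 2, ← Real.rpow_add_of_nonneg ht (by linarith) (by norm_num)]
    congr 1; norm_num
  have hpow' : ∀ t : ℝ, 0 ≤ t → (t ^ 2) ^ (p / 2) = t ^ p := fun t ht => by
    rw [← Real.rpow_natCast t 2, ← Real.rpow_mul ht]
    congr 1; push_cast; ring
  -- The convex function s ↦ s^{p/2} lies above its tangent at s = u². Replacing u^{p-2} by v^{p-2}
  -- in the slope then produces the first-order term, at the cost of the cross term `hcross`.
  have htan : u ^ p - v ^ p ≤ p / 2 * u ^ (p - 2) * (u ^ 2 - v ^ 2) := by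
    rcases hu0.eq_or_lt with h0 | h0
    · rw [← h0, Real.zero_rpow (by linarith)]
      rcases hp.eq_or_lt with h2 | h2
      · rw [← h2]; norm_num
      · rw [Real.zero_rpow (by linarith)]
        have : 0 ≤ v ^ p := by positivity
        linarith
    · have h1 := one_add_mul_self_le_rpow_one_add (s := (v ^ 2) / u ^ 2 - 1)
        (by have : 0 ≤ v ^ 2 / u ^ 2 := by positivity
            linarith) (p := p / 2) (by linarith)
      rw [add_sub_cancel, Real.div_rpow (by positivity) (by positivity), hpow' _ hu0,
        hpow' _ hv0] at h1
      have hup : 0 < u ^ p := by positivity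
      have h2 := mul_le_mul_of_nonneg_left h1 hup.le
      rw [mul_div_cancel₀ _ hup.ne'] at h2
      have e1 : u ^ p * (1 + p / 2 * (v ^ 2 / u ^ 2 - 1))
          = u ^ p + p / 2 * u ^ (p - 2) * (v ^ 2 - u ^ 2) := by
        rw [hpow u hu0]
        field_simp
      rw [e1] at h2
      linarith
  have hM : ∀ t, 0 ≤ t → t ≤ v + δ → t ^ (p - 2) ≤ (v + δ) ^ (p - 2) := fun t ht h =>
    Real.rpow_le_rpow ht h (by linarith)
  have hN0 : 0 ≤ (v + δ) ^ (p - 2) := by positivity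
  have hcross : (u ^ (p - 2) - v ^ (p - 2)) * (u ^ 2 - v ^ 2)
      ≤ 2 * (p - 1) * (v + δ) ^ (p - 2) * δ ^ 2 := by
    have key : ∀ m M, 0 ≤ m → m ≤ M → M ≤ v + δ → M - m ≤ δ →
        (M ^ (p - 2) - m ^ (p - 2)) * (M ^ 2 - m ^ 2)
          ≤ 2 * (p - 1) * (v + δ) ^ (p - 2) * δ ^ 2 := by
      intro m M hm hmM hMv hd
      have h1 := Real.rpow_sub_rpow_mul_le hm hmM (e := p - 2) (by linarith)
      have h2 : 0 ≤ M ^ (p - 2) - m ^ (p - 2) :=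
        sub_nonneg.2 (Real.rpow_le_rpow hm hmM (by linarith))
      have hM0 : 0 ≤ M := hm.trans hmM
      calc (M ^ (p - 2) - m ^ (p - 2)) * (M ^ 2 - m ^ 2)
          = (M ^ (p - 2) - m ^ (p - 2)) * ((M + m) * (M - m)) := by ring
        _ ≤ (M ^ (p - 2) - m ^ (p - 2)) * ((2 * M) * δ) := by
            gcongr
            linarith
        _ = 2 * δ * ((M ^ (p - 2) - m ^ (p - 2)) * M) := by ring
        _ ≤ 2 * δ * ((p - 2 + 1) * M ^ (p - 2) * (M - m)) := by gcongr
        _ ≤ 2 * δ * ((p - 2 + 1) * (v + δ) ^ (p - 2) * δ) := by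
            have h4 := hM M hM0 hMv
            have : 0 ≤ p - 2 + 1 := by linarith
            have : 0 ≤ M - m := by linarith
            gcongr
        _ = _ := by ring
    rcases le_total v u with h | h
    · exact key v u hv0 h huv (by linarith)
    · have := key u v hu0 h (by linarith) (by linarith)
      linarith
  have hv' := hM v hv0 (by linarith)
  have h5 : p / 2 * v ^ (p - 2) * δ ^ 2 ≤ p / 2 * (v + δ) ^ (p - 2) * δ ^ 2 := by gcongr
  have h6 : p / 2 * ((u ^ (p - 2) - v ^ (p - 2)) * (u ^ 2 - v ^ 2))
      ≤ p / 2 * (2 * (p - 1) * (v + δ) ^ (p - 2) * δ ^ 2) := by gcongr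
  have h7 : 0 ≤ (v + δ) ^ (p - 2) * δ ^ 2 := by positivity
  have h8 : p / 2 * v ^ (p - 2) * (u ^ 2 - v ^ 2)
      = p * (v ^ (p - 2) * inner ℝ x d) + p / 2 * v ^ (p - 2) * δ ^ 2 := by rw [hsq]; ring
  nlinarith

/-- The scalar step from a bound for the `p`-th power to a bound for the square. -/
theorem sq_le_of_rpow_le {p A B N : ℝ} (hp : 2 ≤ p) (hA : 0 ≤ A) (hB : 0 ≤ B) (hN : 0 ≤ N)
    (htri : N ≤ A + B) (h : N ^ p ≤ A ^ p + p ^ 2 * ((A + B) ^ (p - 2) * B ^ 2)) :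
    N ^ 2 ≤ A ^ 2 + 6 * p * B ^ 2 := by
  -- If A ≤ pB, the triangle inequality suffices because 2AB ≤ 2pB². Otherwise (1 + B/A)^{p-2} ≤
  -- exp((p - 2) B/A) ≤ e < 3, and Bernoulli's inequality with exponent p / 2 recovers the square.
  rcases le_or_gt A (p * B) with hc | hc
  · have h1 := pow_le_pow_left₀ hN htri 2
    have h2 := mul_le_mul_of_nonneg_right hc hB
    have h3 : 2 * B ^ 2 ≤ p * B ^ 2 := by gcongr
    nlinarith
  have hA0 : 0 < A := lt_of_le_of_lt (by positivity) hc
  have hexp : (A + B) ^ (p - 2) ≤ 3 * A ^ (p - 2) := by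
    have e1 : A + B = A * (1 + B / A) := by field_simp
    have h0 : 0 ≤ B / A := by positivity
    rw [e1, Real.mul_rpow hA (by positivity), mul_comm]
    refine mul_le_mul_of_nonneg_right ?_ (by positivity)
    have h1 : (1 + B / A) ^ (p - 2) ≤ Real.exp (B / A) ^ (p - 2) :=
      Real.rpow_le_rpow (by positivity) (by linarith [Real.add_one_le_exp (B / A)]) (by linarith)
    rw [← Real.exp_mul] at h1
    have h2 : B / A * (p - 2) ≤ 1 := by
      rw [div_mul_eq_mul_div, div_le_one hA0]
      nlinarith
    have h3 := Real.exp_le_exp.2 h2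
    have h4 := Real.exp_one_lt_d9
    linarith
  have hpow : ∀ t : ℝ, 0 ≤ t → (t ^ 2) ^ (p / 2) = t ^ p := fun t ht => by
    rw [← Real.rpow_natCast t 2, ← Real.rpow_mul ht]
    congr 1; push_cast; ring
  have hAp : A ^ p = A ^ (p - 2) * A ^ 2 := by
    rw [← Real.rpow_natCast A 2, ← Real.rpow_add hA0]
    congr 1; norm_num
  have hbern : A ^ p + 3 * p ^ 2 * (A ^ (p - 2) * B ^ 2) ≤ (A ^ 2 + 6 * p * B ^ 2) ^ (p / 2) := by
    have h1 := one_add_mul_self_le_rpow_one_add (s := 6 * p * B ^ 2 / A ^ 2)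
      (by have : 0 ≤ 6 * p * B ^ 2 / A ^ 2 := by positivity
          linarith) (p := p / 2) (by linarith)
    have e1 : A ^ 2 + 6 * p * B ^ 2 = A ^ 2 * (1 + 6 * p * B ^ 2 / A ^ 2) := by field_simp
    rw [e1, Real.mul_rpow (by positivity) (by positivity), hpow A hA]
    have h2 := mul_le_mul_of_nonneg_left h1 (by positivity : 0 ≤ A ^ p)
    refine le_trans (le_of_eq ?_) h2
    rw [hAp]
    field_simp
    ring
  have hle : (N ^ 2) ^ (p / 2) ≤ (A ^ 2 + 6 * p * B ^ 2) ^ (p / 2) := by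
    rw [hpow N hN]
    refine (h.trans ?_).trans hbern
    have := mul_le_mul_of_nonneg_right hexp (by positivity : 0 ≤ p ^ 2 * B ^ 2)
    linarith
  exact (Real.rpow_le_rpow_iff (by positivity) (by positivity) (by linarith)).1 hle

variable {Ω : Type*} {m mΩ : MeasurableSpace Ω} {μ : Measure Ω}

theorem lpNorm_rpow_eq_integral {E : Type*} [NormedAddCommGroup E] {f : Ω → E} {p : ℝ}
    (hp : 2 ≤ p) (hf : MemLp f (ENNReal.ofReal p) μ) :
    lpNorm f (ENNReal.ofReal p) μ ^ p = ∫ ω, ‖f ω‖ ^ p ∂μ := by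
  have hp0 : 0 < p := by linarith
  rw [lpNorm_eq_integral_norm_rpow_toReal (by simpa using hp0) ENNReal.ofReal_ne_top hf.1,
    ENNReal.toReal_ofReal hp0.le, ← Real.rpow_mul (by positivity), inv_mul_cancel₀ hp0.ne',
    Real.rpow_one]

/-- A Hölder inequality for `a ^ (p - 2) * b ^ 2`. -/
theorem integral_rpow_mul_sq_le {f g : Ω → ℝ} {p S T : ℝ} (hp : 2 ≤ p)
    (hf0 : ∀ ω, 0 ≤ f ω) (hg0 : ∀ ω, 0 ≤ g ω) (hS : 0 < S) (hT : 0 < T)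
    (hf : Integrable (fun ω => f ω ^ p) μ) (hg : Integrable (fun ω => g ω ^ p) μ)
    (hfS : ∫ ω, f ω ^ p ∂μ ≤ S ^ p) (hgT : ∫ ω, g ω ^ p ∂μ ≤ T ^ p) :
    ∫ ω, f ω ^ (p - 2) * g ω ^ 2 ∂μ ≤ S ^ (p - 2) * T ^ 2 := by
  have hp0 : 0 < p := by linarith
  -- Weighted Young after normalisation by S and T; the weight (p - 2) / p may be zero, so p = 2
  -- needs no separate treatment.
  have hyoung : ∀ ω, f ω ^ (p - 2) * g ω ^ 2 ≤
      S ^ (p - 2) * T ^ 2 * ((p - 2) / p * (f ω ^ p / S ^ p) + 2 / p * (g ω ^ p / T ^ p)) := by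
    intro ω
    have h1 := Real.geom_mean_le_arith_mean2_weighted (w₁ := (p - 2) / p) (w₂ := 2 / p)
      (p₁ := (f ω / S) ^ p) (p₂ := (g ω / T) ^ p)
      (div_nonneg (by linarith) hp0.le) (by positivity)
      (Real.rpow_nonneg (div_nonneg (hf0 ω) hS.le) _)
      (Real.rpow_nonneg (div_nonneg (hg0 ω) hT.le) _) (by field_simp; ring)
    rw [← Real.rpow_mul (div_nonneg (hf0 ω) hS.le), ← Real.rpow_mul (div_nonneg (hg0 ω) hT.le),
      mul_div_cancel₀ _ hp0.ne', mul_div_cancel₀ _ hp0.ne', Real.div_rpow (hf0 ω) hS.le,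
      Real.div_rpow (hg0 ω) hT.le, Real.div_rpow (hf0 ω) hS.le, Real.div_rpow (hg0 ω) hT.le] at h1
    have hSp : 0 < S ^ (p - 2) := by positivity
    have h2 := mul_le_mul_of_nonneg_left h1 (by positivity : 0 ≤ S ^ (p - 2) * T ^ 2)
    refine le_trans (le_of_eq ?_) h2
    rw [Real.rpow_two, Real.rpow_two]
    field_simp
  have hint : Integrable (fun ω => S ^ (p - 2) * T ^ 2 *
      ((p - 2) / p * (f ω ^ p / S ^ p) + 2 / p * (g ω ^ p / T ^ p))) μ :=
    (((hf.div_const _).const_mul _).add ((hg.div_const _).const_mul _)).const_mul _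
  have h3 := integral_mono_of_nonneg (Filter.Eventually.of_forall fun ω =>
    mul_nonneg (Real.rpow_nonneg (hf0 ω) _) (sq_nonneg _)) hint
    (Filter.Eventually.of_forall hyoung)
  refine h3.trans ?_
  rw [integral_const_mul, integral_add ((hf.div_const _).const_mul _)
    ((hg.div_const _).const_mul _), integral_const_mul, integral_const_mul, integral_div,
    integral_div]
  have hSp : 0 < S ^ p := by positivity
  have hTp : 0 < T ^ p := by positivity
  have h4 : (∫ ω, f ω ^ p ∂μ) / S ^ p ≤ 1 := (div_le_one hSp).2 hfS
  have h5 : (∫ ω, g ω ^ p ∂μ) / T ^ p ≤ 1 := (div_le_one hTp).2 hgT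
  have h6 : 0 ≤ (p - 2) / p := div_nonneg (by linarith) hp0.le
  have h7 : (p - 2) / p * ((∫ ω, f ω ^ p ∂μ) / S ^ p) + 2 / p * ((∫ ω, g ω ^ p ∂μ) / T ^ p)
      ≤ 1 := by
    calc _ ≤ (p - 2) / p * 1 + 2 / p * 1 := by gcongr
      _ = 1 := by field_simp; ring
  calc _ ≤ S ^ (p - 2) * T ^ 2 * 1 := by gcongr
    _ = _ := mul_one _

theorem MemLp.of_bounded {F : Type*} [NormedAddCommGroup F] [IsFiniteMeasure μ] {f : Ω → F}
    {q : ENNReal} (hf : AEStronglyMeasurable f μ) (h : ∃ c, ∀ ω, ‖f ω‖ ≤ c) : MemLp f q μ := by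
  obtain ⟨c, hc⟩ := h
  exact MemLp.of_bound hf c (Filter.Eventually.of_forall hc)

/-- The first-order term of the expansion of `‖X + D‖ ^ p` vanishes for a martingale difference
`D`. -/
theorem integral_rpow_mul_inner_eq_zero {E : Type*} [NormedAddCommGroup E] [InnerProductSpace ℝ E]
    [CompleteSpace E] [IsProbabilityMeasure μ] (hm : m ≤ mΩ) {X D : Ω → E}
    {e : ℝ} (he : 0 ≤ e)
    (hX : StronglyMeasurable[m] X) (hD : AEStronglyMeasurable D μ)
    (hXb : ∃ c, ∀ ω, ‖X ω‖ ≤ c) (hDb : ∃ c, ∀ ω, ‖D ω‖ ≤ c) (hD0 : μ[D | m] =ᵐ[μ] 0) :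
    Integrable (fun ω => ‖X ω‖ ^ e * inner ℝ (X ω) (D ω)) μ ∧
      ∫ ω, ‖X ω‖ ^ e * inner ℝ (X ω) (D ω) ∂μ = 0 := by
  obtain ⟨cX, hcX⟩ := hXb
  obtain ⟨cD, hcD⟩ := hDb
  have hn : StronglyMeasurable[m] fun ω => ‖X ω‖ ^ e :=
    (Real.continuous_rpow_const he).comp_stronglyMeasurable hX.norm
  have hY : StronglyMeasurable[m] fun ω => ‖X ω‖ ^ e • X ω := hn.smul hX
  have heq : ∀ ω, innerSL ℝ (‖X ω‖ ^ e • X ω) (D ω) = ‖X ω‖ ^ e * inner ℝ (X ω) (D ω) :=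
    fun ω => by rw [innerSL_apply_apply, real_inner_smul_left]
  have hDi : Integrable D μ := memLp_one_iff_integrable.1 (MemLp.of_bounded hD ⟨cD, hcD⟩)
  have hint : Integrable (fun ω => innerSL ℝ (‖X ω‖ ^ e • X ω) (D ω)) μ := by
    refine memLp_one_iff_integrable.1 (MemLp.of_bounded ?_ ⟨cX ^ e * cX * cD, fun ω => ?_⟩)
    · simp only [innerSL_apply_apply]
      exact (hY.mono hm).aestronglyMeasurable.inner hD
    · rw [innerSL_apply_apply]
      refine (norm_inner_le_norm _ _).trans ?_
      have h0 : 0 ≤ cX := (norm_nonneg _).trans (hcX ω)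
      have h1 : ‖X ω‖ ^ e ≤ cX ^ e := Real.rpow_le_rpow (norm_nonneg _) (hcX ω) he
      rw [norm_smul, Real.norm_of_nonneg (by positivity)]
      have := hcX ω
      have := hcD ω
      gcongr
  -- The weighted vector ‖X‖^e X is known given `m`, so it can be pulled out of the conditional
  -- expectation of its inner product with D.
  have h1 := condExp_bilin_of_stronglyMeasurable_left (innerSL ℝ) hY hint hDi
  have h2 : ∫ ω, innerSL ℝ (‖X ω‖ ^ e • X ω) (D ω) ∂μ = 0 := by
    rw [← integral_condExp hm, integral_congr_ae h1]
    have h3 : (fun ω => innerSL ℝ (‖X ω‖ ^ e • X ω) (μ[D | m] ω)) =ᵐ[μ] fun _ => (0 : ℝ) := by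
      filter_upwards [hD0] with ω hω
      rw [hω, Pi.zero_apply, map_zero]
    rw [integral_congr_ae h3, integral_zero]
  simp only [heq] at hint h2
  exact ⟨hint, h2⟩

theorem MemLp.integrable_norm_rpow_ofReal {F : Type*} [NormedAddCommGroup F]
    [IsFiniteMeasure μ] {f : Ω → F} {p : ℝ} (hp : 2 ≤ p)
    (hf : MemLp f (ENNReal.ofReal p) μ) : Integrable (fun ω => ‖f ω‖ ^ p) μ := by
  have := hf.integrable_norm_rpow (by simpa using (by linarith : 0 < p)) ENNReal.ofReal_ne_top
  rwa [ENNReal.toReal_ofReal (by linarith)] at this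

theorem integral_norm_add_norm_rpow_le {E : Type*} [NormedAddCommGroup E] [IsFiniteMeasure μ] {X D : Ω → E} {p : ℝ}
    (hp : 2 ≤ p) (hX : MemLp X (ENNReal.ofReal p) μ) (hD : MemLp D (ENNReal.ofReal p) μ) :
    Integrable (fun ω => (‖X ω‖ + ‖D ω‖) ^ p) μ ∧ ∫ ω, (‖X ω‖ + ‖D ω‖) ^ p ∂μ
      ≤ (lpNorm X (ENNReal.ofReal p) μ + lpNorm D (ENNReal.ofReal p) μ) ^ p := by
  have hSp : MemLp (fun ω => ‖X ω‖ + ‖D ω‖) (ENNReal.ofReal p) μ := hX.norm.add hD.norm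
  have hSnorm : ∀ ω, ‖(‖X ω‖ + ‖D ω‖)‖ = ‖X ω‖ + ‖D ω‖ := fun ω =>
    Real.norm_of_nonneg (by positivity)
  have h1p : 1 ≤ ENNReal.ofReal p := by
    rw [ENNReal.one_le_ofReal]; linarith
  have h1 := MemLp.integrable_norm_rpow_ofReal hp hSp
  have h2 := lpNorm_rpow_eq_integral hp hSp
  simp only [hSnorm] at h1 h2
  refine ⟨h1, ?_⟩
  rw [← h2]
  refine Real.rpow_le_rpow lpNorm_nonneg ?_ (by linarith)
  have h3 := lpNorm_add_le hX.norm (g := fun ω => ‖D ω‖) h1p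
  rw [lpNorm_norm hX.1, lpNorm_norm hD.1] at h3
  exact h3

theorem integral_norm_add_rpow_le {E : Type*} [NormedAddCommGroup E] [InnerProductSpace ℝ E]
    [IsProbabilityMeasure μ] {X D : Ω → E} {p : ℝ}
    (hp : 2 ≤ p) (hX : AEStronglyMeasurable X μ) (hD : AEStronglyMeasurable D μ)
    (hXb : ∃ c, ∀ ω, ‖X ω‖ ≤ c) (hDb : ∃ c, ∀ ω, ‖D ω‖ ≤ c)
    (hI : Integrable (fun ω => ‖X ω‖ ^ (p - 2) * inner ℝ (X ω) (D ω)) μ)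
    (hI0 : ∫ ω, ‖X ω‖ ^ (p - 2) * inner ℝ (X ω) (D ω) ∂μ = 0) :
    ∫ ω, ‖(X + D) ω‖ ^ p ∂μ ≤ ∫ ω, ‖X ω‖ ^ p ∂μ
      + p ^ 2 * ∫ ω, (‖X ω‖ + ‖D ω‖) ^ (p - 2) * ‖D ω‖ ^ 2 ∂μ := by
  have hXp : MemLp X (ENNReal.ofReal p) μ := MemLp.of_bounded hX hXb
  have hDp : MemLp D (ENNReal.ofReal p) μ := MemLp.of_bounded hD hDb
  obtain ⟨cX, hcX⟩ := hXb
  obtain ⟨cD, hcD⟩ := hDb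
  have hRint : Integrable (fun ω => (‖X ω‖ + ‖D ω‖) ^ (p - 2) * ‖D ω‖ ^ 2) μ := by
    refine memLp_one_iff_integrable.1 (MemLp.of_bounded ?_
      ⟨(cX + cD) ^ (p - 2) * cD ^ 2, fun ω => ?_⟩)
    · exact ((Real.continuous_rpow_const (by linarith)).comp_aestronglyMeasurable
        (hX.norm.add hD.norm)).mul (hD.norm.pow 2)
    · rw [Real.norm_of_nonneg (by positivity)]
      have h1 := hcX ω
      have h2 := hcD ω
      have h3 : (‖X ω‖ + ‖D ω‖) ^ (p - 2) ≤ (cX + cD) ^ (p - 2) :=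
        Real.rpow_le_rpow (by positivity) (by linarith) (by linarith)
      have h4 : 0 ≤ cX + cD := by linarith [norm_nonneg (X ω), norm_nonneg (D ω)]
      gcongr
  have hXpint := MemLp.integrable_norm_rpow_ofReal hp hXp
  have h1 := integral_mono (MemLp.integrable_norm_rpow_ofReal hp (hXp.add hDp))
    ((hXpint.add (hI.const_mul p)).add (hRint.const_mul (p ^ 2)))
    fun ω => norm_add_rpow_le hp (X ω) (D ω)
  refine h1.trans (le_of_eq ?_)
  refine (integral_add (hXpint.add (hI.const_mul p)) (hRint.const_mul (p ^ 2))).trans ?_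
  rw [integral_const_mul]
  congr 1
  refine (integral_add hXpint (hI.const_mul p)).trans ?_
  rw [integral_const_mul, hI0, mul_zero, add_zero]

/-- The space `L^p` of Hilbert space valued functions is two-smooth with a constant of
order `p`. -/
theorem sq_lpNorm_add_le {E : Type*} [NormedAddCommGroup E] [InnerProductSpace ℝ E]
    [CompleteSpace E] [IsProbabilityMeasure μ] (hm : m ≤ mΩ) {X D : Ω → E} {p : ℝ}
    (hp : 2 ≤ p) (hX : StronglyMeasurable[m] X) (hD : AEStronglyMeasurable D μ)
    (hXb : ∃ c, ∀ ω, ‖X ω‖ ≤ c) (hDb : ∃ c, ∀ ω, ‖D ω‖ ≤ c) (hD0 : μ[D | m] =ᵐ[μ] 0) :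
    lpNorm (X + D) (ENNReal.ofReal p) μ ^ 2 ≤ lpNorm X (ENNReal.ofReal p) μ ^ 2
      + 6 * p * lpNorm D (ENNReal.ofReal p) μ ^ 2 := by
  have hXae : AEStronglyMeasurable X μ := (hX.mono hm).aestronglyMeasurable
  have hXp : MemLp X (ENNReal.ofReal p) μ := MemLp.of_bounded hXae hXb
  have hDp : MemLp D (ENNReal.ofReal p) μ := MemLp.of_bounded hD hDb
  have h1p : 1 ≤ ENNReal.ofReal p := by
    rw [ENNReal.one_le_ofReal]; linarith
  have htri : lpNorm (X + D) (ENNReal.ofReal p) μ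
      ≤ lpNorm X (ENNReal.ofReal p) μ + lpNorm D (ENNReal.ofReal p) μ := lpNorm_add_le hXp h1p
  have hS := integral_norm_add_norm_rpow_le hp hXp hDp
  obtain ⟨hI, hI0⟩ := integral_rpow_mul_inner_eq_zero hm (e := p - 2) (by linarith) hX hD hXb hDb
    hD0
  have hmain := integral_norm_add_rpow_le hp hXae hD hXb hDb hI hI0
  rw [← lpNorm_rpow_eq_integral hp (hXp.add hDp), ← lpNorm_rpow_eq_integral hp hXp] at hmain
  have hDe := lpNorm_rpow_eq_integral hp hDp
  have hDi := MemLp.integrable_norm_rpow_ofReal hp hDp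
  have hA0 : 0 ≤ lpNorm X (ENNReal.ofReal p) μ := lpNorm_nonneg
  have hB0 : 0 ≤ lpNorm D (ENNReal.ofReal p) μ := lpNorm_nonneg
  have hN0 : 0 ≤ lpNorm (X + D) (ENNReal.ofReal p) μ := lpNorm_nonneg
  generalize lpNorm X (ENNReal.ofReal p) μ = A at *
  generalize lpNorm D (ENNReal.ofReal p) μ = B at *
  generalize lpNorm (X + D) (ENNReal.ofReal p) μ = N at *
  -- The normalised Hölder bound divides by B; for B = 0 the triangle inequality is enough.
  rcases hB0.eq_or_lt with hBz | hBpos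
  · rw [← hBz, add_zero] at htri
    rw [← hBz]
    have := pow_le_pow_left₀ hN0 htri 2
    linarith
  refine sq_le_of_rpow_le hp hA0 hB0 hN0 htri (hmain.trans ?_)
  have hHol := integral_rpow_mul_sq_le hp (fun ω => by positivity) (fun ω => norm_nonneg _)
    (by positivity : 0 < A + B) hBpos hS.1 hDi hS.2 hDe.symm.le
  gcongr

end Smoothness

/-! ### Smallness of the decoupling matrices -/

section Decoupling

theorem SmallSteps.slow_le {p ε : ℝ} {β γ : ℕ → ℝ} (h : SmallSteps p ε β γ) (k : ℕ) : β k ≤ ε := by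
  have := h.mul_slow_le k
  have := h.slow_pos k
  have := h.two_le
  nlinarith

theorem SmallSteps.fast_le {p ε : ℝ} {β γ : ℕ → ℝ} (h : SmallSteps p ε β γ) (k : ℕ) : γ k ≤ ε := by
  have := h.mul_fast_le k
  have := h.fast_pos k
  have := h.two_le
  nlinarith

theorem SmallSteps.slow_le_mul_fast {p ε : ℝ} {β γ : ℕ → ℝ} (h : SmallSteps p ε β γ) (k : ℕ) :
    β k ≤ ε * γ k :=
  (div_le_iff₀ (h.fast_pos k)).1 (h.ratio_le k)

theorem IsLyapunovFactor.norm_matrix_le {d n : ℕ} {A B : Matrix (Fin d) (Fin d) ℝ} {c M τ : ℝ}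
    (h : IsLyapunovFactor A B c M τ) (N : Matrix (Fin d) (Fin n) ℝ) : ‖N‖ ≤ M * ‖B * N‖ := by
  have hM := h.cond_pos
  refine Matrix.l2_opNorm_le_bound _ (by positivity) fun x => ?_
  refine (h.norm_le _).trans ?_
  rw [← Matrix.toEuclideanLin_mul_apply, mul_assoc]
  exact mul_le_mul_of_nonneg_left (Matrix.norm_toEuclideanLin_le _ _) hM.le

/-- Applying the vector bound to each N x passes it to the operator norm. It is needed because the
L_k themselves perform Euler steps for A₂₂. -/
theorem IsLyapunovFactor.norm_matrix_step_le {d n : ℕ} {A B : Matrix (Fin d) (Fin d) ℝ}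
    {c M τ : ℝ} (h : IsLyapunovFactor A B c M τ) (N : Matrix (Fin d) (Fin n) ℝ) {t : ℝ}
    (ht0 : 0 ≤ t) (ht : t ≤ τ) (ht1 : c * t ≤ 1) :
    ‖B * (N - t • (A * N))‖ ≤ (1 - c * t) * ‖B * N‖ := by
  have hc : 0 ≤ 1 - c * t := by linarith
  refine Matrix.l2_opNorm_le_bound _ (by positivity) fun x => ?_
  have h1 := h.norm_step_le t ht0 ht (N.toEuclideanLin x)
  have e : (B * (N - t • (A * N))).toEuclideanLin x
      = B.toEuclideanLin (N.toEuclideanLin x - t • A.toEuclideanLin (N.toEuclideanLin x)) := by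
    rw [Matrix.toEuclideanLin_mul_apply, map_sub, map_smul, LinearMap.sub_apply,
      LinearMap.smul_apply, Matrix.toEuclideanLin_mul_apply]
  rw [e]
  refine h1.trans ?_
  rw [← Matrix.toEuclideanLin_mul_apply, mul_assoc]
  exact mul_le_mul_of_nonneg_left (Matrix.norm_toEuclideanLin_le _ _) hc

namespace LinSystem

variable {dθ dw : ℕ} (S : LinSystem dθ dw)

theorem norm_U_le {β γ : ℕ → ℝ} {k : ℕ} {ℓ : ℝ} (h : ‖S.L β γ k‖ ≤ ℓ) :
    ‖S.U β γ k‖ ≤ ‖S.Δ‖ + ‖S.A12‖ * ℓ := by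
  unfold LinSystem.U
  refine (norm_sub_le _ _).trans (add_le_add_right ?_ _)
  exact (Matrix.l2_opNorm_mul _ _).trans (mul_le_mul_of_nonneg_left h (norm_nonneg _))

theorem L_succ_mul {β γ : ℕ → ℝ} {k : ℕ} (h : IsUnit (1 - β k • S.U β γ k)) :
    S.L β γ (k + 1) * (1 - β k • S.U β γ k)
      = S.L β γ k - γ k • (S.A22 * S.L β γ k) + β k • (S.A22⁻¹ * S.A21 * S.U β γ k) := by
  conv_lhs => rw [LinSystem.L]
  unfold LinSystem.U at *
  rw [Matrix.mul_assoc, Matrix.nonsing_inv_mul _ ((Matrix.isUnit_iff_isUnit_det _).1 h),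
    Matrix.mul_one]

theorem isUnit_one_sub_smul_U {β γ : ℕ → ℝ} {k : ℕ} {ℓ : ℝ} (hβ : 0 ≤ β k)
    (h : ‖S.L β γ k‖ ≤ ℓ) (hs : β k * (‖S.Δ‖ + ‖S.A12‖ * ℓ) < 1) :
    IsUnit (1 - β k • S.U β γ k) := by
  refine isUnit_one_sub_of_norm_lt_one ?_
  rw [norm_smul, Real.norm_of_nonneg hβ]
  exact (mul_le_mul_of_nonneg_left (S.norm_U_le h) hβ).trans_lt hs

/-- The decoupling matrices are well defined and small for small and well-separated step sizes. -/
theorem exists_norm_L_le {B : Matrix (Fin dw) (Fin dw) ℝ} {c M τ : ℝ}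
    (hB : IsLyapunovFactor S.A22 B c M τ) {ℓ : ℝ} (hℓ : 0 < ℓ) :
    ∃ ε > 0, ∀ (p : ℝ) (β γ : ℕ → ℝ), SmallSteps p ε β γ → ∀ k,
      ‖S.L β γ k‖ ≤ ℓ ∧ IsUnit (1 - β k • S.U β γ k) := by
  have hc := hB.rate_pos
  have hM := hB.cond_pos
  set u := ‖S.Δ‖ + ‖S.A12‖ * ℓ with hu
  have hu0 : 0 ≤ u := by positivity
  set ℓ' := ℓ / M with hℓ'
  have hℓ'0 : 0 < ℓ' := by positivity
  set κ := ‖B * (S.A22⁻¹ * S.A21)‖ with hκ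
  have hκ0 : 0 ≤ κ := norm_nonneg _
  obtain ⟨ε, hε, hεi⟩ := exists_pos_mul_le ![2 * u, 1, c, κ * u + ℓ' * u] ![1, τ, 1, c * ℓ']
    (by have := hB.step_pos
        intro i; fin_cases i <;> simp <;> positivity)
  have h₀ : 2 * u * ε ≤ 1 := hεi 0
  have h₁ : 1 * ε ≤ τ := hεi 1
  have h₂ : c * ε ≤ 1 := hεi 2
  have h₃ : (κ * u + ℓ' * u) * ε ≤ c * ℓ' := hεi 3
  refine ⟨ε, hε, fun p β γ hs k => ?_⟩
  have hL : ∀ k, ‖B * S.L β γ k‖ ≤ ℓ' → ‖S.L β γ k‖ ≤ ℓ := fun k h => by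
    refine (hB.norm_matrix_le _).trans ((mul_le_mul_of_nonneg_left h hM.le).trans ?_)
    rw [hℓ', mul_div_cancel₀ _ hM.ne']
  have hsm : ∀ k, β k * u ≤ 1 / 2 := fun k => by
    have := mul_le_mul_of_nonneg_left (hs.slow_le k) hu0
    linarith
  have hunit : ∀ k, ‖S.L β γ k‖ ≤ ℓ → IsUnit (1 - β k • S.U β γ k) := fun k h =>
    S.isUnit_one_sub_smul_U (hs.slow_pos k).le h (by linarith [hsm k])
  suffices h : ∀ k, ‖B * S.L β γ k‖ ≤ ℓ' from ⟨hL k (h k), hunit k (hL k (h k))⟩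
  intro k
  induction k with
  | zero =>
    simp only [LinSystem.L, Matrix.mul_zero, norm_zero]
    exact hℓ'0.le
  | succ k ih =>
    have hβ := (hs.slow_pos k).le
    have hγ := (hs.fast_pos k).le
    have hγε := hs.fast_le k
    have hLk := hL k ih
    have hU := S.norm_U_le hLk
    have hcγ : c * γ k ≤ 1 := (mul_le_mul_of_nonneg_left hγε hc.le).trans h₂
    have hrec := S.L_succ_mul (hunit k hLk)
    have h1 := hB.norm_matrix_step_le (S.L β γ k) hγ (by linarith) hcγ
    have h2 : ‖B * (β k • (S.A22⁻¹ * S.A21 * S.U β γ k))‖ ≤ β k * (κ * u) := by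
      rw [Matrix.mul_smul, norm_smul, Real.norm_of_nonneg hβ, ← Matrix.mul_assoc]
      refine mul_le_mul_of_nonneg_left ((Matrix.l2_opNorm_mul _ _).trans ?_) hβ
      exact mul_le_mul_of_nonneg_left hU hκ0
    -- The recursion is kept implicit, with L_{k+1} U_k on the right, so that the inverse of I - β_k
    -- U_k never has to be estimated.
    have h3 : B * S.L β γ (k + 1) = B * (S.L β γ k - γ k • (S.A22 * S.L β γ k))
        + B * (β k • (S.A22⁻¹ * S.A21 * S.U β γ k))
        + β k • (B * S.L β γ (k + 1) * S.U β γ k) := by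
      rw [← Matrix.mul_add, ← hrec, Matrix.mul_sub, Matrix.mul_one, Matrix.mul_smul, Matrix.mul_sub,
        Matrix.mul_smul, Matrix.mul_assoc]
      abel
    have h4 : ‖β k • (B * S.L β γ (k + 1) * S.U β γ k)‖ ≤ β k * (‖B * S.L β γ (k + 1)‖ * u) := by
      rw [norm_smul, Real.norm_of_nonneg hβ]
      refine mul_le_mul_of_nonneg_left ((Matrix.l2_opNorm_mul _ _).trans ?_) hβ
      exact mul_le_mul_of_nonneg_left hU (norm_nonneg _)
    have h5 : ‖B * S.L β γ (k + 1)‖ ≤ (1 - c * γ k) * ℓ' + β k * (κ * u)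
        + β k * (‖B * S.L β γ (k + 1)‖ * u) := by
      conv_lhs => rw [h3]
      refine norm_add₃_le.trans ?_
      have : 0 ≤ 1 - c * γ k := by linarith
      gcongr
      exact h1.trans (mul_le_mul_of_nonneg_left ih this)
    have h6 : β k * (κ * u + ℓ' * u) ≤ c * γ k * ℓ' := by
      have h7 := mul_le_mul_of_nonneg_right (hs.slow_le_mul_fast k)
        (by positivity : 0 ≤ κ * u + ℓ' * u)
      have h8 := mul_le_mul_of_nonneg_right h₃ hγ
      linarith
    have h7 := hsm k
    -- If the bound ℓ' were exceeded, the implicit inequality would give c γ_k ℓ' < β_k (κu + ℓ'u),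
    -- contrary to β_k ≤ ε γ_k.
    by_contra! hlt
    have h8 : 0 < (‖B * S.L β γ (k + 1)‖ - ℓ') * (1 - β k * u) :=
      mul_pos (by linarith) (by linarith)
    nlinarith

end LinSystem

end Decoupling

/-! ### One step of the decoupled recursion, split into mean and noise -/

section MeanDynamics

theorem Matrix.norm_toEuclideanLin_le_of_le {m n : ℕ} {M : Matrix (Fin m) (Fin n) ℝ}
    {x : EuclideanSpace ℝ (Fin n)} {a b : ℝ} (hM : ‖M‖ ≤ a) (hx : ‖x‖ ≤ b) :
    ‖M.toEuclideanLin x‖ ≤ a * b :=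
  (M.norm_toEuclideanLin_le x).trans
    (mul_le_mul hM hx (norm_nonneg _) ((norm_nonneg _).trans hM))

namespace LinSystem

variable {dθ dw : ℕ} (S : LinSystem dθ dw) (β γ : ℕ → ℝ) (k : ℕ)

/-- The matrix `L_{k+1} + A₂₂⁻¹ A₂₁` that decouples the fast error after step `k`. -/
noncomputable def decoupler : Matrix (Fin dw) (Fin dθ) ℝ :=
  S.L β γ (k + 1) + S.A22⁻¹ * S.A21

/-- The matrix `A₁₂ A₂₂⁻¹` through which the fast error drives the slow one. -/
noncomputable def drive : Matrix (Fin dθ) (Fin dw) ℝ := S.A12 * S.A22⁻¹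

/-- The mean evolution of the decoupled fast error. -/
noncomputable def fastMean (w : EuclideanSpace ℝ (Fin dw)) : EuclideanSpace ℝ (Fin dw) :=
  w - γ k • S.A22.toEuclideanLin w
    - β k • (S.decoupler β γ k).toEuclideanLin (S.A12.toEuclideanLin w)

/-- The noise in the decoupled fast error. -/
noncomputable def fastNoise (v : EuclideanSpace ℝ (Fin dθ)) (w : EuclideanSpace ℝ (Fin dw)) :
    EuclideanSpace ℝ (Fin dw) :=
  β k • (S.decoupler β γ k).toEuclideanLin v + γ k • w

/-- The residual influence of the fast error on the corrected slow error. -/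
noncomputable def coupling (w : EuclideanSpace ℝ (Fin dw)) : EuclideanSpace ℝ (Fin dθ) :=
  (β k / γ k - β (k + 1) / γ (k + 1)) • S.drive.toEuclideanLin w
    - (β k * (β k / γ k)) • (S.U β γ k).toEuclideanLin (S.drive.toEuclideanLin w)
    - ((β k / γ k - β (k + 1) / γ (k + 1)) * γ k) • S.A12.toEuclideanLin w
    + (β (k + 1) / γ (k + 1) * β k) • S.drive.toEuclideanLin
        ((S.decoupler β γ k).toEuclideanLin (S.A12.toEuclideanLin w))

/-- The mean evolution of the corrected slow error `θ̃ - (β / γ) A₁₂ A₂₂⁻¹ w̃`. -/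
noncomputable def slowMean (z : EuclideanSpace ℝ (Fin dθ)) (w : EuclideanSpace ℝ (Fin dw)) :
    EuclideanSpace ℝ (Fin dθ) :=
  z - β k • (S.U β γ k).toEuclideanLin z + S.coupling β γ k w

/-- The noise in the corrected slow error. -/
noncomputable def slowNoise (v : EuclideanSpace ℝ (Fin dθ)) (w : EuclideanSpace ℝ (Fin dw)) :
    EuclideanSpace ℝ (Fin dθ) :=
  β k • v - (β (k + 1) / γ (k + 1)) • S.drive.toEuclideanLin (S.fastNoise β γ k v w)

/-- Contraction of the mean evolution and bounds for the noise and for the original errors, in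
the norms `‖B₁ ·‖` and `‖B₂ ·‖`. -/
structure StepBounds (B₁ : Matrix (Fin dθ) (Fin dθ) ℝ) (B₂ : Matrix (Fin dw) (Fin dw) ℝ)
    (c₁ c₂ C : ℝ) : Prop where
  isUnit : IsUnit (1 - β k • S.U β γ k)
  fastMean_le : ∀ w, ‖B₂.toEuclideanLin (S.fastMean β γ k w)‖
    ≤ (1 - c₂ / 2 * γ k) * ‖B₂.toEuclideanLin w‖
  slowMean_le : ∀ z w, ‖B₁.toEuclideanLin (S.slowMean β γ k z w)‖
    ≤ (1 - c₁ / 2 * β k) * ‖B₁.toEuclideanLin z‖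
      + C * (β k * (β k / γ k)) * ‖B₂.toEuclideanLin w‖
  fastNoise_le : ∀ v w, ‖B₂.toEuclideanLin (S.fastNoise β γ k v w)‖ ≤ C * γ k * (‖v‖ + ‖w‖)
  slowNoise_le : ∀ v w, ‖B₁.toEuclideanLin (S.slowNoise β γ k v w)‖ ≤ C * β k * (‖v‖ + ‖w‖)
  slowErr_le : ∀ z w, ‖z + (β k / γ k) • S.drive.toEuclideanLin w‖
    ≤ C * (‖B₁.toEuclideanLin z‖ + β k / γ k * ‖B₂.toEuclideanLin w‖)
  fastErr_le : ∀ θ w, ‖w - (S.L β γ k + S.A22⁻¹ * S.A21).toEuclideanLin θ‖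
    ≤ C * (‖θ‖ + ‖B₂.toEuclideanLin w‖)

-- Each deviation from a pure Euler step costs at most half of the contraction rate. For the slow
-- error the deviation is A₁₂ L_k, for the fast one it is β_k times the decoupler, which is small
-- against γ_k.
set_option maxHeartbeats 1000000 in
theorem exists_stepBounds {B₁ : Matrix (Fin dθ) (Fin dθ) ℝ}
    {B₂ : Matrix (Fin dw) (Fin dw) ℝ} {c₁ M₁ τ₁ c₂ M₂ τ₂ : ℝ}
    (hB₁ : IsLyapunovFactor S.Δ B₁ c₁ M₁ τ₁) (hB₂ : IsLyapunovFactor S.A22 B₂ c₂ M₂ τ₂) :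
    ∃ ε > 0, ∃ C > 0, ∀ (p : ℝ) (β γ : ℕ → ℝ), SmallSteps p ε β γ → ∀ k,
      S.StepBounds β γ k B₁ B₂ c₁ c₂ C := by
  have hc₁ := hB₁.rate_pos
  have hM₁ := hB₁.cond_pos
  have hc₂ := hB₂.rate_pos
  have hM₂ := hB₂.cond_pos
  set g := ‖S.drive‖ with hg
  set α := ‖S.A12‖ with hα
  have hg0 : 0 ≤ g := norm_nonneg _
  have hα0 : 0 ≤ α := norm_nonneg _
  set n₁ := ‖B₁‖ with hn₁
  set n₂ := ‖B₂‖ with hn₂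
  have hn₁0 : 0 ≤ n₁ := norm_nonneg _
  have hn₂0 : 0 ≤ n₂ := norm_nonneg _
  -- The bound ℓ for ‖L_k‖ is fixed first, so that replacing Δ by U_k uses at most c₁ / 2; ε is then
  -- chosen depending on ℓ.
  obtain ⟨ℓ, hℓ, hℓi⟩ := exists_pos_mul_le ![n₁ * α * M₁] ![c₁ / 2]
    (by intro i; fin_cases i; simpa using hc₁)
  have hℓ1 : n₁ * α * M₁ * ℓ ≤ c₁ / 2 := hℓi 0
  obtain ⟨ε₀, hε₀, hL⟩ := S.exists_norm_L_le hB₂ hℓ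
  set e := ‖S.A22⁻¹ * S.A21‖ with he
  have he0 : 0 ≤ e := norm_nonneg _
  set δ := ℓ + e with hδ
  have hδ0 : 0 ≤ δ := by positivity
  set υ := ‖S.Δ‖ + α * ℓ with hυ
  have hυ0 : 0 ≤ υ := by positivity
  clear_value δ υ
  obtain ⟨ε, hε, hεi⟩ := exists_pos_mul_le ![1, 1, n₂ * (δ * α) * M₂, 1, 1]
    ![ε₀, 1, c₂ / 2, τ₁, τ₂]
    (by have := hB₁.step_pos
        have := hB₂.step_pos
        intro i; fin_cases i <;> simp <;> positivity)
  have h₀ : 1 * ε ≤ ε₀ := hεi 0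
  have h₁ : 1 * ε ≤ 1 := hεi 1
  have h₂ : n₂ * (δ * α) * M₂ * ε ≤ c₂ / 2 := hεi 2
  have h₃ : 1 * ε ≤ τ₁ := hεi 3
  have h₄ : 1 * ε ≤ τ₂ := hεi 4
  -- One summand for each of the four terms of `coupling`, all of order β_k ρ_k.
  set q := g + υ * g + α + g * (δ * α) with hq
  have hq0 : 0 ≤ q := by positivity
  clear_value q
  set C₁ := n₁ * q * M₂ with hC₁
  set C₂ := n₂ * (δ + 1) with hC₂
  set C₃ := n₁ * (1 + g * (δ + 1)) with hC₃
  set C₄ := M₁ + g * M₂ with hC₄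
  set C₅ := M₂ + δ with hC₅
  clear_value C₂ C₃ C₄ C₅ C₁
  have hC₁0 : 0 ≤ C₁ := by rw [hC₁]; positivity
  have hC₂0 : 0 ≤ C₂ := by rw [hC₂]; positivity
  have hC₃0 : 0 ≤ C₃ := by rw [hC₃]; positivity
  have hC₄0 : 0 < C₄ := by rw [hC₄]; positivity
  have hC₅0 : 0 < C₅ := by rw [hC₅]; positivity
  refine ⟨ε, hε, C₁ + C₂ + C₃ + C₄ + C₅, by positivity, fun p β γ hs k => ?_⟩
  set C := C₁ + C₂ + C₃ + C₄ + C₅ with hC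
  clear_value C
  have hLk := fun k => hL p β γ (hs.mono (by linarith)) k
  have hβ := hs.slow_pos k
  have hγ := hs.fast_pos k
  have hβε := hs.slow_le k
  have hγε := hs.fast_le k
  have hβγ : β k ≤ γ k :=
    (hs.slow_le_mul_fast k).trans (mul_le_of_le_one_left hγ.le (by linarith))
  set ρ := β k / γ k with hρ
  set ρ' := β (k + 1) / γ (k + 1) with hρ'
  have hρ0 : 0 < ρ := div_pos hβ hγ
  have hρ'0 : 0 < ρ' := div_pos (hs.slow_pos _) (hs.fast_pos _)
  have hρ'ρ : ρ' ≤ ρ := hs.ratio_anti k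
  have hργ : ρ * γ k = β k := div_mul_cancel₀ _ hγ.ne'
  have hdρ : ρ - ρ' ≤ β k * ρ := by
    have h5 := hs.ratio_sub_le k
    have h6 : 0 ≤ β k * ρ := by positivity
    have h7 := mul_le_mul_of_nonneg_right (by linarith : ε ≤ 1) h6
    linarith
  have hU : ‖S.U β γ k‖ ≤ υ := (S.norm_U_le (hLk k).1).trans_eq hυ.symm
  have hD : ‖S.decoupler β γ k‖ ≤ δ :=
    ((norm_add_le _ _).trans (add_le_add_left (hLk (k + 1)).1 _)).trans_eq hδ.symm
  have hD' : ‖S.L β γ k + S.A22⁻¹ * S.A21‖ ≤ δ :=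
    ((norm_add_le _ _).trans (add_le_add_left (hLk k).1 _)).trans_eq hδ.symm
  have hnoise : ∀ v w, ‖S.fastNoise β γ k v w‖ ≤ (δ + 1) * γ k * (‖v‖ + ‖w‖) := fun v w => by
    unfold LinSystem.fastNoise
    refine (norm_add_le _ _).trans ?_
    rw [norm_smul, norm_smul, Real.norm_of_nonneg hβ.le, Real.norm_of_nonneg hγ.le]
    have h5 := Matrix.norm_toEuclideanLin_le_of_le hD (le_refl ‖v‖)
    have h6 : β k * ‖(S.decoupler β γ k).toEuclideanLin v‖ ≤ γ k * (δ * ‖v‖) := by gcongr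
    have h7 : 0 ≤ γ k * ‖v‖ := by positivity
    have h8 : 0 ≤ γ k * (δ * ‖w‖) := by positivity
    linarith
  refine ⟨(hLk k).2, fun w => ?_, fun z w => ?_, fun v w => ?_, fun v w => ?_, fun z w => ?_,
    fun θ w => ?_⟩
  · have h5 := hB₂.norm_step_le (γ k) hγ.le (by linarith) w
    have h6 : ‖β k • B₂.toEuclideanLin
        ((S.decoupler β γ k).toEuclideanLin (S.A12.toEuclideanLin w))‖
        ≤ ε * γ k * (n₂ * (δ * (α * (M₂ * ‖B₂.toEuclideanLin w‖)))) := by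
      rw [norm_smul, Real.norm_of_nonneg hβ.le]
      refine mul_le_mul (hs.slow_le_mul_fast k) ?_ (norm_nonneg _) (by positivity)
      exact Matrix.norm_toEuclideanLin_le_of_le le_rfl <|
        Matrix.norm_toEuclideanLin_le_of_le hD <|
        Matrix.norm_toEuclideanLin_le_of_le le_rfl (hB₂.norm_le w)
    unfold LinSystem.fastMean
    rw [map_sub, map_smul]
    refine (norm_sub_le _ _).trans ?_
    have h7 := mul_le_mul_of_nonneg_right h₂ (mul_nonneg hγ.le (norm_nonneg (B₂.toEuclideanLin w)))
    linarith
  · have h5 := hB₁.norm_step_le (β k) hβ.le (by linarith) z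
    have e1 : z - β k • (S.U β γ k).toEuclideanLin z = (z - β k • S.Δ.toEuclideanLin z)
        + β k • S.A12.toEuclideanLin ((S.L β γ k).toEuclideanLin z) := by
      rw [LinSystem.U, map_sub, LinearMap.sub_apply, Matrix.toEuclideanLin_mul_apply, smul_sub]
      abel
    have h6 : ‖B₁.toEuclideanLin (β k • S.A12.toEuclideanLin ((S.L β γ k).toEuclideanLin z))‖
        ≤ β k * (n₁ * (α * (ℓ * (M₁ * ‖B₁.toEuclideanLin z‖)))) := by
      rw [map_smul, norm_smul, Real.norm_of_nonneg hβ.le]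
      refine mul_le_mul_of_nonneg_left ?_ hβ.le
      exact Matrix.norm_toEuclideanLin_le_of_le le_rfl <|
        Matrix.norm_toEuclideanLin_le_of_le le_rfl <|
        Matrix.norm_toEuclideanLin_le_of_le (hLk k).1 (hB₁.norm_le z)
    have h7 : ‖S.coupling β γ k w‖ ≤ q * (β k * ρ) * ‖w‖ := by
      unfold LinSystem.coupling
      rw [← hρ, ← hρ']
      have hgw : ‖S.drive.toEuclideanLin w‖ ≤ g * ‖w‖ := Matrix.norm_toEuclideanLin_le _ _
      have hαw : ‖S.A12.toEuclideanLin w‖ ≤ α * ‖w‖ := Matrix.norm_toEuclideanLin_le _ _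
      have b1 : ‖(ρ - ρ') • S.drive.toEuclideanLin w‖ ≤ β k * ρ * (g * ‖w‖) := by
        rw [norm_smul, Real.norm_of_nonneg (by linarith)]
        gcongr
      have b2 : ‖(β k * ρ) • (S.U β γ k).toEuclideanLin (S.drive.toEuclideanLin w)‖
          ≤ β k * ρ * (υ * (g * ‖w‖)) := by
        rw [norm_smul, Real.norm_of_nonneg (by positivity)]
        exact mul_le_mul_of_nonneg_left (Matrix.norm_toEuclideanLin_le_of_le hU hgw)
          (by positivity)
      have b3 : ‖((ρ - ρ') * γ k) • S.A12.toEuclideanLin w‖ ≤ β k * ρ * (α * ‖w‖) := by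
        rw [norm_smul, Real.norm_of_nonneg (mul_nonneg (by linarith) hγ.le)]
        have : (ρ - ρ') * γ k ≤ β k * ρ * 1 :=
          mul_le_mul hdρ (by linarith) hγ.le (by positivity)
        rw [mul_one] at this
        gcongr
      have b4 : ‖(ρ' * β k) • S.drive.toEuclideanLin
          ((S.decoupler β γ k).toEuclideanLin (S.A12.toEuclideanLin w))‖
          ≤ β k * ρ * (g * (δ * (α * ‖w‖))) := by
        rw [norm_smul, Real.norm_of_nonneg (by positivity), mul_comm ρ']
        refine mul_le_mul (by gcongr) ?_ (norm_nonneg _) (by positivity)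
        exact Matrix.norm_toEuclideanLin_le_of_le le_rfl
          (Matrix.norm_toEuclideanLin_le_of_le hD hαw)
      refine (norm_add_le _ _).trans ?_
      have b5 := norm_sub_le ((ρ - ρ') • S.drive.toEuclideanLin w
        - (β k * ρ) • (S.U β γ k).toEuclideanLin (S.drive.toEuclideanLin w))
        (((ρ - ρ') * γ k) • S.A12.toEuclideanLin w)
      have b6 := norm_sub_le ((ρ - ρ') • S.drive.toEuclideanLin w)
        ((β k * ρ) • (S.U β γ k).toEuclideanLin (S.drive.toEuclideanLin w))
      rw [hq]
      linarith
    have h8 : ‖B₁.toEuclideanLin (S.coupling β γ k w)‖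
        ≤ n₁ * (q * (β k * ρ) * (M₂ * ‖B₂.toEuclideanLin w‖)) :=
      Matrix.norm_toEuclideanLin_le_of_le le_rfl
        (h7.trans (mul_le_mul_of_nonneg_left (hB₂.norm_le w) (by positivity)))
    unfold LinSystem.slowMean
    rw [e1, map_add, map_add]
    refine norm_add₃_le.trans ?_
    have h9 := mul_le_mul_of_nonneg_right hℓ1
      (mul_nonneg hβ.le (norm_nonneg (B₁.toEuclideanLin z)))
    have h10 : C₁ * (β k * ρ * ‖B₂.toEuclideanLin w‖) ≤ C * (β k * ρ * ‖B₂.toEuclideanLin w‖) :=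
      mul_le_mul_of_nonneg_right (by linarith) (by positivity)
    rw [hC₁] at h10
    linarith
  · have h5 := Matrix.norm_toEuclideanLin_le_of_le (le_refl ‖B₂‖) (hnoise v w)
    have h6 : C₂ * (γ k * (‖v‖ + ‖w‖)) ≤ C * (γ k * (‖v‖ + ‖w‖)) :=
      mul_le_mul_of_nonneg_right (by linarith) (by positivity)
    rw [hC₂] at h6
    linarith
  · have h5 : ‖S.slowNoise β γ k v w‖ ≤ (1 + g * (δ + 1)) * β k * (‖v‖ + ‖w‖) := by
      unfold LinSystem.slowNoise
      refine (norm_sub_le _ _).trans ?_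
      rw [norm_smul, norm_smul, Real.norm_of_nonneg hβ.le, ← hρ', Real.norm_of_nonneg hρ'0.le]
      have h6 := Matrix.norm_toEuclideanLin_le_of_le (le_refl ‖S.drive‖) (hnoise v w)
      have h7 := mul_le_mul hρ'ρ h6 (norm_nonneg _) hρ0.le
      -- The fast noise enters the corrected error with the factor ρ_{k+1} ≤ ρ_k, and ρ_k γ_k = β_k
      -- restores the slow order.
      have e2 : ρ * (‖S.drive‖ * ((δ + 1) * γ k * (‖v‖ + ‖w‖)))
          = g * (δ + 1) * β k * (‖v‖ + ‖w‖) := by rw [← hργ]; ring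
      rw [e2] at h7
      have : 0 ≤ β k * ‖w‖ := by positivity
      linarith
    have h6 := Matrix.norm_toEuclideanLin_le_of_le (le_refl ‖B₁‖) h5
    have h7 : C₃ * (β k * (‖v‖ + ‖w‖)) ≤ C * (β k * (‖v‖ + ‖w‖)) :=
      mul_le_mul_of_nonneg_right (by linarith) (by positivity)
    rw [hC₃] at h7
    linarith
  · refine (norm_add_le _ _).trans ?_
    rw [norm_smul, Real.norm_of_nonneg hρ0.le]
    have h5 := Matrix.norm_toEuclideanLin_le_of_le (le_refl ‖S.drive‖) (hB₂.norm_le w)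
    have h6 := mul_le_mul_of_nonneg_left h5 hρ0.le
    have h7 := hB₁.norm_le z
    have hz := norm_nonneg (B₁.toEuclideanLin z)
    have hw : 0 ≤ ρ * ‖B₂.toEuclideanLin w‖ := by positivity
    have hgM : 0 ≤ g * M₂ := by positivity
    have h8 : M₁ * ‖B₁.toEuclideanLin z‖ ≤ C * ‖B₁.toEuclideanLin z‖ :=
      mul_le_mul_of_nonneg_right (by linarith) hz
    have h9 : g * M₂ * (ρ * ‖B₂.toEuclideanLin w‖) ≤ C * (ρ * ‖B₂.toEuclideanLin w‖) :=
      mul_le_mul_of_nonneg_right (by linarith) hw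
    linarith
  · refine (norm_sub_le _ _).trans ?_
    have h5 := Matrix.norm_toEuclideanLin_le_of_le hD' (le_refl ‖θ‖)
    have h6 := hB₂.norm_le w
    have h7 : M₂ * ‖B₂.toEuclideanLin w‖ ≤ C * ‖B₂.toEuclideanLin w‖ :=
      mul_le_mul_of_nonneg_right (by linarith) (norm_nonneg _)
    have h8 : δ * ‖θ‖ ≤ C * ‖θ‖ := mul_le_mul_of_nonneg_right (by linarith) (norm_nonneg _)
    linarith

end LinSystem

end MeanDynamics

/-! ### Exact recursions for the errors; measurability and boundedness -/

section Recursion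

namespace TTSA

variable {Ω : Type u} {𝒳 : Type v} {dθ dw : ℕ} (T : TTSA Ω 𝒳 dθ dw)

/-- The slow error corrected by a small multiple of the decoupled fast error. -/
noncomputable def zerr (k : ℕ) (ω : Ω) : EuclideanSpace ℝ (Fin dθ) :=
  T.θtilde k ω - (T.β k / T.γ k) • T.sys.drive.toEuclideanLin (T.wtilde k ω)

theorem θtilde_eq (k : ℕ) (ω : Ω) : T.θtilde k ω
    = T.zerr k ω + (T.β k / T.γ k) • T.sys.drive.toEuclideanLin (T.wtilde k ω) := by
  rw [zerr, sub_add_cancel]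

theorem werr_eq (k : ℕ) (ω : Ω) : T.werr k ω = T.wtilde k ω
    - (T.sys.L T.β T.γ k + T.sys.A22⁻¹ * T.sys.A21).toEuclideanLin (T.θtilde k ω) := by
  rw [wtilde, add_sub_cancel_right]

/-- Purely algebraic: V collects exactly what separates the random update from the mean one,
whatever the centre θ⋆, w⋆. -/
theorem θtilde_succ_aux (k : ℕ) (ω : Ω) : T.θtilde (k + 1) ω = T.θtilde k ω
    - T.β k • (T.sys.A11.toEuclideanLin (T.θtilde k ω) + T.sys.A12.toEuclideanLin (T.werr k ω))
    + T.β k • T.Vsucc k ω := by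
  simp only [θtilde, werr, Vsucc, εV, iter, map_sub, LinearMap.sub_apply]
  module

theorem werr_succ_aux (k : ℕ) (ω : Ω) : T.werr (k + 1) ω = T.werr k ω
    - T.γ k • (T.sys.A21.toEuclideanLin (T.θtilde k ω) + T.sys.A22.toEuclideanLin (T.werr k ω))
    + T.γ k • T.Wsucc k ω := by
  simp only [θtilde, werr, Wsucc, εW, iter, map_sub, LinearMap.sub_apply]
  module

theorem θtilde_succ (k : ℕ) (ω : Ω) : T.θtilde (k + 1) ω = T.θtilde k ω
    - T.β k • ((T.sys.U T.β T.γ k).toEuclideanLin (T.θtilde k ω)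
      + T.sys.A12.toEuclideanLin (T.wtilde k ω)) + T.β k • T.Vsucc k ω := by
  rw [θtilde_succ_aux, werr_eq, LinSystem.U, LinSystem.Δ]
  simp only [map_sub, map_add, LinearMap.sub_apply, LinearMap.add_apply,
    Matrix.toEuclideanLin_mul_apply]
  module

/-- The coefficient of θ̃_k on the right is zero precisely because of the recursion defining
L_{k+1}. -/
theorem wtilde_succ {k : ℕ} (hA : IsUnit T.sys.A22)
    (hU : IsUnit (1 - T.β k • T.sys.U T.β T.γ k)) (ω : Ω) :
    T.wtilde (k + 1) ω = T.sys.fastMean T.β T.γ k (T.wtilde k ω)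
      + T.sys.fastNoise T.β T.γ k (T.Vsucc k ω) (T.Wsucc k ω) := by
  have hAA : T.sys.A22 * T.sys.A22⁻¹ = 1 :=
    Matrix.mul_nonsing_inv _ ((Matrix.isUnit_iff_isUnit_det _).1 hA)
  have hL := congrArg (fun M => M.toEuclideanLin (T.θtilde k ω)) (T.sys.L_succ_mul hU)
  have hAv : ∀ v, T.sys.A22.toEuclideanLin ((T.sys.A22⁻¹).toEuclideanLin v) = v := fun v => by
    rw [← Matrix.toEuclideanLin_mul_apply, hAA, Matrix.toEuclideanLin_one_apply]
  simp only [map_sub, map_add, map_smul, LinearMap.sub_apply, LinearMap.add_apply,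
    LinearMap.smul_apply, Matrix.toEuclideanLin_mul_apply, Matrix.toEuclideanLin_one_apply] at hL
  rw [sub_eq_iff_eq_add] at hL
  rw [wtilde, werr_succ_aux, θtilde_succ, werr_eq, LinSystem.fastMean, LinSystem.fastNoise,
    LinSystem.decoupler]
  simp only [map_sub, map_add, map_smul, LinearMap.add_apply,
    Matrix.toEuclideanLin_mul_apply, hAv, hL]
  module

/-- The first-order drive β_k A₁₂ w̃_k meets ρ_{k+1} γ_k A₁₂ w̃_k with opposite sign, since A₁₂
A₂₂⁻¹ A₂₂ = A₁₂. What survives is (ρ_k - ρ_{k+1}) γ_k A₁₂ w̃_k and terms with a factor β_k ρ or a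
difference of ratios. -/
theorem zerr_succ {k : ℕ} (hA : IsUnit T.sys.A22) (hγ : T.γ k ≠ 0)
    (hU : IsUnit (1 - T.β k • T.sys.U T.β T.γ k)) (ω : Ω) :
    T.zerr (k + 1) ω = T.sys.slowMean T.β T.γ k (T.zerr k ω) (T.wtilde k ω)
      + T.sys.slowNoise T.β T.γ k (T.Vsucc k ω) (T.Wsucc k ω) := by
  have hAA : T.sys.A22⁻¹ * T.sys.A22 = 1 :=
    Matrix.nonsing_inv_mul _ ((Matrix.isUnit_iff_isUnit_det _).1 hA)
  have hAv : ∀ v, T.sys.drive.toEuclideanLin (T.sys.A22.toEuclideanLin v)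
      = T.sys.A12.toEuclideanLin v := fun v => by
    rw [← Matrix.toEuclideanLin_mul_apply, LinSystem.drive, Matrix.mul_assoc, hAA, Matrix.mul_one]
  have hρ : T.β k / T.γ k * T.γ k = T.β k := div_mul_cancel₀ _ hγ
  rw [zerr, wtilde_succ T hA hU, θtilde_succ, θtilde_eq, LinSystem.slowMean, LinSystem.slowNoise,
    LinSystem.fastMean, LinSystem.coupling, sub_mul, hρ]
  simp only [map_sub, map_add, map_smul, hAv]
  module

section Measurability

variable [MeasurableSpace 𝒳]

theorem ℱ_mono : Monotone T.ℱ := fun _ _ h =>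
  biSup_mono fun _ hi => Finset.Icc_subset_Icc_right h hi

theorem ℱ_le [MeasurableSpace Ω] (hX : ∀ k, Measurable (T.X k)) (k : ℕ) :
    T.ℱ k ≤ ‹MeasurableSpace Ω› :=
  iSup₂_le fun i _ => (hX i).comap_le

theorem measurable_X_succ (k : ℕ) : Measurable[T.ℱ (k + 1)] (T.X (k + 1)) := by
  refine Measurable.mono (comap_measurable (T.X (k + 1))) ?_ le_rfl
  exact le_iSup₂_of_le (k + 1) (Finset.mem_Icc.2 ⟨by omega, le_rfl⟩) le_rfl

end Measurability

end TTSA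

theorem measurable_toEuclideanLin_apply {α : Type*} [MeasurableSpace α] {m n : ℕ}
    {M : α → Matrix (Fin m) (Fin n) ℝ} {x : α → EuclideanSpace ℝ (Fin n)}
    (hM : ∀ i j, Measurable fun ω => M ω i j) (hx : Measurable x) :
    Measurable fun ω => (M ω).toEuclideanLin (x ω) := by
  simp only [Matrix.toLpLin_apply]
  refine (WithLp.measurable_toLp 2 _).comp (measurable_pi_lambda _ fun i => ?_)
  simp only [Matrix.mulVec, dotProduct]
  refine Finset.measurable_sum _ fun j _ => (hM i j).mul ?_
  exact (measurable_pi_apply j).comp ((WithLp.measurable_ofLp 2 _).comp hx)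

namespace TTSA

variable {Ω : Type u} {𝒳 : Type v} {dθ dw : ℕ} (T : TTSA Ω 𝒳 dθ dw) [MeasurableSpace 𝒳]

theorem measurable_iter (hO : T.oracle.IsMeasurable) (k : ℕ) :
    Measurable[T.ℱ k] (T.iter k) := by
  obtain ⟨h11, h12, h21, h22, h1, h2⟩ := hO
  induction k with
  | zero => exact @measurable_const _ _ _ (T.ℱ 0) _
  | succ k ih =>
    let _ : MeasurableSpace Ω := T.ℱ (k + 1)
    have ih' : Measurable (T.iter k) := ih.mono (T.ℱ_mono k.le_succ) le_rfl
    have hX : Measurable (T.X (k + 1)) := T.measurable_X_succ k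
    have hA : ∀ {m n : ℕ} {M : 𝒳 → Matrix (Fin m) (Fin n) ℝ}
        {x : Ω → EuclideanSpace ℝ (Fin n)}, (∀ i j, Measurable fun ξ => M ξ i j) → Measurable x →
        Measurable fun ω => (M (T.X (k + 1) ω)).toEuclideanLin (x ω) := fun hM hx =>
      measurable_toEuclideanLin_apply (fun i j => (hM i j).comp hX) hx
    refine Measurable.prodMk ?_ ?_
    · exact ih'.fst.add ((((h1.comp hX).sub (hA h11 ih'.fst)).sub (hA h12 ih'.snd)).const_smul (T.β k))
    · exact ih'.snd.add ((((h2.comp hX).sub (hA h21 ih'.fst)).sub (hA h22 ih'.snd)).const_smul (T.γ k))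

theorem measurable_θtilde (hO : T.oracle.IsMeasurable) (k : ℕ) :
    Measurable[T.ℱ k] (T.θtilde k) := by
  let _ : MeasurableSpace Ω := T.ℱ k
  exact (T.measurable_iter hO k).fst.sub_const _

theorem measurable_werr (hO : T.oracle.IsMeasurable) (k : ℕ) :
    Measurable[T.ℱ k] (T.werr k) := by
  let _ : MeasurableSpace Ω := T.ℱ k
  exact (T.measurable_iter hO k).snd.sub_const _

theorem measurable_wtilde (hO : T.oracle.IsMeasurable) (k : ℕ) :
    Measurable[T.ℱ k] (T.wtilde k) := by
  let _ : MeasurableSpace Ω := T.ℱ k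
  exact (T.measurable_werr hO k).add (measurable_toEuclideanLin_apply
    (M := fun _ => T.sys.L T.β T.γ k + T.sys.A22⁻¹ * T.sys.A21) (fun _ _ => measurable_const)
    (T.measurable_θtilde hO k))

theorem measurable_zerr (hO : T.oracle.IsMeasurable) (k : ℕ) :
    Measurable[T.ℱ k] (T.zerr k) := by
  let _ : MeasurableSpace Ω := T.ℱ k
  have h : Measurable fun ω => T.sys.drive.toEuclideanLin (T.wtilde k ω) :=
    measurable_toEuclideanLin_apply (M := fun _ => T.sys.drive) (fun _ _ => measurable_const)
      (T.measurable_wtilde hO k)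
  exact (T.measurable_θtilde hO k).sub (h.const_smul (T.β k / T.γ k))

theorem measurable_zerr_wtilde (hO : T.oracle.IsMeasurable) (k : ℕ) :
    Measurable[T.ℱ k] fun ω => (T.zerr k ω, T.wtilde k ω) := by
  let _ : MeasurableSpace Ω := T.ℱ k
  exact (T.measurable_zerr hO k).prodMk (T.measurable_wtilde hO k)

theorem measurable_toEuclideanLin_wtilde (hO : T.oracle.IsMeasurable)
    (B : Matrix (Fin dw) (Fin dw) ℝ) (k : ℕ) :
    Measurable[T.ℱ k] fun ω => B.toEuclideanLin (T.wtilde k ω) :=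
  @measurable_toEuclideanLin_apply _ (T.ℱ k) _ _ (fun _ => B) _ (fun _ _ => measurable_const)
    (T.measurable_wtilde hO k)

theorem measurable_toEuclideanLin_zerr (hO : T.oracle.IsMeasurable)
    (B : Matrix (Fin dθ) (Fin dθ) ℝ) (k : ℕ) :
    Measurable[T.ℱ k] fun ω => B.toEuclideanLin (T.zerr k ω) :=
  @measurable_toEuclideanLin_apply _ (T.ℱ k) _ _ (fun _ => B) _ (fun _ _ => measurable_const)
    (T.measurable_zerr hO k)

theorem measurable_Vsucc [MeasurableSpace Ω] (hX : ∀ k, Measurable (T.X k))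
    (hO : T.oracle.IsMeasurable) (k : ℕ) : Measurable (T.Vsucc k) := by
  obtain ⟨h11, h12, h21, h22, h1, h2⟩ := id hO
  have hθ := (T.measurable_θtilde hO k).mono (T.ℱ_le hX k) le_rfl
  have hw := (T.measurable_werr hO k).mono (T.ℱ_le hX k) le_rfl
  have hXk := hX (k + 1)
  refine Measurable.sub (Measurable.sub (Measurable.sub (Measurable.sub (h1.comp hXk) ?_) ?_) ?_) ?_
  · exact measurable_toEuclideanLin_apply (fun i j => (h11 i j).comp hXk) measurable_const
  · exact measurable_toEuclideanLin_apply (fun i j => (h12 i j).comp hXk) measurable_const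
  · exact measurable_toEuclideanLin_apply (fun i j => ((h11 i j).comp hXk).sub_const _) hθ
  · exact measurable_toEuclideanLin_apply (fun i j => ((h12 i j).comp hXk).sub_const _) hw

theorem measurable_Wsucc [MeasurableSpace Ω] (hX : ∀ k, Measurable (T.X k))
    (hO : T.oracle.IsMeasurable) (k : ℕ) : Measurable (T.Wsucc k) := by
  obtain ⟨h11, h12, h21, h22, h1, h2⟩ := id hO
  have hθ := (T.measurable_θtilde hO k).mono (T.ℱ_le hX k) le_rfl
  have hw := (T.measurable_werr hO k).mono (T.ℱ_le hX k) le_rfl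
  have hXk := hX (k + 1)
  refine Measurable.sub (Measurable.sub (Measurable.sub (Measurable.sub (h2.comp hXk) ?_) ?_) ?_) ?_
  · exact measurable_toEuclideanLin_apply (fun i j => (h21 i j).comp hXk) measurable_const
  · exact measurable_toEuclideanLin_apply (fun i j => (h22 i j).comp hXk) measurable_const
  · exact measurable_toEuclideanLin_apply (fun i j => ((h21 i j).comp hXk).sub_const _) hθ
  · exact measurable_toEuclideanLin_apply (fun i j => ((h22 i j).comp hXk).sub_const _) hw

end TTSA

section Bounded

/-- Boundedness of a function into a normed group. -/
def IsBddFun {α F : Type*} [NormedAddCommGroup F] (f : α → F) : Prop := ∃ c, ∀ ω, ‖f ω‖ ≤ c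

variable {α F : Type*} [NormedAddCommGroup F]

theorem IsBddFun.add {f g : α → F} (hf : IsBddFun f) (hg : IsBddFun g) :
    IsBddFun fun ω => f ω + g ω := by
  obtain ⟨a, ha⟩ := hf
  obtain ⟨b, hb⟩ := hg
  exact ⟨a + b, fun ω => (norm_add_le _ _).trans (add_le_add (ha ω) (hb ω))⟩

theorem IsBddFun.sub {f g : α → F} (hf : IsBddFun f) (hg : IsBddFun g) :
    IsBddFun fun ω => f ω - g ω := by
  obtain ⟨a, ha⟩ := hf
  obtain ⟨b, hb⟩ := hg
  exact ⟨a + b, fun ω => (norm_sub_le _ _).trans (add_le_add (ha ω) (hb ω))⟩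

theorem IsBddFun.const_smul [NormedSpace ℝ F] {f : α → F} (hf : IsBddFun f) (c : ℝ) :
    IsBddFun fun ω => c • f ω := by
  obtain ⟨a, ha⟩ := hf
  refine ⟨‖c‖ * a, fun ω => ?_⟩
  rw [norm_smul]
  exact mul_le_mul_of_nonneg_left (ha ω) (norm_nonneg _)

theorem isBddFun_const (c : F) : IsBddFun fun _ : α => c := ⟨‖c‖, fun _ => le_rfl⟩

theorem IsBddFun.toEuclideanLin {m n : ℕ} {M : α → Matrix (Fin m) (Fin n) ℝ}
    {x : α → EuclideanSpace ℝ (Fin n)} (hM : IsBddFun M) (hx : IsBddFun x) :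
    IsBddFun fun ω => (M ω).toEuclideanLin (x ω) := by
  obtain ⟨a, ha⟩ := hM
  obtain ⟨b, hb⟩ := hx
  exact ⟨a * b, fun ω => Matrix.norm_toEuclideanLin_le_of_le (ha ω) (hb ω)⟩

end Bounded

/-- Each of the estimates is a bounded function. -/
theorem Oracle.IsBounded.isBddFun {Ω : Type u} {𝒳 : Type v} {dθ dw : ℕ} {O : Oracle 𝒳 dθ dw}
    {S : LinSystem dθ dw} (h : O.IsBounded S) (X : Ω → 𝒳) :
    IsBddFun (fun ω => O.A11 (X ω)) ∧ IsBddFun (fun ω => O.A12 (X ω)) ∧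
    IsBddFun (fun ω => O.A21 (X ω)) ∧ IsBddFun (fun ω => O.A22 (X ω)) ∧
    IsBddFun (fun ω => O.b1 (X ω)) ∧ IsBddFun (fun ω => O.b2 (X ω)) := by
  obtain ⟨CA, -, Cb, -, h⟩ := h
  refine ⟨⟨CA, fun ω => ?_⟩, ⟨CA, fun ω => ?_⟩, ⟨CA, fun ω => ?_⟩, ⟨CA, fun ω => ?_⟩,
    ⟨Cb, fun ω => ?_⟩, ⟨Cb, fun ω => ?_⟩⟩ <;>
  obtain ⟨h1, h2, h3, h4, h5, h6⟩ := h (X ω)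
  exacts [(le_max_left _ _).trans h1, (le_max_left _ _).trans h2, (le_max_left _ _).trans h3,
    (le_max_left _ _).trans h4, (le_max_left _ _).trans h5, (le_max_left _ _).trans h6]

namespace TTSA

variable {Ω : Type u} {𝒳 : Type v} {dθ dw : ℕ} (T : TTSA Ω 𝒳 dθ dw)

/-- The bound depends on k and serves only to guarantee integrability; it never enters a constant of
the theorem. -/
theorem isBddFun_iter {S : LinSystem dθ dw} (hO : T.oracle.IsBounded S) (k : ℕ) :
    IsBddFun (fun ω => (T.iter k ω).1) ∧ IsBddFun (fun ω => (T.iter k ω).2) := by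
  induction k with
  | zero => exact ⟨isBddFun_const T.θ₀, isBddFun_const T.w₀⟩
  | succ k ih =>
    obtain ⟨h11, h12, h21, h22, h1, h2⟩ := hO.isBddFun (T.X (k + 1))
    exact ⟨ih.1.add (((h1.sub (h11.toEuclideanLin ih.1)).sub
      (h12.toEuclideanLin ih.2)).const_smul _),
      ih.2.add (((h2.sub (h21.toEuclideanLin ih.1)).sub
      (h22.toEuclideanLin ih.2)).const_smul _)⟩

theorem isBddFun_θtilde {S : LinSystem dθ dw} (hO : T.oracle.IsBounded S) (k : ℕ) :
    IsBddFun (T.θtilde k) := (T.isBddFun_iter hO k).1.sub (isBddFun_const _)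

theorem isBddFun_werr {S : LinSystem dθ dw} (hO : T.oracle.IsBounded S) (k : ℕ) :
    IsBddFun (T.werr k) := (T.isBddFun_iter hO k).2.sub (isBddFun_const _)

theorem isBddFun_wtilde {S : LinSystem dθ dw} (hO : T.oracle.IsBounded S) (k : ℕ) :
    IsBddFun (T.wtilde k) :=
  (T.isBddFun_werr hO k).add ((isBddFun_const _).toEuclideanLin (T.isBddFun_θtilde hO k))

theorem isBddFun_zerr {S : LinSystem dθ dw} (hO : T.oracle.IsBounded S) (k : ℕ) :
    IsBddFun (T.zerr k) :=
  (T.isBddFun_θtilde hO k).sub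
    (((isBddFun_const _).toEuclideanLin (T.isBddFun_wtilde hO k)).const_smul _)

theorem isBddFun_Vsucc {S : LinSystem dθ dw} (hO : T.oracle.IsBounded S) (k : ℕ) :
    IsBddFun (T.Vsucc k) := by
  obtain ⟨h11, h12, h21, h22, h1, h2⟩ := hO.isBddFun (T.X (k + 1))
  exact (((h1.sub (h11.toEuclideanLin (isBddFun_const _))).sub
    (h12.toEuclideanLin (isBddFun_const _))).sub
    ((h11.sub (isBddFun_const _)).toEuclideanLin (T.isBddFun_θtilde hO k))).sub
    ((h12.sub (isBddFun_const _)).toEuclideanLin (T.isBddFun_werr hO k))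

theorem isBddFun_Wsucc {S : LinSystem dθ dw} (hO : T.oracle.IsBounded S) (k : ℕ) :
    IsBddFun (T.Wsucc k) := by
  obtain ⟨h11, h12, h21, h22, h1, h2⟩ := hO.isBddFun (T.X (k + 1))
  exact (((h2.sub (h21.toEuclideanLin (isBddFun_const _))).sub
    (h22.toEuclideanLin (isBddFun_const _))).sub
    ((h21.sub (isBddFun_const _)).toEuclideanLin (T.isBddFun_θtilde hO k))).sub
    ((h22.sub (isBddFun_const _)).toEuclideanLin (T.isBddFun_werr hO k))

end TTSA

end Recursion

/-! ### Recursions for the squared moments -/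

section Moments

theorem lpNorm_le_of_norm_le {Ω E F G : Type*} [MeasurableSpace Ω] {μ : Measure Ω}
    [NormedAddCommGroup E] [NormedAddCommGroup F] [NormedAddCommGroup G] {q : ENNReal}
    (hq : 1 ≤ q) {f : Ω → E} {g : Ω → F} {h : Ω → G} {a b : ℝ} (ha : 0 ≤ a) (hb : 0 ≤ b)
    (hg : MemLp g q μ) (hh : MemLp h q μ) (hle : ∀ ω, ‖f ω‖ ≤ a * ‖g ω‖ + b * ‖h ω‖) :
    lpNorm f q μ ≤ a * lpNorm g q μ + b * lpNorm h q μ := by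
  have h1 : MemLp (a • fun ω => ‖g ω‖) q μ := hg.norm.const_smul a
  have h2 : MemLp (b • fun ω => ‖h ω‖) q μ := hh.norm.const_smul b
  refine (lpNorm_mono_real (h1.add h2) hle).trans ((lpNorm_add_le h1 hq).trans (le_of_eq ?_))
  rw [lpNorm_const_smul, lpNorm_const_smul, lpNorm_norm hg.1, lpNorm_norm hh.1]
  simp [abs_of_nonneg ha, abs_of_nonneg hb]

theorem condExp_linear_eq_zero {Ω E F G : Type*} {m mΩ : MeasurableSpace Ω} {μ : Measure Ω}
    [NormedAddCommGroup E] [NormedSpace ℝ E] [CompleteSpace E]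
    [NormedAddCommGroup F] [NormedSpace ℝ F] [CompleteSpace F]
    [NormedAddCommGroup G] [NormedSpace ℝ G] [CompleteSpace G]
    (P : E →L[ℝ] G) (R : F →L[ℝ] G) {V : Ω → E} {W : Ω → F} (hV : Integrable V μ)
    (hW : Integrable W μ) (hV0 : μ[V | m] =ᵐ[μ] 0) (hW0 : μ[W | m] =ᵐ[μ] 0) :
    μ[fun ω => P (V ω) + R (W ω) | m] =ᵐ[μ] 0 := by
  have h1 := P.comp_condExp_comm (m := m) hV
  have h2 := R.comp_condExp_comm (m := m) hW
  have h3 := condExp_add (m := m) (P.integrable_comp hV) (R.integrable_comp hW)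
  refine h3.trans ?_
  filter_upwards [h1, h2, hV0, hW0] with ω e1 e2 e3 e4
  have e1' : μ[fun ω => P (V ω) | m] ω = P (μ[V | m] ω) := e1.symm
  have e2' : μ[fun ω => R (W ω) | m] ω = R (μ[W | m] ω) := e2.symm
  rw [Pi.add_apply, e1', e2', e3, e4]
  simp

/-- One step of a recursion with a martingale difference noise, in `L^p`. -/
theorem sq_lpNorm_step_le {Ω E F G H H' : Type*} {m mΩ : MeasurableSpace Ω} {μ : Measure Ω}
    [IsProbabilityMeasure μ]
    [NormedAddCommGroup E] [NormedSpace ℝ E] [CompleteSpace E]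
    [NormedAddCommGroup F] [NormedSpace ℝ F] [CompleteSpace F]
    [NormedAddCommGroup G] [InnerProductSpace ℝ G] [CompleteSpace G]
    [NormedAddCommGroup H] [NormedAddCommGroup H']
    (hm : m ≤ mΩ) {p a b κ : ℝ} (hp : 2 ≤ p) (ha : 0 ≤ a) (hb : 0 ≤ b) (hκ : 0 ≤ κ)
    {X : Ω → G} {g : Ω → H} {h : Ω → H'} {V : Ω → E} {W : Ω → F}
    (P : E →L[ℝ] G) (R : F →L[ℝ] G)
    (hX : StronglyMeasurable[m] X) (hg : AEStronglyMeasurable g μ) (hh : AEStronglyMeasurable h μ)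
    (hV : AEStronglyMeasurable V μ) (hW : AEStronglyMeasurable W μ)
    (hgb : IsBddFun g) (hhb : IsBddFun h) (hVb : IsBddFun V) (hWb : IsBddFun W)
    (hV0 : μ[V | m] =ᵐ[μ] 0) (hW0 : μ[W | m] =ᵐ[μ] 0)
    (hXle : ∀ ω, ‖X ω‖ ≤ a * ‖g ω‖ + b * ‖h ω‖)
    (hPR : ∀ v w, ‖P v + R w‖ ≤ κ * (‖v‖ + ‖w‖)) :
    lpNorm (fun ω => X ω + (P (V ω) + R (W ω))) (ENNReal.ofReal p) μ ^ 2
      ≤ (a * lpNorm g (ENNReal.ofReal p) μ + b * lpNorm h (ENNReal.ofReal p) μ) ^ 2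
        + 6 * p * (κ * (lpNorm V (ENNReal.ofReal p) μ + lpNorm W (ENNReal.ofReal p) μ)) ^ 2 := by
  have hq1 : 1 ≤ ENNReal.ofReal p := by
    rw [ENNReal.one_le_ofReal]; linarith
  have hVL : ∀ q : ENNReal, MemLp V q μ := fun q => MemLp.of_bounded hV hVb
  have hWL : ∀ q : ENNReal, MemLp W q μ := fun q => MemLp.of_bounded hW hWb
  have hPR' : ∀ ω, ‖P (V ω) + R (W ω)‖ ≤ κ * ‖V ω‖ + κ * ‖W ω‖ := fun ω => by
    rw [← mul_add]; exact hPR _ _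
  have hXb : IsBddFun X := by
    obtain ⟨c, hc⟩ := hgb
    obtain ⟨d, hd⟩ := hhb
    refine ⟨a * c + b * d, fun ω => (hXle ω).trans ?_⟩
    have h1 := hc ω
    have h2 := hd ω
    gcongr
  have hDb : IsBddFun fun ω => P (V ω) + R (W ω) := by
    obtain ⟨c, hc⟩ := hVb
    obtain ⟨d, hd⟩ := hWb
    refine ⟨κ * c + κ * d, fun ω => (hPR' ω).trans ?_⟩
    have h1 := hc ω
    have h2 := hd ω
    gcongr
  have hDm : AEStronglyMeasurable (fun ω => P (V ω) + R (W ω)) μ :=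
    (P.continuous.comp_aestronglyMeasurable hV).add (R.continuous.comp_aestronglyMeasurable hW)
  have h1 := sq_lpNorm_add_le hm hp hX hDm hXb hDb (condExp_linear_eq_zero P R
    (memLp_one_iff_integrable.1 (hVL 1)) (memLp_one_iff_integrable.1 (hWL 1)) hV0 hW0)
  have h2 := lpNorm_le_of_norm_le hq1 ha hb (MemLp.of_bounded hg hgb) (MemLp.of_bounded hh hhb) hXle
  have h3 := lpNorm_le_of_norm_le hq1 hκ hκ (hVL _) (hWL _) hPR'
  rw [← mul_add] at h3
  refine h1.trans (add_le_add (pow_le_pow_left₀ lpNorm_nonneg h2 2) ?_)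
  exact mul_le_mul_of_nonneg_left (pow_le_pow_left₀ lpNorm_nonneg h3 2) (by linarith)

namespace LinSystem

variable {dθ dw : ℕ} (S : LinSystem dθ dw) (β γ : ℕ → ℝ) (k : ℕ)

/-- Continuous linear maps commute with conditional expectation, so this form shows that the
transformed noise is again centred. -/
theorem exists_fastNoise_eq (B : Matrix (Fin dw) (Fin dw) ℝ) :
    ∃ (P : EuclideanSpace ℝ (Fin dθ) →L[ℝ] EuclideanSpace ℝ (Fin dw))
      (R : EuclideanSpace ℝ (Fin dw) →L[ℝ] EuclideanSpace ℝ (Fin dw)),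
      ∀ v w, B.toEuclideanLin (S.fastNoise β γ k v w) = P v + R w := by
  refine ⟨(B.toEuclideanLin ∘ₗ (β k • (S.decoupler β γ k).toEuclideanLin)).toContinuousLinearMap,
    (B.toEuclideanLin ∘ₗ (γ k • LinearMap.id)).toContinuousLinearMap, fun v w => ?_⟩
  simp only [fastNoise, map_add, LinearMap.coe_toContinuousLinearMap', LinearMap.comp_apply,
    LinearMap.smul_apply, LinearMap.id_apply]

theorem exists_slowNoise_eq (B : Matrix (Fin dθ) (Fin dθ) ℝ) :
    ∃ (P : EuclideanSpace ℝ (Fin dθ) →L[ℝ] EuclideanSpace ℝ (Fin dθ))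
      (R : EuclideanSpace ℝ (Fin dw) →L[ℝ] EuclideanSpace ℝ (Fin dθ)),
      ∀ v w, B.toEuclideanLin (S.slowNoise β γ k v w) = P v + R w := by
  obtain ⟨P, R, h⟩ := S.exists_fastNoise_eq β γ k 1
  simp only [Matrix.toEuclideanLin_one_apply] at h
  set ρ := β (k + 1) / γ (k + 1)
  refine ⟨(B.toEuclideanLin ∘ₗ (β k • LinearMap.id
      - ρ • (S.drive.toEuclideanLin ∘ₗ P.toLinearMap))).toContinuousLinearMap,
    (B.toEuclideanLin ∘ₗ (-ρ • (S.drive.toEuclideanLin ∘ₗ R.toLinearMap))).toContinuousLinearMap,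
    fun v w => ?_⟩
  simp only [slowNoise, h, map_add, map_sub, map_smul, LinearMap.coe_toContinuousLinearMap',
    LinearMap.comp_apply, LinearMap.smul_apply, LinearMap.id_apply, LinearMap.sub_apply,
    ContinuousLinearMap.coe_coe]
  module

theorem continuous_fastMean : Continuous (S.fastMean β γ k) := by
  have hcont : ∀ {m n : ℕ} (N : Matrix (Fin m) (Fin n) ℝ), Continuous N.toEuclideanLin :=
    fun N => LinearMap.continuous_of_finiteDimensional _
  have h1 : Continuous fun w => (S.decoupler β γ k).toEuclideanLin (S.A12.toEuclideanLin w) :=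
    (hcont _).comp (hcont _)
  exact (continuous_id.sub ((hcont S.A22).const_smul (γ k))).sub (h1.const_smul (β k))

theorem continuous_coupling : Continuous (S.coupling β γ k) := by
  have hcont : ∀ {m n : ℕ} (N : Matrix (Fin m) (Fin n) ℝ), Continuous N.toEuclideanLin :=
    fun N => LinearMap.continuous_of_finiteDimensional _
  have h1 : Continuous fun w => (S.decoupler β γ k).toEuclideanLin (S.A12.toEuclideanLin w) :=
    (hcont _).comp (hcont _)
  have h2 : Continuous fun w => (S.U β γ k).toEuclideanLin (S.drive.toEuclideanLin w) :=
    (hcont _).comp (hcont _)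
  have h3 : Continuous fun w => S.drive.toEuclideanLin
      ((S.decoupler β γ k).toEuclideanLin (S.A12.toEuclideanLin w)) := (hcont _).comp h1
  exact ((((hcont S.drive).const_smul (β k / γ k - β (k + 1) / γ (k + 1))).sub
    (h2.const_smul (β k * (β k / γ k)))).sub ((hcont S.A12).const_smul
    ((β k / γ k - β (k + 1) / γ (k + 1)) * γ k))).add
    (h3.const_smul (β (k + 1) / γ (k + 1) * β k))

theorem continuous_slowMean :
    Continuous fun x : EuclideanSpace ℝ (Fin dθ) × EuclideanSpace ℝ (Fin dw) =>
      S.slowMean β γ k x.1 x.2 := by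
  have h1 : Continuous fun x : EuclideanSpace ℝ (Fin dθ) × EuclideanSpace ℝ (Fin dw) =>
      (S.U β γ k).toEuclideanLin x.1 :=
    (LinearMap.continuous_of_finiteDimensional _).comp continuous_fst
  exact (continuous_fst.sub (h1.const_smul (β k))).add
    ((S.continuous_coupling β γ k).comp continuous_snd)

end LinSystem

section ScalarSteps

theorem noise_sq_le {p κ N y z t : ℝ} (hp : 0 ≤ p) (ht : 0 ≤ t) (hN : 0 ≤ N) {a : ℝ}
    (hκ : κ = a * t) (ha : 0 ≤ a) {b : ℝ} (hb : N ≤ b * (1 + z + y)) :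
    6 * p * (κ * N) ^ 2 ≤ 18 * (a * b) ^ 2 * p * t ^ 2 * (1 + z ^ 2 + y ^ 2) := by
  have h1 : κ * N ≤ a * t * (b * (1 + z + y)) := by
    rw [hκ]; exact mul_le_mul_of_nonneg_left hb (by positivity)
  have h0 : 0 ≤ κ * N := by rw [hκ]; positivity
  have h2 := pow_le_pow_left₀ h0 h1 2
  have h3 : (1 + z + y) ^ 2 ≤ 3 * (1 + z ^ 2 + y ^ 2) := by
    nlinarith [sq_nonneg (1 - z), sq_nonneg (1 - y), sq_nonneg (z - y)]
  have h4 := mul_le_mul_of_nonneg_left h3 (by positivity : 0 ≤ 6 * p * (a * t * b) ^ 2)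
  have h5 := mul_le_mul_of_nonneg_left h2 (by positivity : 0 ≤ 6 * p)
  linarith

theorem sq_convex_le {s z t : ℝ} (hs0 : 0 ≤ s) (hs1 : s ≤ 1) :
    ((1 - s) * z + s * t) ^ 2 ≤ (1 - s) * z ^ 2 + s * t ^ 2 := by
  have h : 0 ≤ s * (1 - s) * (z - t) ^ 2 :=
    mul_nonneg (mul_nonneg hs0 (by linarith)) (sq_nonneg _)
  linarith

/-- Convexity of the square with weight s = cβ / 2: the coupling is s times 2Cρy / c, so its
contribution has a single factor β and no cross term in z and y arises. -/
theorem sq_mean_le {c C β ρ y z : ℝ} (hc : 0 < c) (hβ : 0 ≤ β) (h : c * β ≤ 1) :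
    ((1 - c / 2 * β) * z + C * (β * ρ) * y) ^ 2
      ≤ (1 - c / 2 * β) * z ^ 2 + 2 * C ^ 2 / c * β * ρ ^ 2 * y ^ 2 := by
  have h1 := sq_convex_le (s := c / 2 * β) (z := z) (t := 2 * C * ρ * y / c) (by positivity)
    (by linarith)
  have e1 : C * (β * ρ) * y = c / 2 * β * (2 * C * ρ * y / c) := by field_simp
  have e2 : 2 * C ^ 2 / c * β * ρ ^ 2 * y ^ 2 = c / 2 * β * (2 * C * ρ * y / c) ^ 2 := by
    field_simp
  rw [e1, e2]
  exact h1

end ScalarSteps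

namespace TTSA

variable {Ω : Type u} {𝒳 : Type v} {dθ dw : ℕ} (T : TTSA Ω 𝒳 dθ dw)
  [MeasurableSpace Ω] [MeasurableSpace 𝒳] (μ : Measure Ω)

/-- The standing assumptions on the noise. -/
structure IsRegular (p m_V m_W : ℝ) : Prop where
  measurable_X : ∀ k, Measurable (T.X k)
  measurable_oracle : T.oracle.IsMeasurable
  bounded : T.oracle.IsBounded T.sys
  two_le : 2 ≤ p
  m_V_pos : 0 < m_V
  m_W_pos : 0 < m_W
  moment : T.MomentBound μ p m_V m_W
  zeroMean : T.ZeroMean μ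

/-- The `p`-th moment of the decoupled fast error in the norm `‖B ·‖`. -/
noncomputable def fastMoment (B : Matrix (Fin dw) (Fin dw) ℝ) (p : ℝ) (k : ℕ) : ℝ :=
  lpNorm (fun ω => B.toEuclideanLin (T.wtilde k ω)) (ENNReal.ofReal p) μ

/-- The `p`-th moment of the corrected slow error in the norm `‖B ·‖`. -/
noncomputable def slowMoment (B : Matrix (Fin dθ) (Fin dθ) ℝ) (p : ℝ) (k : ℕ) : ℝ :=
  lpNorm (fun ω => B.toEuclideanLin (T.zerr k ω)) (ENNReal.ofReal p) μ

variable {T μ} {p m_V m_W : ℝ}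

theorem IsRegular.one_le (hT : T.IsRegular μ p m_V m_W) : 1 ≤ ENNReal.ofReal p := by
  rw [ENNReal.one_le_ofReal]
  linarith [hT.two_le]

variable [IsProbabilityMeasure μ]

theorem IsRegular.memLp {F : Type*} [NormedAddCommGroup F] [MeasurableSpace F] [BorelSpace F]
    [SecondCountableTopology F] (hT : T.IsRegular μ p m_V m_W) {k : ℕ} {f : Ω → F} (q : ENNReal)
    (hf : Measurable[T.ℱ k] f) (hb : IsBddFun f) : MemLp f q μ :=
  MemLp.of_bounded ((hf.mono (T.ℱ_le hT.measurable_X k) le_rfl).aestronglyMeasurable) hb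

/-- All variables are bounded, so the moments are finite and the assumed bounds pass from extended
to real numbers. -/
theorem IsRegular.lpNorm_noise_le (hT : T.IsRegular μ p m_V m_W) (k : ℕ) :
    lpNorm (T.Vsucc k) (ENNReal.ofReal p) μ + lpNorm (T.Wsucc k) (ENNReal.ofReal p) μ
      ≤ (m_V + m_W) * (1 + lpNorm (T.θtilde k) (ENNReal.ofReal p) μ
        + lpNorm (T.werr k) (ENNReal.ofReal p) μ) := by
  have hO := hT.measurable_oracle
  have hb := hT.bounded
  have hmV := hT.m_V_pos
  have hmW := hT.m_W_pos
  have hθ := hT.memLp (ENNReal.ofReal p) (T.measurable_θtilde hO k) (T.isBddFun_θtilde hb k)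
  have hw := hT.memLp (ENNReal.ofReal p) (T.measurable_werr hO k) (T.isBddFun_werr hb k)
  have hV : MemLp (T.Vsucc k) (ENNReal.ofReal p) μ := MemLp.of_bounded
    (T.measurable_Vsucc hT.measurable_X hO k).aestronglyMeasurable (T.isBddFun_Vsucc hb k)
  have hW : MemLp (T.Wsucc k) (ENNReal.ofReal p) μ := MemLp.of_bounded
    (T.measurable_Wsucc hT.measurable_X hO k).aestronglyMeasurable (T.isBddFun_Wsucc hb k)
  have h0 : (0 : ℝ) ≤ lpNorm (T.θtilde k) (ENNReal.ofReal p) μ := lpNorm_nonneg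
  have h1 : (0 : ℝ) ≤ lpNorm (T.werr k) (ENNReal.ofReal p) μ := lpNorm_nonneg
  obtain ⟨hV1, hW1⟩ := hT.moment k
  rw [← ofReal_lpNorm hθ, ← ofReal_lpNorm hw, ← ENNReal.ofReal_one,
    ← ENNReal.ofReal_add one_pos.le h0, ← ENNReal.ofReal_add (by positivity) h1] at hV1 hW1
  rw [← ofReal_lpNorm hV, ← ENNReal.ofReal_mul hmV.le,
    ENNReal.ofReal_le_ofReal_iff (by positivity)] at hV1
  rw [← ofReal_lpNorm hW, ← ENNReal.ofReal_mul hmW.le,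
    ENNReal.ofReal_le_ofReal_iff (by positivity)] at hW1
  linarith

variable {B₁ : Matrix (Fin dθ) (Fin dθ) ℝ} {B₂ : Matrix (Fin dw) (Fin dw) ℝ} {c₁ c₂ C : ℝ} {k : ℕ}

theorem IsRegular.memLp_fast (hT : T.IsRegular μ p m_V m_W) (B : Matrix (Fin dw) (Fin dw) ℝ)
    (k : ℕ) (q : ENNReal) : MemLp (fun ω => B.toEuclideanLin (T.wtilde k ω)) q μ :=
  hT.memLp q (T.measurable_toEuclideanLin_wtilde hT.measurable_oracle B k)
    ((isBddFun_const B).toEuclideanLin (T.isBddFun_wtilde hT.bounded k))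

theorem IsRegular.memLp_slow (hT : T.IsRegular μ p m_V m_W) (B : Matrix (Fin dθ) (Fin dθ) ℝ)
    (k : ℕ) (q : ENNReal) : MemLp (fun ω => B.toEuclideanLin (T.zerr k ω)) q μ :=
  hT.memLp q (T.measurable_toEuclideanLin_zerr hT.measurable_oracle B k)
    ((isBddFun_const B).toEuclideanLin (T.isBddFun_zerr hT.bounded k))

theorem IsRegular.lpNorm_θtilde_le (hT : T.IsRegular μ p m_V m_W)
    (hB : T.sys.StepBounds T.β T.γ k B₁ B₂ c₁ c₂ C) (hC : 0 < C) (hρ0 : 0 < T.β k / T.γ k) :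
    lpNorm (T.θtilde k) (ENNReal.ofReal p) μ
      ≤ C * (T.slowMoment μ B₁ p k + T.β k / T.γ k * T.fastMoment μ B₂ p k) := by
  have h1 := lpNorm_le_of_norm_le (f := T.θtilde k) hT.one_le hC.le
    (by positivity : 0 ≤ C * (T.β k / T.γ k)) (hT.memLp_slow B₁ k _) (hT.memLp_fast B₂ k _)
    fun ω => by
      rw [T.θtilde_eq k ω]
      refine (hB.slowErr_le _ _).trans (le_of_eq ?_)
      ring
  rw [fastMoment, slowMoment]
  linarith

/-- The noise moments in terms of the decoupled errors. -/
theorem IsRegular.lpNorm_noise_le' (hT : T.IsRegular μ p m_V m_W)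
    (hB : T.sys.StepBounds T.β T.γ k B₁ B₂ c₁ c₂ C) (hC : 0 < C) (hρ0 : 0 < T.β k / T.γ k)
    (hρ1 : T.β k / T.γ k ≤ 1) :
    lpNorm (T.Vsucc k) (ENNReal.ofReal p) μ + lpNorm (T.Wsucc k) (ENNReal.ofReal p) μ
      ≤ (m_V + m_W) * (1 + C) ^ 2 * (1 + T.slowMoment μ B₁ p k + T.fastMoment μ B₂ p k) := by
  have hy0 : 0 ≤ T.fastMoment μ B₂ p k := lpNorm_nonneg
  have hz0 : 0 ≤ T.slowMoment μ B₁ p k := lpNorm_nonneg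
  have hmV := hT.m_V_pos
  have hmW := hT.m_W_pos
  have hθ := hT.lpNorm_θtilde_le hB hC hρ0
  have hwerr : lpNorm (T.werr k) (ENNReal.ofReal p) μ
      ≤ C * (lpNorm (T.θtilde k) (ENNReal.ofReal p) μ + T.fastMoment μ B₂ p k) := by
    have h1 := lpNorm_le_of_norm_le (f := T.werr k) hT.one_le hC.le hC.le
      (hT.memLp (ENNReal.ofReal p) (T.measurable_θtilde hT.measurable_oracle k)
        (T.isBddFun_θtilde hT.bounded k)) (hT.memLp_fast B₂ k _)
      fun ω => by
        rw [T.werr_eq k ω]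
        refine (hB.fastErr_le _ _).trans (le_of_eq ?_)
        ring
    rw [fastMoment]
    linarith
  have hn := hT.lpNorm_noise_le k
  generalize lpNorm (T.Vsucc k) (ENNReal.ofReal p) μ = v at *
  generalize lpNorm (T.Wsucc k) (ENNReal.ofReal p) μ = w at *
  generalize lpNorm (T.θtilde k) (ENNReal.ofReal p) μ = t at *
  generalize lpNorm (T.werr k) (ENNReal.ofReal p) μ = t' at *
  generalize T.fastMoment μ B₂ p k = y at *
  generalize T.slowMoment μ B₁ p k = z at *
  have hθ' : t ≤ C * (z + y) := by
    refine hθ.trans (mul_le_mul_of_nonneg_left ?_ hC.le)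
    have := mul_le_mul_of_nonneg_right hρ1 hy0
    linarith
  have hsum : 1 + t + t' ≤ (1 + C) ^ 2 * (1 + z + y) := by
    have h1 := mul_le_mul_of_nonneg_left hθ' hC.le
    have h2 : 0 ≤ C * z := by positivity
    have h3 : 0 ≤ C ^ 2 := by positivity
    linarith
  have h1 := mul_le_mul_of_nonneg_left hsum (by positivity : 0 ≤ m_V + m_W)
  linarith

theorem IsRegular.fastMoment_succ_le (hT : T.IsRegular μ p m_V m_W) (hA : IsUnit T.sys.A22)
    (hB : T.sys.StepBounds T.β T.γ k B₁ B₂ c₁ c₂ C) (hc₂ : 0 < c₂) (hC : 0 < C)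
    (hβ : 0 < T.β k) (hγ : 0 < T.γ k) (hγ1 : c₂ * T.γ k ≤ 1) (hρ1 : T.β k / T.γ k ≤ 1) :
    T.fastMoment μ B₂ p (k + 1) ^ 2 ≤ (1 - c₂ / 2 * T.γ k) * T.fastMoment μ B₂ p k ^ 2
      + 18 * (C * ((m_V + m_W) * (1 + C) ^ 2)) ^ 2 * p * T.γ k ^ 2
        * (1 + T.slowMoment μ B₁ p k ^ 2 + T.fastMoment μ B₂ p k ^ 2) := by
  have hO := hT.measurable_oracle
  have hp := hT.two_le
  have hs0 : 0 ≤ 1 - c₂ / 2 * T.γ k := by linarith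
  obtain ⟨P, R, hPR⟩ := T.sys.exists_fastNoise_eq T.β T.γ k B₂
  have hstep : (fun ω => B₂.toEuclideanLin (T.wtilde (k + 1) ω))
      = fun ω => B₂.toEuclideanLin (T.sys.fastMean T.β T.γ k (T.wtilde k ω))
        + (P (T.Vsucc k ω) + R (T.Wsucc k ω)) := by
    funext ω
    rw [T.wtilde_succ hA hB.isUnit, map_add, hPR]
  have hcont : Continuous fun w => B₂.toEuclideanLin (T.sys.fastMean T.β T.γ k w) :=
    (LinearMap.continuous_of_finiteDimensional _).comp (T.sys.continuous_fastMean T.β T.γ k)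
  have hXm : StronglyMeasurable[T.ℱ k]
      fun ω => B₂.toEuclideanLin (T.sys.fastMean T.β T.γ k (T.wtilde k ω)) :=
    (hcont.measurable.comp (T.measurable_wtilde hO k)).stronglyMeasurable
  have hg := (hT.memLp_fast B₂ k 1).1
  have hgb := (isBddFun_const B₂).toEuclideanLin (T.isBddFun_wtilde hT.bounded k)
  have hmain := sq_lpNorm_step_le (T.ℱ_le hT.measurable_X k) hp hs0 (le_refl (0 : ℝ))
    (by positivity : 0 ≤ C * T.γ k) P R hXm hg hg
    (T.measurable_Vsucc hT.measurable_X hO k).aestronglyMeasurable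
    (T.measurable_Wsucc hT.measurable_X hO k).aestronglyMeasurable hgb hgb
    (T.isBddFun_Vsucc hT.bounded k) (T.isBddFun_Wsucc hT.bounded k)
    (hT.zeroMean k).1 (hT.zeroMean k).2
    (fun ω => by rw [zero_mul, add_zero]; exact hB.fastMean_le _)
    (fun v w => by rw [← hPR]; exact hB.fastNoise_le v w)
  rw [← hstep] at hmain
  have hn := hT.lpNorm_noise_le' hB hC (div_pos hβ hγ) hρ1
  have hN0 : 0 ≤ lpNorm (T.Vsucc k) (ENNReal.ofReal p) μ
    + lpNorm (T.Wsucc k) (ENNReal.ofReal p) μ := add_nonneg lpNorm_nonneg lpNorm_nonneg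
  have hnoise := noise_sq_le (by linarith : 0 ≤ p) hγ.le hN0 rfl hC.le hn
  -- Without coupling this is just (1 - s)² ≤ 1 - s.
  have hmean := sq_mean_le (C := 0) (ρ := 0) (y := 0) (z := T.fastMoment μ B₂ p k) hc₂ hγ.le hγ1
  rw [zero_mul, add_zero] at hmain
  rw [zero_mul, zero_mul, add_zero, zero_pow two_ne_zero, mul_zero, add_zero] at hmean
  exact hmain.trans (add_le_add hmean hnoise)

theorem IsRegular.slowMoment_succ_le (hT : T.IsRegular μ p m_V m_W) (hA : IsUnit T.sys.A22)
    (hB : T.sys.StepBounds T.β T.γ k B₁ B₂ c₁ c₂ C) (hc₁ : 0 < c₁) (hC : 0 < C)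
    (hβ : 0 < T.β k) (hγ : 0 < T.γ k) (hβ1 : c₁ * T.β k ≤ 1) (hρ1 : T.β k / T.γ k ≤ 1) :
    T.slowMoment μ B₁ p (k + 1) ^ 2 ≤ (1 - c₁ / 2 * T.β k) * T.slowMoment μ B₁ p k ^ 2
      + 2 * C ^ 2 / c₁ * T.β k * (T.β k / T.γ k) ^ 2 * T.fastMoment μ B₂ p k ^ 2
      + 18 * (C * ((m_V + m_W) * (1 + C) ^ 2)) ^ 2 * p * T.β k ^ 2
        * (1 + T.slowMoment μ B₁ p k ^ 2 + T.fastMoment μ B₂ p k ^ 2) := by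
  have hO := hT.measurable_oracle
  have hp := hT.two_le
  have hs0 : 0 ≤ 1 - c₁ / 2 * T.β k := by linarith
  have hρ0 : 0 < T.β k / T.γ k := div_pos hβ hγ
  obtain ⟨P, R, hPR⟩ := T.sys.exists_slowNoise_eq T.β T.γ k B₁
  have hstep : (fun ω => B₁.toEuclideanLin (T.zerr (k + 1) ω))
      = fun ω => B₁.toEuclideanLin (T.sys.slowMean T.β T.γ k (T.zerr k ω) (T.wtilde k ω))
        + (P (T.Vsucc k ω) + R (T.Wsucc k ω)) := by
    funext ω
    rw [T.zerr_succ hA hγ.ne' hB.isUnit, map_add, hPR]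
  have hcont : Continuous fun x : EuclideanSpace ℝ (Fin dθ) × EuclideanSpace ℝ (Fin dw) =>
      B₁.toEuclideanLin (T.sys.slowMean T.β T.γ k x.1 x.2) :=
    (LinearMap.continuous_of_finiteDimensional _).comp (T.sys.continuous_slowMean T.β T.γ k)
  have hmeas : Measurable[T.ℱ k] fun ω => (T.zerr k ω, T.wtilde k ω) :=
    T.measurable_zerr_wtilde hO k
  have hXm : StronglyMeasurable[T.ℱ k] fun ω =>
      B₁.toEuclideanLin (T.sys.slowMean T.β T.γ k (T.zerr k ω) (T.wtilde k ω)) :=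
    (hcont.measurable.comp hmeas).stronglyMeasurable
  have hmain := sq_lpNorm_step_le (T.ℱ_le hT.measurable_X k) hp hs0
    (by positivity : 0 ≤ C * (T.β k * (T.β k / T.γ k)))
    (by positivity : 0 ≤ C * T.β k) P R hXm (hT.memLp_slow B₁ k 1).1 (hT.memLp_fast B₂ k 1).1
    (T.measurable_Vsucc hT.measurable_X hO k).aestronglyMeasurable
    (T.measurable_Wsucc hT.measurable_X hO k).aestronglyMeasurable
    ((isBddFun_const B₁).toEuclideanLin (T.isBddFun_zerr hT.bounded k))
    ((isBddFun_const B₂).toEuclideanLin (T.isBddFun_wtilde hT.bounded k))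
    (T.isBddFun_Vsucc hT.bounded k) (T.isBddFun_Wsucc hT.bounded k)
    (hT.zeroMean k).1 (hT.zeroMean k).2
    (fun ω => hB.slowMean_le _ _)
    (fun v w => by rw [← hPR]; exact hB.slowNoise_le v w)
  rw [← hstep] at hmain
  have hn := hT.lpNorm_noise_le' hB hC hρ0 hρ1
  have hN0 : 0 ≤ lpNorm (T.Vsucc k) (ENNReal.ofReal p) μ
    + lpNorm (T.Wsucc k) (ENNReal.ofReal p) μ := add_nonneg lpNorm_nonneg lpNorm_nonneg
  have hnoise := noise_sq_le (by linarith : 0 ≤ p) hβ.le hN0 rfl hC.le hn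
  have hmean := sq_mean_le (C := C) (ρ := T.β k / T.γ k) (y := T.fastMoment μ B₂ p k)
    (z := T.slowMoment μ B₁ p k) hc₁ hβ.le hβ1
  exact hmain.trans (add_le_add hmean hnoise)

end TTSA

end Moments

/-! ### Choice of constants and conclusion -/

section Conclusion

theorem contractionRate_nonneg {d : ℕ} (A : Matrix (Fin d) (Fin d) ℝ) : 0 ≤ contractionRate A := by
  unfold contractionRate; positivity

/-- Square roots are taken here. The natural factor is √p, which is relaxed to pⁿ through p ≤ (pⁿ)².
-/
theorem le_mul_add_of_sq_le {N κ P M H p η : ℝ} {n : ℕ} (hn : n ≠ 0) (hκ : 0 ≤ κ) (hP : 0 ≤ P)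
    (hM : 0 ≤ M) (hH : 0 ≤ H) (hp : 1 ≤ p) (hη : 0 ≤ η)
    (h : N ^ 2 ≤ κ * (P ^ 2 * M + H * p * η)) :
    N ≤ (√(κ * M) + √(κ * H)) * (P + p ^ n * η ^ (1 / 2 : ℝ)) := by
  rw [← Real.sqrt_eq_rpow]
  have hpn : p ≤ p ^ n := le_self_pow₀ hp hn
  have hpn2 : p ≤ (p ^ n) ^ 2 := hpn.trans (le_self_pow₀ (one_le_pow₀ hp) two_ne_zero)
  have h1 : N ^ 2 ≤ (√(κ * M) * P + √(κ * H) * (p ^ n * √η)) ^ 2 := by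
    have e1 := Real.sq_sqrt (mul_nonneg hκ hM)
    have e2 := Real.sq_sqrt (mul_nonneg hκ hH)
    have e3 := Real.sq_sqrt hη
    have h2 : 0 ≤ √(κ * M) * P * (√(κ * H) * (p ^ n * √η)) := by positivity
    have h3 : κ * H * p * η ≤ κ * H * (p ^ n) ^ 2 * η := by gcongr
    calc N ^ 2 ≤ κ * M * P ^ 2 + κ * H * p * η := h.trans_eq (by ring)
      _ ≤ κ * M * P ^ 2 + κ * H * (p ^ n) ^ 2 * η := by linarith
      _ = √(κ * M) ^ 2 * P ^ 2 + √(κ * H) ^ 2 * (p ^ n) ^ 2 * √η ^ 2 := by rw [e1, e2, e3]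
      _ ≤ _ := by linarith
  have h2 : 0 ≤ √(κ * M) * P + √(κ * H) * (p ^ n * √η) := by positivity
  have h3 := abs_le_of_sq_le_sq' h1 h2 |>.2
  have h4 : 0 ≤ √(κ * M) * (p ^ n * √η) := by positivity
  have h5 : 0 ≤ √(κ * H) * P := by positivity
  linarith

namespace TTSA

variable {Ω : Type u} {𝒳 : Type v} {dθ dw : ℕ} {T : TTSA Ω 𝒳 dθ dw}
  [MeasurableSpace Ω] {μ : Measure Ω} [IsProbabilityMeasure μ]

theorem fastMoment_zero_le {p : ℝ} (hp : 0 < p) (B : Matrix (Fin dw) (Fin dw) ℝ) :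
    T.fastMoment μ B p 0 ≤ ‖B‖ * ‖T.w₀ - T.sys.wstar
      + (T.sys.A22⁻¹ * T.sys.A21).toEuclideanLin (T.θ₀ - T.sys.θstar)‖ := by
  have e : (fun ω => B.toEuclideanLin (T.wtilde 0 ω)) = fun _ => B.toEuclideanLin (T.w₀
      - T.sys.wstar + (T.sys.A22⁻¹ * T.sys.A21).toEuclideanLin (T.θ₀ - T.sys.θstar)) := by
    funext ω
    simp only [wtilde, werr, θtilde, iter, LinSystem.L, zero_add]
  rw [fastMoment, e, lpNorm_const' (by simpa using hp) ENNReal.ofReal_ne_top]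
  simp only [probReal_univ, Real.one_rpow, mul_one]
  exact Matrix.norm_toEuclideanLin_le _ _

/-- The start is deterministic and L₀ = 0, so the bound is free of p; using ρ₀ ≤ 1 also frees it of
k₀. -/
theorem slowMoment_zero_le {p : ℝ} (hp : 0 < p) (hρ0 : 0 ≤ T.β 0 / T.γ 0)
    (hρ1 : T.β 0 / T.γ 0 ≤ 1) (B : Matrix (Fin dθ) (Fin dθ) ℝ) :
    T.slowMoment μ B p 0 ≤ ‖B‖ * (‖T.θ₀ - T.sys.θstar‖ + ‖T.sys.drive‖ * ‖T.w₀ - T.sys.wstar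
      + (T.sys.A22⁻¹ * T.sys.A21).toEuclideanLin (T.θ₀ - T.sys.θstar)‖) := by
  set w := T.w₀ - T.sys.wstar
      + (T.sys.A22⁻¹ * T.sys.A21).toEuclideanLin (T.θ₀ - T.sys.θstar) with hw
  have e : (fun ω => B.toEuclideanLin (T.zerr 0 ω)) = fun _ => B.toEuclideanLin
      (T.θ₀ - T.sys.θstar - (T.β 0 / T.γ 0) • T.sys.drive.toEuclideanLin w) := by
    funext ω
    simp only [hw, zerr, wtilde, werr, θtilde, iter, LinSystem.L, zero_add]
  rw [slowMoment, e, lpNorm_const' (by simpa using hp) ENNReal.ofReal_ne_top]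
  have h : ‖T.θ₀ - T.sys.θstar - (T.β 0 / T.γ 0) • T.sys.drive.toEuclideanLin w‖
      ≤ ‖T.θ₀ - T.sys.θstar‖ + ‖T.sys.drive‖ * ‖w‖ := by
    refine (norm_sub_le _ _).trans (add_le_add_right ?_ _)
    rw [norm_smul, Real.norm_of_nonneg hρ0]
    exact (mul_le_of_le_one_left (norm_nonneg _) hρ1).trans (Matrix.norm_toEuclideanLin_le _ _)
  simp only [probReal_univ, Real.one_rpow, mul_one]
  exact Matrix.norm_toEuclideanLin_le_of_le le_rfl h

end TTSA

/-- Moment bounds for the decoupled errors of a two-timescale scheme whose step sizes are small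
and well separated. -/
theorem LinSystem.exists_moment_bound {dθ dw : ℕ} (S : LinSystem dθ dw)
    (hA22 : IsHurwitz (-S.A22)) (hΔ : IsHurwitz (-S.Δ)) {m_V m_W : ℝ} (hmV : 0 < m_V)
    (hmW : 0 < m_W) :
    ∃ ε > 0, ∀ (θ₀ : EuclideanSpace ℝ (Fin dθ)) (w₀ : EuclideanSpace ℝ (Fin dw)), ∃ C > 0,
      ∀ (p : ℝ) (β γ : ℕ → ℝ), SmallSteps p ε β γ →
      (∀ k, IsUnit (1 - β k • S.U β γ k)) ∧
      ∀ (Ω : Type u) (𝒳 : Type v) [MeasurableSpace Ω] [MeasurableSpace 𝒳]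
        (μ : Measure Ω) [IsProbabilityMeasure μ] (T : TTSA Ω 𝒳 dθ dw),
        T.sys = S → T.β = β → T.γ = γ → T.θ₀ = θ₀ → T.w₀ = w₀ → T.IsRegular μ p m_V m_W →
        ∀ k : ℕ,
          lpNorm (T.θtilde (k + 1)) (ENNReal.ofReal p) μ ≤
            C * (∏ j ∈ Finset.range (k + 1), (1 - β j * S.aΔ / 8)
              + p ^ 2 * β k ^ (1 / 2 : ℝ)) ∧
          lpNorm (T.wtilde (k + 1)) (ENNReal.ofReal p) μ ≤
            C * (∏ j ∈ Finset.range (k + 1), (1 - γ j * S.a22 / 8)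
              + p ^ 3 * γ k ^ (1 / 2 : ℝ)) := by
  obtain ⟨B₁, c₁, M₁, τ₁, hac₁, -, hB₁⟩ := hΔ.exists_lyapunov_factor
  obtain ⟨B₂, c₂, M₂, τ₂, hac₂, hAu, hB₂⟩ := hA22.exists_lyapunov_factor
  have hc₁ := hB₁.rate_pos
  have hc₂ := hB₂.rate_pos
  have hM₂ := hB₂.cond_pos
  have ha₁ : 0 ≤ S.aΔ := contractionRate_nonneg _
  have ha₂ : 0 ≤ S.a22 := contractionRate_nonneg _
  obtain ⟨ε₁, hε₁, C₁, hC₁, hstep⟩ := S.exists_stepBounds hB₁ hB₂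
  set D₁ := 18 * (C₁ * ((m_V + m_W) * (1 + C₁) ^ 2)) ^ 2 with hD₁
  set D₂ := 2 * C₁ ^ 2 / c₁ with hD₂
  have hD₁0 : 0 ≤ D₁ := by positivity
  have hD₂0 : 0 ≤ D₂ := by positivity
  obtain ⟨ε₂, hε₂, H, hH, hscalar⟩ := exists_bound_of_two_timescale (a₁ := S.aΔ) (a₂ := S.a22)
    (C := D₁ + D₂) ha₁ hc₁ hac₁ hc₂ hac₂ (by positivity)
  obtain ⟨ε, hε, hεi⟩ := exists_pos_mul_le ![1, 1, 1, c₁, c₂] ![ε₁, ε₂, 1, 1, 1]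
    (by intro i; fin_cases i <;> simp <;> positivity)
  have h₀ : 1 * ε ≤ ε₁ := hεi 0
  have h₁ : 1 * ε ≤ ε₂ := hεi 1
  have h₂ : 1 * ε ≤ 1 := hεi 2
  have h₃ : c₁ * ε ≤ 1 := hεi 3
  have h₄ : c₂ * ε ≤ 1 := hεi 4
  refine ⟨ε, hε, fun θ₀ w₀ => ?_⟩
  set n := ‖w₀ - S.wstar + (S.A22⁻¹ * S.A21).toEuclideanLin (θ₀ - S.θstar)‖ with hn
  -- A bound for the sum of the initial squared moments that is uniform in p and in the step sizes.
  -- It is the only place where the starting point enters, after ε has been fixed.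
  set M := (‖B₁‖ * (‖θ₀ - S.θstar‖ + ‖S.drive‖ * n)) ^ 2 + (‖B₂‖ * n) ^ 2 with hM
  have hM0 : 0 ≤ M := by positivity
  set K₁ := √(2 * C₁ ^ 2 * M) + √(2 * C₁ ^ 2 * H) with hK₁
  set K₂ := √(M₂ ^ 2 * M) + √(M₂ ^ 2 * (H * (1 + M))) with hK₂
  have hK₁0 : 0 ≤ K₁ := by positivity
  have hK₂0 : 0 ≤ K₂ := by positivity
  refine ⟨K₁ + K₂ + 1, by positivity, fun p β γ hs => ?_⟩
  have hSB := hstep p β γ (hs.mono (by linarith))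
  refine ⟨fun k => (hSB k).isUnit, ?_⟩
  intro Ω 𝒳 _ _ μ _ T hTS hTβ hTγ hTθ hTw hT k
  subst hTS hTβ hTγ hTθ hTw
  have hβ := hs.slow_pos
  have hγ := hs.fast_pos
  have hp2 := hs.two_le
  have hρ0 : ∀ k, 0 < T.β k / T.γ k := fun k => div_pos (hβ k) (hγ k)
  have hρ1 : ∀ k, T.β k / T.γ k ≤ 1 := fun k => (hs.ratio_le k).trans (by linarith)
  have hβ1 : ∀ k, c₁ * T.β k ≤ 1 := fun k =>
    (mul_le_mul_of_nonneg_left (hs.slow_le k) hc₁.le).trans h₃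
  have hγ1 : ∀ k, c₂ * T.γ k ≤ 1 := fun k =>
    (mul_le_mul_of_nonneg_left (hs.fast_le k) hc₂.le).trans h₄
  have hbounds := hscalar p T.β T.γ (hs.mono (by linarith))
    (fun k => T.fastMoment μ B₂ p k ^ 2) (fun k => T.slowMoment μ B₁ p k ^ 2)
    (fun k => sq_nonneg _) (fun k => sq_nonneg _)
    (fun k => by
      refine (hT.fastMoment_succ_le hAu (hSB k) hc₂ hC₁ (hβ k) (hγ k) (hγ1 k) (hρ1 k)).trans ?_
      have hγk := hγ k
      gcongr
      linarith)
    (fun k => by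
      refine (hT.slowMoment_succ_le hAu (hSB k) hc₁ hC₁ (hβ k) (hγ k) (hβ1 k) (hρ1 k)).trans ?_
      have hβk := hβ k
      gcongr
      · linarith
      · linarith)
    M (by
      have i1 := pow_le_pow_left₀ lpNorm_nonneg
        (T.slowMoment_zero_le (μ := μ) (by linarith : 0 < p) (hρ0 0).le (hρ1 0) B₁) 2
      have i2 := pow_le_pow_left₀ lpNorm_nonneg
        (T.fastMoment_zero_le (μ := μ) (by linarith : 0 < p) B₂) 2
      exact add_le_add i1 i2) (k + 1)
  obtain ⟨hb1, hb2⟩ := hbounds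
  have hP₁ := (prod_sq_le_one ha₁ hac₁ hβ hβ1 (k + 1)).1
  have hP₂ := (prod_sq_le_one ha₂ hac₂ hγ hγ1 (k + 1)).1
  have hp1 : 1 ≤ p := by linarith
  have hp0 : 0 ≤ p := by linarith
  have hβk := (hβ k).le
  have hγk := (hγ k).le
  constructor
  · have hθ := hT.lpNorm_θtilde_le (hSB (k + 1)) hC₁ (hρ0 (k + 1))
    have hsq : lpNorm (T.θtilde (k + 1)) (ENNReal.ofReal p) μ ^ 2 ≤ 2 * C₁ ^ 2 *
        ((∏ j ∈ Finset.range (k + 1), (1 - T.β j * T.sys.aΔ / 8)) ^ 2 * M + H * p * T.β k) := by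
      refine (pow_le_pow_left₀ lpNorm_nonneg hθ 2).trans ?_
      have i1 : H * p * T.β (k + 1) ≤ H * p * T.β k :=
        mul_le_mul_of_nonneg_left (hs.slow_anti k) (by positivity)
      have i2 := mul_le_mul_of_nonneg_left (hb1.trans (add_le_add_right i1 _))
        (by positivity : 0 ≤ 2 * C₁ ^ 2)
      refine le_trans ?_ i2
      -- This gives (z + ρy)² ≤ 2 (z² + ρ²y²), which is exactly the combination controlled by the
      -- scalar lemma.
      have i3 := mul_nonneg (sq_nonneg C₁) (sq_nonneg (T.slowMoment μ B₁ p (k + 1)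
        - T.β (k + 1) / T.γ (k + 1) * T.fastMoment μ B₂ p (k + 1)))
      linarith
    refine (le_mul_add_of_sq_le two_ne_zero (by positivity) hP₁ hM0 hH.le hp1 hβk hsq).trans ?_
    exact mul_le_mul_of_nonneg_right (by linarith) (by positivity)
  · have hw : lpNorm (T.wtilde (k + 1)) (ENNReal.ofReal p) μ
        ≤ M₂ * T.fastMoment μ B₂ p (k + 1) := by
      have i1 := lpNorm_le_of_norm_le (f := T.wtilde (k + 1)) (b := 0) hT.one_le hM₂.le le_rfl
        (hT.memLp_fast B₂ (k + 1) _) (hT.memLp_fast B₂ (k + 1) _)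
        fun ω => by rw [zero_mul, add_zero]; exact hB₂.norm_le _
      rwa [zero_mul, add_zero] at i1
    have hsq : lpNorm (T.wtilde (k + 1)) (ENNReal.ofReal p) μ ^ 2 ≤ M₂ ^ 2 *
        ((∏ j ∈ Finset.range (k + 1), (1 - T.γ j * T.sys.a22 / 8)) ^ 2 * M
          + H * (1 + M) * p * T.γ k) := by
      refine (pow_le_pow_left₀ lpNorm_nonneg hw 2).trans ?_
      rw [mul_pow]
      have i1 : H * (1 + M) * p * T.γ (k + 1) ≤ H * (1 + M) * p * T.γ k :=
        mul_le_mul_of_nonneg_left (hs.fast_anti k) (by positivity)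
      exact mul_le_mul_of_nonneg_left (hb2.trans (add_le_add_right i1 _)) (sq_nonneg _)
    refine (le_mul_add_of_sq_le three_ne_zero (by positivity) hP₂ hM0 (by positivity) hp1 hγk
      hsq).trans ?_
    exact mul_le_mul_of_nonneg_right (by linarith) (by positivity)

end Conclusion

theorem proposition3 {dθ dw : ℕ} (S : LinSystem dθ dw)
    (hA22 : IsHurwitz (-S.A22)) (hΔ : IsHurwitz (-S.Δ))
    (a b : ℝ) (ha : 1 / 2 < a) (hab : a < b) (hb : b < 1) :
    -- threshold for the ratio of the step-size constants
    ∃ r > 0, ∀ cβ cγ : ℝ, 0 < cβ → 0 < cγ → cβ / cγ ≤ r →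
    ∀ m_V m_W : ℝ, 0 < m_V → 0 < m_W →
    -- the constant in the lower bound on `k₀`
    ∃ K > 0, ∀ (θ₀ : EuclideanSpace ℝ (Fin dθ)) (w₀ : EuclideanSpace ℝ (Fin dw)),
    -- the constant in the two bounds: it depends neither on `k` nor on `p` (nor on `k₀`)
    ∃ C > 0, ∀ p k₀ : ℝ, 2 ≤ p → K * p ^ (4 / b) ≤ k₀ →
      -- the recursion for `L_k` is well defined
      (∀ k, IsUnit (1 - stepSize cβ b k₀ k • S.U (stepSize cβ b k₀) (stepSize cγ a k₀) k)) ∧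
      ∀ (Ω : Type u) (𝒳 : Type v) [MeasurableSpace Ω] [MeasurableSpace 𝒳]
        (μ : Measure Ω) [IsProbabilityMeasure μ] (T : TTSA Ω 𝒳 dθ dw),
        T.sys = S → T.β = stepSize cβ b k₀ → T.γ = stepSize cγ a k₀ →
        T.θ₀ = θ₀ → T.w₀ = w₀ →
        (∀ k, Measurable (T.X k)) → T.oracle.IsMeasurable →
        T.ZeroMean μ → T.MomentBound μ p m_V m_W → T.ConstantCovariance μ →
        T.oracle.IsBounded S →
        ∀ k : ℕ,
          eLpNorm (T.θtilde (k + 1)) (ENNReal.ofReal p) μ ≤ ENNReal.ofReal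
            (C * (∏ j ∈ Finset.range (k + 1), (1 - stepSize cβ b k₀ j * S.aΔ / 8)
              + p ^ 2 * stepSize cβ b k₀ k ^ (1 / 2 : ℝ))) ∧
          eLpNorm (T.wtilde (k + 1)) (ENNReal.ofReal p) μ ≤ ENNReal.ofReal
            (C * (∏ j ∈ Finset.range (k + 1), (1 - stepSize cγ a k₀ j * S.a22 / 8)
              + p ^ 3 * stepSize cγ a k₀ k ^ (1 / 2 : ℝ))) := by
  -- The value of r is not critical: since b > a, the separation of the time scales is obtained from
  -- K, through β_k / γ_k ≤ (cβ / cγ) K^{-(b - a)}.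
  refine ⟨1, one_pos, fun cβ cγ hcβ hcγ _ m_V m_W hmV hmW => ?_⟩
  obtain ⟨ε, hε, h⟩ := S.exists_moment_bound hA22 hΔ hmV hmW
  obtain ⟨K, hK, hsteps⟩ := exists_smallSteps ha hab hb hcβ hcγ hε
  refine ⟨K, hK, fun θ₀ w₀ => ?_⟩
  obtain ⟨C, hC, hbound⟩ := h θ₀ w₀
  refine ⟨C, hC, fun p k₀ hp hk₀ => ?_⟩
  obtain ⟨hunit, hmom⟩ := hbound p _ _ (hsteps p k₀ hp hk₀)
  refine ⟨hunit, ?_⟩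
  intro Ω 𝒳 _ _ μ _ T hS hβ hγ hθ hw hX hO hzero hmoment _ hb k
  have hT : T.IsRegular μ p m_V m_W := ⟨hX, hO, hS ▸ hb, hp, hmV, hmW, hmoment, hzero⟩
  obtain ⟨h1, h2⟩ := hmom Ω 𝒳 μ T hS hβ hγ hθ hw hT k
  -- Membership in L^p makes the real-valued `lpNorm` agree with `eLpNorm`, so the real estimates
  -- carry over.
  rw [← ofReal_lpNorm (hT.memLp _ (T.measurable_θtilde hO (k + 1)) (T.isBddFun_θtilde hb (k + 1))),
    ← ofReal_lpNorm (hT.memLp _ (T.measurable_wtilde hO (k + 1)) (T.isBddFun_wtilde hb (k + 1)))]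
  exact ⟨ENNReal.ofReal_le_ofReal h1, ENNReal.ofReal_le_ofReal h2⟩
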